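/- Let $n\ge 2$. A \emph{compact graph over $U$} is the graph in $\mathbb{R}^n\times\mathbb{R}=\mathbb{R}^{n+1}$ of a function $f:\overline U\setminus U_o\to\mathbb{R}$, where $U\subset\mathbb{R}^n$ is a bounded connected open set, $U_o$ is a (possibly empty) open set with $\overline{U_o}\subset U$, both with smooth boundary, and $f$ is continuous, smooth on $\overline U\setminus\overline{U_o}$ (up to $\partial U$), locally constant on $\partial U_o$, with $|Df|\to\infty$ at $\partial U_o$. Let $(\Omega,g)$ be a compact smooth Riemannian $n$-manifold with boundary. We write $(\Omega,g)\in\mathcal{A}_U$ if it can be smoothly isometrically embedded in $\mathbb{R}^{n+1}$ with image a compact graph over $U$ of some non-constant $f$ such that (i) the scalar curvature of the graph is non-negative; (ii) for almost every value $h$ of $f$ the level set $\{f=h\}$ is regular and strictly mean convex in $\mathbb{R}^n$ with respect to the normal $Df/|Df|$, and the sublevel set $\Omega_h=\{x\in\overline U:\bar f(x)<h\}$ is outer-minimizing in $\mathbb{R}^n$ (no bounded measurable set containing it has smaller perimeter), where $\bar f$ is the continuous extension of $f$ to $\overline U$ that is constant on each component of $U_o$ (assumed to exist); (iii) $f$ is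 locally constant on $\partial(\overline U\setminus U_o)$. We write $(\Omega,g)\in\mathcal{A}_C$ if it has non-negative scalar curvature and can be smoothly isometrically embedded in $\mathbb{R}^{n+1}$ with image $\overline U\times\{c\}$ for some constant $c$, where $U$ is a bounded connected open set with smooth boundary (the same $U$ as for $\mathcal{A}_U$). If $(\Omega,g)$ is realized in one of these ways as the graph of $f$, the Brown--York mass of the outer boundary is $$\mathbf{m}_{\mathrm{BY}}(\partial U)=\frac{1}{(n-1)\,\omega_{n-1}}\int_{\partial U}(H_o-H)\,dS,$$ where $\omega_{n-1}$ is the area of the unit sphere in $\mathbb{R}^n$, $H_o$ is the outward mean curvature of $\partial U$ in $\mathbb{R}^n$, and $H$ is the outward mean curvature of the part of the boundary over $\partial U$ in the graph of $f$, i.e. that of $\partial U$ for the metric $\delta+df\otimes df$. \textbf{Statement.} Let $(\Omega,g)\in\mathcal{A}_U\cup\mathcal{A}_C$, and let $f$ be any function realizing this. Then $\mathbf{m}_{\mathrm{BY}}(\partial U)=0$ if and only if $(\Omega,g)\in\mathcal{A}_C$. -/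

import Mathlib

open scoped Manifold ContDiff Topology MeasureTheory ENNReal

noncomputable section

namespace BYGraph

/-- `ℝⁿ` with its Euclidean structure. -/
abbrev Euc (n : ℕ) := EuclideanSpace ℝ (Fin n)

/-- `ℝⁿ⁺¹ = ℝⁿ × ℝ` with its Euclidean structure; the last factor is the vertical direction. -/
abbrev Amb (n : ℕ) := WithLp 2 (Euc n × ℝ)

/-! ### Riemannian geometry in the coordinates of `ℝⁿ` -/

/-- The partial derivative `∂ᵢφ` at `x`. -/
def pderiv {n : ℕ} (i : Fin n) (φ : Euc n → ℝ) (x : Euc n) : ℝ :=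
  fderiv ℝ φ x (EuclideanSpace.single i 1)

/-- The Euclidean metric `δᵢⱼ`. -/
def flatMetric (n : ℕ) : Euc n → Matrix (Fin n) (Fin n) ℝ := fun _ => 1

/-- The metric `δᵢⱼ + ∂ᵢf ∂ⱼf` induced on the graph of `f` by `ℝⁿ⁺¹`, in the coordinates
of `ℝⁿ`. -/
def graphMetric {n : ℕ} (f : Euc n → ℝ) : Euc n → Matrix (Fin n) (Fin n) ℝ :=
  fun x => Matrix.of fun i j => (if i = j then 1 else 0) + pderiv i f x * pderiv j f x

/-- The Christoffel symbol `Γᵏᵢⱼ` of a metric `g`. -/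
def christoffel {n : ℕ} (g : Euc n → Matrix (Fin n) (Fin n) ℝ) (k i j : Fin n)
    (x : Euc n) : ℝ :=
  (1 / 2) * ∑ l, (g x)⁻¹ k l *
    (pderiv i (fun y => g y j l) x + pderiv j (fun y => g y i l) x
      - pderiv l (fun y => g y i j) x)

/-- The Ricci tensor
`Ricᵢⱼ = ∂ₖΓᵏᵢⱼ - ∂ⱼΓᵏᵢₖ + Γᵏₖₗ Γˡᵢⱼ - Γᵏⱼₗ Γˡᵢₖ` of a metric `g`. -/
def ricci {n : ℕ} (g : Euc n → Matrix (Fin n) (Fin n) ℝ) (i j : Fin n) (x : Euc n) : ℝ :=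
  ∑ k, (pderiv k (christoffel g k i j) x - pderiv j (christoffel g k i k) x
    + ∑ l, (christoffel g k k l x * christoffel g l i j x
      - christoffel g k j l x * christoffel g l i k x))

/-- The scalar curvature `gⁱʲ Ricᵢⱼ` of a metric `g`. -/
def scalarCurvature {n : ℕ} (g : Euc n → Matrix (Fin n) (Fin n) ℝ) (x : Euc n) : ℝ :=
  ∑ i, ∑ j, (g x)⁻¹ i j * ricci g i j x

/-- The divergence `(det g)^{-1/2} ∂ᵢ((det g)^{1/2} Xⁱ)` of a vector field with respect to `g`. -/
def metricDiv {n : ℕ} (g : Euc n → Matrix (Fin n) (Fin n) ℝ) (X : Euc n → Fin n → ℝ)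
    (x : Euc n) : ℝ :=
  (Real.sqrt (g x).det)⁻¹ * ∑ i, pderiv i (fun y => Real.sqrt (g y).det * X y i) x

/-- The `g`-unit normal `∇φ / |∇φ|` to the level sets of `φ`, in the direction in which `φ`
increases; `∇φ` and `|·|` are taken with respect to `g`. -/
def unitNormal {n : ℕ} (g : Euc n → Matrix (Fin n) (Fin n) ℝ) (φ : Euc n → ℝ)
    (x : Euc n) (i : Fin n) : ℝ :=
  (∑ j, (g x)⁻¹ i j * pderiv j φ x) /
    Real.sqrt (∑ k, ∑ j, (g x)⁻¹ k j * pderiv k φ x * pderiv j φ x)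

/-- The mean curvature `H = div ν` at `x`, with respect to the metric `g`, of the level set of `φ`
through `x`, for the unit normal `ν` in the direction in which `φ` increases
(so the unit sphere in `ℝⁿ`, with `φ = |x|`, has `H = n - 1`). -/
def levelMeanCurvature {n : ℕ} (g : Euc n → Matrix (Fin n) (Fin n) ℝ) (φ : Euc n → ℝ)
    (x : Euc n) : ℝ :=
  metricDiv g (unitNormal g φ) x

/-! ### Domains with smooth boundary -/

/-- `ρ` is a smooth function with `dρ ≠ 0` at `x` and `V = {ρ < 0}` near `x`. -/
def IsDefiningAt {n : ℕ} (V : Set (Euc n)) (x : Euc n) (ρ : Euc n → ℝ) : Prop :=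
  ContDiff ℝ ∞ ρ ∧ fderiv ℝ ρ x ≠ 0 ∧ ∀ᶠ y in 𝓝 x, (y ∈ V ↔ ρ y < 0)

/-- The boundary of `V` is a smooth hypersurface, with `V` locally on one side of it. -/
def HasSmoothBoundary {n : ℕ} (V : Set (Euc n)) : Prop :=
  ∀ x ∈ frontier V, ∃ ρ, IsDefiningAt V x ρ

open Classical in
/-- The outward mean curvature of `∂V` at `x ∈ ∂V` with respect to the metric `g`: that of the
zero set of a local defining function, whose choice does not affect the value. -/
def boundaryMeanCurvature {n : ℕ} (g : Euc n → Matrix (Fin n) (Fin n) ℝ) (V : Set (Euc n))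
    (x : Euc n) : ℝ :=
  if h : ∃ ρ, IsDefiningAt V x ρ then levelMeanCurvature g h.choose x else 0

/-! ### Perimeter and outer-minimizing sets -/

/-- The Euclidean divergence of a vector field. -/
def euclDiv {n : ℕ} (X : Euc n → Euc n) (x : Euc n) : ℝ :=
  ∑ i, pderiv i (fun y => X y i) x

/-- The perimeter of a set in `ℝⁿ` in the sense of De Giorgi; it is the area `|∂*A|` of the
reduced boundary when it is finite. -/
def perimeter {n : ℕ} (A : Set (Euc n)) : ℝ≥0∞ :=
  ⨆ X ∈ {X : Euc n → Euc n | ContDiff ℝ 1 X ∧ HasCompactSupport X ∧ ∀ x, ‖X x‖ ≤ 1},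
    ENNReal.ofReal (∫ x in A, euclDiv X x)

/-- The (reduced) boundary of `A` is outer-minimizing in `ℝⁿ`: no bounded set containing `A` has a
boundary of smaller area. -/
def IsOuterMinimizing {n : ℕ} (A : Set (Euc n)) : Prop :=
  ∀ F : Set (Euc n), A ⊆ F → MeasurableSet F → Bornology.IsBounded F → perimeter A ≤ perimeter F

/-! ### Compact graphs -/

/-- `f`, restricted to `Ū \ Uₒ`, defines a compact graphical manifold with boundary. As usual,
smoothness up to `∂U` means that `f` is the restriction of a function which is smooth near each
point of `Ū \ Ūₒ`; the values of `f` away from a neighbourhood of `Ū \ Uₒ` are irrelevant. -/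
structure IsCompactGraph {n : ℕ} (U Uₒ : Set (Euc n)) (f : Euc n → ℝ) : Prop where
  isOpen : IsOpen U
  isConnected : IsConnected U
  isBounded : Bornology.IsBounded U
  smoothBoundary : HasSmoothBoundary U
  isOpen_inner : IsOpen Uₒ
  closure_inner_subset : closure Uₒ ⊆ U
  smoothBoundary_inner : HasSmoothBoundary Uₒ
  smooth : ∀ x ∈ closure U \ closure Uₒ, ContDiffAt ℝ ∞ f x
  continuousOn : ContinuousOn f (closure U \ Uₒ)
  /-- `f` is locally constant on `∂Uₒ` -/
  locallyConstant_inner : ∀ x ∈ frontier Uₒ, ∀ᶠ y in 𝓝[frontier Uₒ] x, f y = f x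
  /-- `|Df| → ∞` on `∂Uₒ` -/
  tendsto_inner : ∀ x ∈ frontier Uₒ,
    Filter.Tendsto (fun y => ‖fderiv ℝ f y‖) (𝓝[closure U \ closure Uₒ] x) Filter.atTop

/-- The scalar curvature of the graph of `f` is non-negative. -/
def NonnegScalarCurvature {n : ℕ} (U Uₒ : Set (Euc n)) (f : Euc n → ℝ) : Prop :=
  ∀ x ∈ closure U \ closure Uₒ, 0 ≤ scalarCurvature (graphMetric f) x

/-- `F` is the continuous extension of `f` to `Ū` which is constant on each component of `Uₒ`. -/
def IsFillIn {n : ℕ} (U Uₒ : Set (Euc n)) (f F : Euc n → ℝ) : Prop :=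
  Set.EqOn F f (closure U \ Uₒ) ∧ ContinuousOn F (closure U) ∧
    ∀ x ∈ Uₒ, ∀ᶠ y in 𝓝 x, F y = F x

/-- The level set `{f = h}` is regular and strictly mean convex in `ℝⁿ`, with respect to the
normal in the direction in which `f` increases. -/
def StrictlyMeanConvexLevel {n : ℕ} (U Uₒ : Set (Euc n)) (f : Euc n → ℝ) (h : ℝ) : Prop :=
  ∀ x ∈ closure U \ closure Uₒ, f x = h →
    fderiv ℝ f x ≠ 0 ∧ 0 < levelMeanCurvature (flatMetric n) f x

/-- The conditions on the graph function in the definition of the class `𝒜_U`. Almost every value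
`h` of `f` has a level set which is strictly mean convex and bounds, together with the filled in
set `Uₒ`, an outer-minimizing sublevel set. -/
structure IsAdmissible {n : ℕ} (U Uₒ : Set (Euc n)) (f : Euc n → ℝ) : Prop
    extends IsCompactGraph U Uₒ f where
  scalarCurvature_nonneg : NonnegScalarCurvature U Uₒ f
  strictlyMeanConvex : ∀ᵐ h : ℝ, h ∈ f '' (closure U \ Uₒ) → StrictlyMeanConvexLevel U Uₒ f h
  outerMinimizing : ∃ F, IsFillIn U Uₒ f F ∧
    ∀ᵐ h : ℝ, h ∈ f '' (closure U \ Uₒ) → IsOuterMinimizing {x ∈ closure U | F x < h}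
  /-- `f` is locally constant on the boundary of `Ū \ Uₒ` -/
  locallyConstant : ∀ x ∈ frontier (closure U \ Uₒ),
    ∀ᶠ y in 𝓝[frontier (closure U \ Uₒ)] x, f y = f x
  /-- graphs of constant functions are excluded -/
  not_constant : ¬ ∃ c, ∀ x ∈ closure U \ Uₒ, f x = c

/-- The graph of `f` is an entire graph over `Ū` of a constant function, with non-negative scalar
curvature. -/
structure IsConstantGraph {n : ℕ} (U : Set (Euc n)) (f : Euc n → ℝ) : Prop
    extends IsCompactGraph U ∅ f where
  scalarCurvature_nonneg : NonnegScalarCurvature U ∅ f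
  constant : ∃ c, ∀ x ∈ closure U, f x = c

/-- `graph[f]`, the graph of `f` over `Ū \ Uₒ` in `ℝⁿ⁺¹`. -/
def graphSet {n : ℕ} (U Uₒ : Set (Euc n)) (f : Euc n → ℝ) : Set (Amb n) :=
  {p | ∃ x ∈ closure U \ Uₒ, p = WithLp.toLp 2 (x, f x)}

/-! ### Riemannian manifolds realized as graphs -/

section Manifold

variable {n : ℕ} [NeZero n] {Ω : Type*} [TopologicalSpace Ω]
  [ChartedSpace (EuclideanHalfSpace n) Ω] [IsManifold (𝓡∂ n) ∞ Ω]

/-- A smooth Riemannian metric on the `n`-manifold with boundary `Ω`. -/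
abbrev SmoothMetric (n : ℕ) [NeZero n] (Ω : Type*) [TopologicalSpace Ω]
    [ChartedSpace (EuclideanHalfSpace n) Ω] [IsManifold (𝓡∂ n) ∞ Ω] :=
  Bundle.ContMDiffRiemannianMetric (𝓡∂ n) ∞ (Euc n) (fun x : Ω => TangentSpace (𝓡∂ n) x)

/-- `Φ` is a smooth isometric embedding of the Riemannian manifold `(Ω, g)` into `ℝⁿ⁺¹`. -/
structure IsIsometricEmbedding (g : SmoothMetric n Ω) (Φ : Ω → Amb n) : Prop where
  smooth : ContMDiff (𝓡∂ n) 𝓘(ℝ, Amb n) ∞ Φ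
  isEmbedding : Topology.IsEmbedding Φ
  isometric : ∀ (p : Ω) (v w : TangentSpace (𝓡∂ n) p),
    @inner ℝ (Amb n) _ (mfderiv (𝓡∂ n) 𝓘(ℝ, Amb n) Φ p v) (mfderiv (𝓡∂ n) 𝓘(ℝ, Amb n) Φ p w)
      = g.inner p v w

/-- `(Ω, g)` can be isometrically embedded in `ℝⁿ⁺¹` with image `graph[f]`. -/
def IsRealizedBy (g : SmoothMetric n Ω) (U Uₒ : Set (Euc n)) (f : Euc n → ℝ) : Prop :=
  ∃ Φ : Ω → Amb n, IsIsometricEmbedding g Φ ∧ Set.range Φ = graphSet U Uₒ f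

/-- `(Ω, g) ∈ 𝒜_U`, realized by the graph function `f : Ū \ Uₒ → ℝ`. -/
def RealizedInA_U (g : SmoothMetric n Ω) (U Uₒ : Set (Euc n)) (f : Euc n → ℝ) : Prop :=
  IsAdmissible U Uₒ f ∧ IsRealizedBy g U Uₒ f

/-- `(Ω, g) ∈ 𝒜_C`, realized by the constant graph function `f : Ū → ℝ`. -/
def RealizedInA_C (g : SmoothMetric n Ω) (U Uₒ : Set (Euc n)) (f : Euc n → ℝ) : Prop :=
  Uₒ = ∅ ∧ IsConstantGraph U f ∧ IsRealizedBy g U Uₒ f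

/-- `(Ω, g) ∈ 𝒜_C`. -/
def MemA_C (g : SmoothMetric n Ω) (U : Set (Euc n)) : Prop :=
  ∃ f : Euc n → ℝ, IsConstantGraph U f ∧ IsRealizedBy g U ∅ f

end Manifold

/-! ### Brown–York mass -/

/-- The Brown–York mass
`m_BY(∂U) = 1 / ((n - 1) ω_{n-1}) ∫_{∂U} (Hₒ - H) dS`
of the outer boundary of `graph[f]`, where `f` is locally constant on `∂U`. The piece of the
boundary over `∂U` is isometric to `∂U ⊂ ℝⁿ`, which is the isometric embedding from which `Hₒ` is
taken; `H` is the outward mean curvature in the metric of the graph, `dS` is the area measure and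
`ω_{n-1}` the area of the unit sphere in `ℝⁿ`. -/
def brownYorkMass {n : ℕ} (U : Set (Euc n)) (f : Euc n → ℝ) : ℝ :=
  1 / (((n : ℝ) - 1) * (MeasureTheory.volume : MeasureTheory.Measure (Euc n)).toSphere.real
      Set.univ) *
    ∫ x in frontier U, (boundaryMeanCurvature (flatMetric n) U x
      - boundaryMeanCurvature (graphMetric f) U x) ∂(μHE[n - 1])

end BYGraph

end

/-!
For an admissible graph the Brown–York mass of `∂U` is positive, and the graph is not isometric to
a flat domain `Ū × {c}`; for a constant graph the mass is zero. This gives the equivalence.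

*The integrand.* If `f` is constant along `∂U`, then the mean curvature of `∂U` in the graph is
`H = H_o / √(1 + |Df|²)`, so that `H_o - H = H_o (1 - 1 / √(1 + |Df|²))`
(`IsDefiningAt.boundaryMeanCurvature_graph_eq_div`). In particular it vanishes for constant graphs.
For an admissible graph it is non-negative (`IsAdmissible.boundaryMeanCurvature_nonneg`): where `f`
is below its maximum, a sublevel set agrees with `Ū` near the boundary point, and an
outer-minimizing set has `H_o ≥ 0` by the first variation of area (`not_isOuterMinimizing`, proved
by calibration); where `f` is maximal and `Df ≠ 0`, `H_o` is a limit of mean curvatures of level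
sets of `f`.

*Strict positivity.* The Gauss equation (`scalarCurvature_graphMetric`) shows that non-negative
scalar curvature and a mean convex level set make the mean curvature of the graph positive
(`graphMean_pos`). Regular values of `f` with mean convex level set are dense, so this mean
curvature is non-negative on all of `U \ Ūₒ` (`IsAdmissible.graphMean_nonneg`). A point farthest
from the origin in a high superlevel set of `f` lies on `∂U`, at the maximal height, and `H_o > 0`
there (`IsAdmissible.exists_frontier_isMax`). If the mass vanished, then `Df = 0` on `∂U` near this
point, and the boundary point lemma together with the strong maximum principle (`eq_max_near`) would
make `f` constant.

*No flat realization.* A second realization of `(Ω, g)` by `Ū × {c}` gives a bijection `ψ` of `Ū`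
with the graph of `f`, with a strict isometric derivative up to the boundary
(`exists_isometric_transition`). Interior points of `Ū` cannot go to points over `∂U ∪ ∂Uₒ`
(`not_contact_vertical`), so that `∂U ∪ ∂Uₒ` is contained in the image of `∂U` under a map which does
not increase area; hence `Uₒ = ∅`. Comparison of the volumes of `U` and of its image under the
horizontal part of `ψ` then gives `Df = 0` (`IsIsometricTransition.exists_eq_const`).
-/


open scoped NNReal

namespace BYGraph

/-! ### Partial derivatives -/

section PartialDerivatives

variable {n : ℕ} {f g φ : Euc n → ℝ} {x : Euc n}

lemma pderiv_congr (h : f =ᶠ[𝓝 x] g) (i : Fin n) : pderiv i f x = pderiv i g x := by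
  simp only [pderiv, h.fderiv_eq]

lemma pderiv_const (i : Fin n) (c : ℝ) : pderiv i (fun _ => c) x = 0 := by
  simp [pderiv]

lemma pderiv_add (hf : DifferentiableAt ℝ f x) (hg : DifferentiableAt ℝ g x) (i : Fin n) :
    pderiv i (fun y => f y + g y) x = pderiv i f x + pderiv i g x := by
  simp [pderiv, fderiv_fun_add hf hg]

lemma pderiv_sub (hf : DifferentiableAt ℝ f x) (hg : DifferentiableAt ℝ g x) (i : Fin n) :
    pderiv i (fun y => f y - g y) x = pderiv i f x - pderiv i g x := by
  simp [pderiv, fderiv_fun_sub hf hg]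

lemma pderiv_neg (i : Fin n) : pderiv i (fun y => -f y) x = -pderiv i f x := by
  simp [pderiv, fderiv_fun_neg]

lemma pderiv_mul (hf : DifferentiableAt ℝ f x) (hg : DifferentiableAt ℝ g x) (i : Fin n) :
    pderiv i (fun y => f y * g y) x = pderiv i f x * g x + f x * pderiv i g x := by
  simp [pderiv, fderiv_fun_mul hf hg]; ring

lemma pderiv_const_mul (hf : DifferentiableAt ℝ f x) (c : ℝ) (i : Fin n) :
    pderiv i (fun y => c * f y) x = c * pderiv i f x := by
  simp [pderiv, fderiv_const_mul hf]

lemma pderiv_sum {ι : Type*} {s : Finset ι} {F : ι → Euc n → ℝ}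
    (h : ∀ k ∈ s, DifferentiableAt ℝ (F k) x) (i : Fin n) :
    pderiv i (fun y => ∑ k ∈ s, F k y) x = ∑ k ∈ s, pderiv i (F k) x := by
  simp [pderiv, fderiv_fun_sum h]

/-- The chain rule for a function of one real variable. -/
lemma pderiv_comp {u : ℝ → ℝ} {u' : ℝ} (hu : HasDerivAt u u' (f x))
    (hf : DifferentiableAt ℝ f x) (i : Fin n) :
    pderiv i (fun y => u (f y)) x = u' * pderiv i f x := by
  have := (hu.comp_hasFDerivAt x hf.hasFDerivAt).fderiv
  simp only [Function.comp_def] at this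
  simp [pderiv, this]

lemma pderiv_inv (hf : DifferentiableAt ℝ f x) (h0 : f x ≠ 0) (i : Fin n) :
    pderiv i (fun y => (f y)⁻¹) x = -pderiv i f x / f x ^ 2 := by
  rw [pderiv_comp (hasDerivAt_inv h0) hf]; ring

lemma pderiv_sqrt (hf : DifferentiableAt ℝ f x) (h0 : f x ≠ 0) (i : Fin n) :
    pderiv i (fun y => Real.sqrt (f y)) x = pderiv i f x / (2 * Real.sqrt (f x)) := by
  rw [pderiv_comp (Real.hasDerivAt_sqrt h0) hf]; ring

lemma fderiv_apply_eq_sum (f : Euc n → ℝ) (x v : Euc n) :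
    fderiv ℝ f x v = ∑ i, v i * pderiv i f x := by
  have : v = ∑ i, v i • EuclideanSpace.single i (1 : ℝ) := by
    ext j; simp [Finset.sum_apply, Pi.single_apply]
  conv_lhs => rw [this]
  simp [pderiv]

lemma fderiv_eq_zero_iff : fderiv ℝ f x = 0 ↔ ∀ i, pderiv i f x = 0 := by
  constructor
  · intro h i; simp [pderiv, h]
  · intro h; ext v; simp [fderiv_apply_eq_sum, h]

lemma contDiffAt_pderiv {m k : WithTop ℕ∞} (hf : ContDiffAt ℝ k f x) (h : m + 1 ≤ k) (i : Fin n) :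
    ContDiffAt ℝ m (pderiv i f) x :=
  (hf.fderiv_right h).clm_apply contDiffAt_const

lemma contDiff_pderiv (hf : ContDiff ℝ ∞ f) (i : Fin n) : ContDiff ℝ ∞ (pderiv i f) :=
  contDiff_iff_contDiffAt.2 fun _ => contDiffAt_pderiv hf.contDiffAt (by simp) i

lemma differentiableAt_pderiv (hf : ContDiffAt ℝ 2 f x) (i : Fin n) :
    DifferentiableAt ℝ (pderiv i f) x :=
  (contDiffAt_pderiv (m := 1) hf (by norm_num) i).differentiableAt (by simp)

lemma pderiv_comm (hf : ContDiffAt ℝ 2 f x) (i j : Fin n) :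
    pderiv i (pderiv j f) x = pderiv j (pderiv i f) x := by
  have hd : DifferentiableAt ℝ (fderiv ℝ f) x :=
    (hf.fderiv_right (m := 1) (by norm_num)).differentiableAt (by simp)
  have h : ∀ a b : Fin n, pderiv a (pderiv b f) x
      = fderiv ℝ (fderiv ℝ f) x (EuclideanSpace.single a 1) (EuclideanSpace.single b 1) := by
    intro a b
    have : pderiv b f = fun y => fderiv ℝ f y (EuclideanSpace.single b 1) := rfl
    rw [this, pderiv, fderiv_clm_apply hd (by fun_prop)]
    simp
  rw [h, h]
  exact (hf.isSymmSndFDerivAt (by simp)).eq _ _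

/-- `|Df|²`. -/
noncomputable def gradSq (f : Euc n → ℝ) (x : Euc n) : ℝ := ∑ i, pderiv i f x ^ 2

lemma gradSq_nonneg (f : Euc n → ℝ) (x : Euc n) : 0 ≤ gradSq f x :=
  Finset.sum_nonneg fun _ _ => sq_nonneg _

lemma gradSq_eq_zero_iff : gradSq f x = 0 ↔ fderiv ℝ f x = 0 := by
  rw [fderiv_eq_zero_iff, gradSq, Finset.sum_eq_zero_iff_of_nonneg fun _ _ => sq_nonneg _]
  simp

lemma gradSq_pos_iff : 0 < gradSq f x ↔ fderiv ℝ f x ≠ 0 := by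
  rw [Ne, ← gradSq_eq_zero_iff, (gradSq_nonneg f x).lt_iff_ne, ne_comm]

lemma contDiffAt_gradSq {m k : WithTop ℕ∞} (hf : ContDiffAt ℝ k f x) (h : m + 1 ≤ k) :
    ContDiffAt ℝ m (gradSq f) x := by
  unfold gradSq
  exact ContDiffAt.sum fun i _ => (contDiffAt_pderiv hf h i).pow 2

lemma differentiableAt_gradSq (hf : ContDiffAt ℝ 2 f x) : DifferentiableAt ℝ (gradSq f) x :=
  (contDiffAt_gradSq (m := 1) hf (by norm_num)).differentiableAt (by simp)

lemma pderiv_gradSq (hf : ContDiffAt ℝ 2 f x) (i : Fin n) :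
    pderiv i (gradSq f) x = 2 * ∑ j, pderiv j f x * pderiv i (pderiv j f) x := by
  have hd := fun j => differentiableAt_pderiv hf j
  have : gradSq f = fun y => ∑ j, pderiv j f y * pderiv j f y := by
    ext y; simp [gradSq, pow_two]
  rw [this, pderiv_sum fun j _ => (hd j).fun_mul (hd j), Finset.mul_sum]
  refine Finset.sum_congr rfl fun j _ => ?_
  rw [pderiv_mul (hd j) (hd j)]; ring

/-- The Laplacian `Δf`. -/
noncomputable def lapl (f : Euc n → ℝ) (x : Euc n) : ℝ := ∑ i, pderiv i (pderiv i f) x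

/-- `D²f(Df, Df)`. -/
noncomputable def hessGrad (f : Euc n → ℝ) (x : Euc n) : ℝ :=
  ∑ i, ∑ j, pderiv i f x * pderiv j f x * pderiv i (pderiv j f) x

lemma continuousAt_pderiv (hf : ContDiffAt ℝ 1 f x) (i : Fin n) : ContinuousAt (pderiv i f) x :=
  (contDiffAt_pderiv (m := 0) hf (by norm_num) i).continuousAt

lemma continuousAt_pderiv_pderiv (hf : ContDiffAt ℝ 2 f x) (i j : Fin n) :
    ContinuousAt (pderiv i (pderiv j f)) x :=
  continuousAt_pderiv (contDiffAt_pderiv hf (by norm_num) j) i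

lemma continuousAt_gradSq (hf : ContDiffAt ℝ 1 f x) : ContinuousAt (gradSq f) x :=
  (contDiffAt_gradSq (m := 0) hf (by norm_num)).continuousAt

lemma continuousAt_lapl (hf : ContDiffAt ℝ 2 f x) : ContinuousAt (lapl f) x :=
  tendsto_finsetSum _ fun i _ => continuousAt_pderiv_pderiv hf i i

lemma continuousAt_hessGrad (hf : ContDiffAt ℝ 2 f x) : ContinuousAt (hessGrad f) x :=
  tendsto_finsetSum _ fun i _ => tendsto_finsetSum _ fun j _ =>
    (((continuousAt_pderiv (hf.of_le (by norm_num)) i).mul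
      (continuousAt_pderiv (hf.of_le (by norm_num)) j)).mul (continuousAt_pderiv_pderiv hf i j))

lemma unitNormal_flat (φ : Euc n → ℝ) (x : Euc n) (i : Fin n) :
    unitNormal (flatMetric n) φ x i = pderiv i φ x / Real.sqrt (gradSq φ x) := by
  simp [unitNormal, flatMetric, gradSq, Matrix.one_apply, pow_two]

lemma metricDiv_flat (X : Euc n → Fin n → ℝ) (x : Euc n) :
    metricDiv (flatMetric n) X x = ∑ i, pderiv i (fun y => X y i) x := by
  simp [metricDiv, flatMetric]

lemma pderiv_normalized (hf : ContDiffAt ℝ 2 φ x) (h0 : fderiv ℝ φ x ≠ 0) (i j : Fin n) :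
    pderiv i (fun y => pderiv j φ y / Real.sqrt (gradSq φ y)) x
      = pderiv i (pderiv j φ) x / Real.sqrt (gradSq φ x)
        - pderiv j φ x * (∑ k, pderiv k φ x * pderiv i (pderiv k φ) x)
          / (gradSq φ x * Real.sqrt (gradSq φ x)) := by
  have hP := gradSq_pos_iff.2 h0
  have hs : Real.sqrt (gradSq φ x) ≠ 0 := (Real.sqrt_pos.2 hP).ne'
  have hdP : DifferentiableAt ℝ (gradSq φ) x := differentiableAt_gradSq hf
  have hds : DifferentiableAt ℝ (fun y => Real.sqrt (gradSq φ y)) x := hdP.sqrt hP.ne'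
  have hdi : DifferentiableAt ℝ (fun y => (Real.sqrt (gradSq φ y))⁻¹) x := hds.fun_inv hs
  simp only [div_eq_mul_inv]
  rw [pderiv_mul (differentiableAt_pderiv hf j) hdi, pderiv_inv hds hs,
    pderiv_sqrt hdP hP.ne', pderiv_gradSq hf, Real.sq_sqrt hP.le]
  field_simp
  ring

/-- The mean curvature of a regular level set in `ℝⁿ` in terms of second derivatives. -/
lemma levelMeanCurvature_flat (hf : ContDiffAt ℝ 2 φ x) (h0 : fderiv ℝ φ x ≠ 0) :
    levelMeanCurvature (flatMetric n) φ x
      = (lapl φ x - hessGrad φ x / gradSq φ x) / Real.sqrt (gradSq φ x) := by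
  have hP := gradSq_pos_iff.2 h0
  have hs : Real.sqrt (gradSq φ x) ≠ 0 := (Real.sqrt_pos.2 hP).ne'
  rw [levelMeanCurvature, metricDiv_flat]
  simp only [unitNormal_flat, pderiv_normalized hf h0, Finset.sum_sub_distrib, lapl, hessGrad,
    sub_div, Finset.sum_div, Finset.mul_sum]
  congr 1
  refine Finset.sum_congr rfl fun i _ => Finset.sum_congr rfl fun j _ => ?_
  field_simp

lemma fderiv_ne_zero_eventually (hf : ContDiffAt ℝ 1 φ x) (h0 : fderiv ℝ φ x ≠ 0) :
    ∀ᶠ y in 𝓝 x, fderiv ℝ φ y ≠ 0 :=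
  ((hf.fderiv_right (m := 0) (by norm_num)).continuousAt).eventually_ne h0

lemma continuousAt_levelMeanCurvature_flat (hf : ContDiffAt ℝ 2 φ x) (h0 : fderiv ℝ φ x ≠ 0) :
    ContinuousAt (levelMeanCurvature (flatMetric n) φ) x := by
  have hP := gradSq_pos_iff.2 h0
  have hs : Real.sqrt (gradSq φ x) ≠ 0 := (Real.sqrt_pos.2 hP).ne'
  have h1 : ContDiffAt ℝ 1 φ x := hf.of_le (by norm_num)
  have key : ContinuousAt (fun y => (lapl φ y - hessGrad φ y / gradSq φ y) /
      Real.sqrt (gradSq φ y)) x :=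
    ((continuousAt_lapl hf).sub ((continuousAt_hessGrad hf).div
      (continuousAt_gradSq h1) hP.ne')).div (continuousAt_gradSq h1).sqrt hs
  refine key.congr ?_
  filter_upwards [hf.eventually (by simp), fderiv_ne_zero_eventually h1 h0] with y hy hy0
  exact (levelMeanCurvature_flat hy hy0).symm

/-- First and second order conditions along a parabola `s ↦ y + s e + s² k` on which `φ` has a
local maximum at `s = 0`. -/
lemma secondOrder_of_isLocalMax {y e k : Euc n} (hf : ContDiffAt ℝ 2 φ y)
    (hmax : IsLocalMax (fun s : ℝ => φ (y + s • e + s ^ 2 • k)) 0) :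
    fderiv ℝ φ y e = 0 ∧
      2 * fderiv ℝ φ y k + ∑ i, ∑ j, e i * e j * pderiv i (pderiv j φ) y ≤ 0 := by
  set γ : ℝ → Euc n := fun s => y + s • e + s ^ 2 • k with hγ
  have hγ0 : γ 0 = y := by simp [hγ]
  have hγ' : ∀ s, HasDerivAt γ (e + (2 * s) • k) s := by
    intro s
    have h1 : HasDerivAt (fun s : ℝ => s • e) e s := by
      simpa using (hasDerivAt_id s).smul_const e
    have h2 : HasDerivAt (fun s : ℝ => s ^ 2 • k) ((2 * s) • k) s := by
      simpa using (hasDerivAt_pow 2 s).smul_const k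
    simpa [hγ] using (h1.const_add y).fun_add h2
  have hcont : ContinuousAt γ 0 := (hγ' 0).continuousAt
  have hev : ∀ᶠ s in 𝓝 (0 : ℝ), ContDiffAt ℝ 2 φ (γ s) :=
    hcont.eventually (by rw [hγ0]; exact hf.eventually (by simp))
  set g : ℝ → ℝ := fun s => φ (γ s) with hg
  have hg' : ∀ᶠ s in 𝓝 (0 : ℝ), HasDerivAt g (∑ i, (e i + 2 * s * k i) * pderiv i φ (γ s)) s := by
    filter_upwards [hev] with s hs
    have := (hs.differentiableAt (by simp)).hasFDerivAt.comp_hasDerivAt s (hγ' s)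
    rw [fderiv_apply_eq_sum] at this
    simpa [Function.comp_def] using this
  have hd0 : deriv g 0 = fderiv ℝ φ y e := by
    rw [hg'.self_of_nhds.deriv, fderiv_apply_eq_sum]; simp [hγ0]
  have hcrit : fderiv ℝ φ y e = 0 := by rw [← hd0]; exact hmax.deriv_eq_zero
  have hdd : HasDerivAt (fun s : ℝ => ∑ i, (e i + 2 * s * k i) * pderiv i φ (γ s))
      (∑ i, (2 * k i * pderiv i φ y + e i * ∑ j, e j * pderiv j (pderiv i φ) y)) 0 := by
    refine HasDerivAt.fun_sum fun i _ => ?_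
    have h1 : HasDerivAt (fun s : ℝ => e i + 2 * s * k i) (2 * k i) 0 := by
      simpa using (((hasDerivAt_id (0 : ℝ)).const_mul 2).mul_const (k i)).const_add (e i)
    have hdi : DifferentiableAt ℝ (pderiv i φ) (γ 0) := by
      rw [hγ0]; exact differentiableAt_pderiv hf i
    have h2 := hdi.hasFDerivAt.comp_hasDerivAt 0 (hγ' 0)
    rw [fderiv_apply_eq_sum] at h2
    simpa [hγ0, Function.comp_def] using h1.fun_mul h2
  have hdd' : deriv (deriv g) 0
      = 2 * fderiv ℝ φ y k + ∑ i, ∑ j, e i * e j * pderiv i (pderiv j φ) y := by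
    have : deriv g =ᶠ[𝓝 0] fun s : ℝ => ∑ i, (e i + 2 * s * k i) * pderiv i φ (γ s) :=
      hg'.mono fun s hs => hs.deriv
    rw [this.deriv_eq, hdd.deriv, Finset.sum_add_distrib, fderiv_apply_eq_sum, Finset.mul_sum]
    congr 1
    · exact Finset.sum_congr rfl fun i _ => by ring
    · simp only [Finset.mul_sum]
      refine Finset.sum_congr rfl fun i _ => Finset.sum_congr rfl fun j _ => ?_
      rw [pderiv_comm hf]; ring
  refine ⟨hcrit, ?_⟩
  by_contra! hpos
  rw [← hdd'] at hpos
  -- a strict minimum which is also a maximum forces `g` to be constant near `0`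
  have hmin := isLocalMin_of_deriv_deriv_pos hpos (hd0.trans hcrit)
    hg'.self_of_nhds.continuousAt
  have hc : g =ᶠ[𝓝 0] fun _ => g 0 := by
    filter_upwards [hmin, hmax] with s h1 h2 using le_antisymm h2 h1
  have h3 : deriv g =ᶠ[𝓝 0] fun _ => 0 := by
    filter_upwards [hc.eventuallyEq_nhds] with s hs
    rw [hs.deriv_eq]; simp
  rw [h3.deriv_eq] at hpos
  simp at hpos

end PartialDerivatives

/-! ### The metric of a graph -/

section GraphMetric

variable {n : ℕ} {f φ : Euc n → ℝ} {x : Euc n}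

lemma one_add_gradSq_pos (f : Euc n → ℝ) (x : Euc n) : 0 < 1 + gradSq f x := by
  have := gradSq_nonneg f x; linarith

lemma graphMetric_apply (f : Euc n → ℝ) (x : Euc n) (i j : Fin n) :
    graphMetric f x i j = (if i = j then 1 else 0) + pderiv i f x * pderiv j f x := rfl

lemma graphMetric_inv (f : Euc n → ℝ) (x : Euc n) :
    (graphMetric f x)⁻¹ = Matrix.of fun i j =>
      (if i = j then 1 else 0) - pderiv i f x * pderiv j f x / (1 + gradSq f x) := by
  have hw := (one_add_gradSq_pos f x).ne'
  refine Matrix.inv_eq_right_inv ?_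
  ext i k
  rw [Matrix.mul_apply, Matrix.one_apply]
  simp only [graphMetric_apply, Matrix.of_apply, add_mul, mul_sub, ite_mul, one_mul, zero_mul,
    mul_ite, mul_one, mul_zero, Finset.sum_add_distrib, Finset.sum_sub_distrib,
    Finset.sum_ite_eq, Finset.mem_univ, if_true, Finset.sum_ite_eq']
  have : ∑ j, pderiv i f x * pderiv j f x * (pderiv j f x * pderiv k f x / (1 + gradSq f x))
      = pderiv i f x * pderiv k f x * gradSq f x / (1 + gradSq f x) := by
    simp only [gradSq, Finset.mul_sum, Finset.sum_div]
    exact Finset.sum_congr rfl fun j _ => by ring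
  rw [this]
  field_simp
  ring

lemma graphMetric_inv_apply (f : Euc n → ℝ) (x : Euc n) (i j : Fin n) :
    (graphMetric f x)⁻¹ i j
      = (if i = j then 1 else 0) - pderiv i f x * pderiv j f x / (1 + gradSq f x) := by
  rw [graphMetric_inv]; rfl

lemma det_graphMetric (f : Euc n → ℝ) (x : Euc n) : (graphMetric f x).det = 1 + gradSq f x := by
  have : graphMetric f x = 1 + Matrix.replicateCol Unit (fun i => pderiv i f x) *
      Matrix.replicateRow Unit (fun i => pderiv i f x) := by
    ext i j
    simp [graphMetric_apply, Matrix.one_apply, Matrix.mul_apply]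
  rw [this, Matrix.det_one_add_replicateCol_mul_replicateRow]
  simp [dotProduct, gradSq, pow_two]

lemma sum_graphMetric_inv_mul (f : Euc n → ℝ) (x : Euc n) (i : Fin n) (v : Fin n → ℝ) :
    ∑ j, (graphMetric f x)⁻¹ i j * v j
      = v i - pderiv i f x * (∑ j, pderiv j f x * v j) / (1 + gradSq f x) := by
  simp only [graphMetric_inv_apply, sub_mul, ite_mul, one_mul, zero_mul, Finset.sum_sub_distrib,
    Finset.sum_ite_eq, Finset.mem_univ, if_true, Finset.mul_sum, Finset.sum_div]
  congr 1
  exact Finset.sum_congr rfl fun j _ => by ring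

lemma pderiv_graphMetric (hf : ContDiffAt ℝ 2 f x) (k i j : Fin n) :
    pderiv k (fun y => graphMetric f y i j) x
      = pderiv k (pderiv i f) x * pderiv j f x + pderiv i f x * pderiv k (pderiv j f) x := by
  simp only [graphMetric_apply]
  have hd := fun j => differentiableAt_pderiv hf j
  rw [pderiv_add (by fun_prop) ((hd i).fun_mul (hd j)), pderiv_const, pderiv_mul (hd i) (hd j)]
  ring

/-- The Christoffel symbols of a graph: `Γᵏᵢⱼ = fₖ fᵢⱼ / (1 + |Df|²)`. -/
lemma christoffel_graphMetric (hf : ContDiffAt ℝ 2 f x) (k i j : Fin n) :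
    christoffel (graphMetric f) k i j x
      = pderiv k f x * pderiv i (pderiv j f) x / (1 + gradSq f x) := by
  have hw := (one_add_gradSq_pos f x).ne'
  have h : ∀ l, pderiv i (fun y => graphMetric f y j l) x + pderiv j (fun y => graphMetric f y i l) x
      - pderiv l (fun y => graphMetric f y i j) x
      = 2 * pderiv i (pderiv j f) x * pderiv l f x := by
    intro l
    rw [pderiv_graphMetric hf, pderiv_graphMetric hf, pderiv_graphMetric hf,
      pderiv_comm hf j i, pderiv_comm hf l i, pderiv_comm hf l j]
    ring
  rw [christoffel]
  simp only [h]
  rw [sum_graphMetric_inv_mul]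
  have : ∑ l, pderiv l f x * (2 * pderiv i (pderiv j f) x * pderiv l f x)
      = 2 * pderiv i (pderiv j f) x * gradSq f x := by
    rw [gradSq, Finset.mul_sum]; exact Finset.sum_congr rfl fun l _ => by ring
  rw [this]
  field_simp
  ring

/-- The components `(D²f Df)ᵢ`. -/
noncomputable def hessVec (f : Euc n → ℝ) (x : Euc n) (i : Fin n) : ℝ :=
  ∑ l, pderiv i (pderiv l f) x * pderiv l f x

lemma pderiv_christoffel_graphMetric (hf : ContDiffAt ℝ 3 f x) (m k i j : Fin n) :
    pderiv m (christoffel (graphMetric f) k i j) x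
      = (pderiv m (pderiv k f) x * pderiv i (pderiv j f) x
          + pderiv k f x * pderiv m (pderiv i (pderiv j f)) x) / (1 + gradSq f x)
        - 2 * pderiv k f x * pderiv i (pderiv j f) x * hessVec f x m / (1 + gradSq f x) ^ 2 := by
  have hw := (one_add_gradSq_pos f x).ne'
  have hf2 : ContDiffAt ℝ 2 f x := hf.of_le (by norm_num)
  have he : christoffel (graphMetric f) k i j =ᶠ[𝓝 x]
      fun y => (pderiv k f y * pderiv i (pderiv j f) y) * (1 + gradSq f y)⁻¹ := by
    filter_upwards [hf2.eventually (by simp)] with y hy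
    rw [christoffel_graphMetric hy, div_eq_mul_inv]
  have h1 := differentiableAt_pderiv hf2 k
  have h2 : DifferentiableAt ℝ (pderiv i (pderiv j f)) x :=
    differentiableAt_pderiv (contDiffAt_pderiv hf (by norm_num) j) i
  have h3 : DifferentiableAt ℝ (fun y => 1 + gradSq f y) x :=
    (differentiableAt_gradSq hf2).const_add 1
  rw [pderiv_congr he, pderiv_mul (h1.fun_mul h2) (h3.fun_inv hw), pderiv_mul h1 h2,
    pderiv_inv h3 hw, pderiv_add (by fun_prop) (differentiableAt_gradSq hf2), pderiv_const,
    pderiv_gradSq hf2]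
  have : ∑ j, pderiv j f x * pderiv m (pderiv j f) x = hessVec f x m :=
    Finset.sum_congr rfl fun _ _ => mul_comm _ _
  rw [this]
  field_simp
  ring

/-- `|D²f|²`. -/
noncomputable def hessSq (f : Euc n → ℝ) (x : Euc n) : ℝ :=
  ∑ i, ∑ j, pderiv i (pderiv j f) x ^ 2

lemma sum_pderiv_mul_hessVec (f : Euc n → ℝ) (x : Euc n) :
    ∑ i, pderiv i f x * hessVec f x i = hessGrad f x := by
  simp only [hessVec, hessGrad, Finset.mul_sum]
  exact Finset.sum_congr rfl fun i _ => Finset.sum_congr rfl fun j _ => by ring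

lemma pderiv_pderiv_pderiv_comm (hf : ContDiffAt ℝ 3 f x) (i j k : Fin n) :
    pderiv k (pderiv i (pderiv j f)) x = pderiv j (pderiv i (pderiv k f)) x := by
  have hf2 : ContDiffAt ℝ 2 f x := hf.of_le (by norm_num)
  have h : ∀ a b, pderiv a (pderiv b f) =ᶠ[𝓝 x] pderiv b (pderiv a f) := fun a b => by
    filter_upwards [hf2.eventually (by simp)] with y hy using pderiv_comm hy a b
  rw [pderiv_congr (h i j), pderiv_congr (h i k),
    pderiv_comm (contDiffAt_pderiv hf (by norm_num) i)]

/-- The Gauss equation for the Ricci tensor of a graph. -/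
lemma ricci_graphMetric (hf : ContDiffAt ℝ 3 f x) (i j : Fin n) :
    ricci (graphMetric f) i j x
      = (lapl f x * pderiv i (pderiv j f) x
          - ∑ k, pderiv k (pderiv i f) x * pderiv k (pderiv j f) x) / (1 + gradSq f x)
        - (hessGrad f x * pderiv i (pderiv j f) x - hessVec f x i * hessVec f x j)
          / (1 + gradSq f x) ^ 2 := by
  have hw := (one_add_gradSq_pos f x).ne'
  have hf2 : ContDiffAt ℝ 2 f x := hf.of_le (by norm_num)
  set w := 1 + gradSq f x with hwdef
  have hterm : ∀ k, (pderiv k (christoffel (graphMetric f) k i j) x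
      - pderiv j (christoffel (graphMetric f) k i k) x
      + ∑ l, (christoffel (graphMetric f) k k l x * christoffel (graphMetric f) l i j x
        - christoffel (graphMetric f) k j l x * christoffel (graphMetric f) l i k x))
      = (pderiv k (pderiv k f) x * pderiv i (pderiv j f) x
          - pderiv k (pderiv i f) x * pderiv k (pderiv j f) x) / w
        - (pderiv k f x * hessVec f x k * pderiv i (pderiv j f) x
          - pderiv k f x * pderiv i (pderiv k f) x * hessVec f x j) / w ^ 2 := by
    intro k
    have hs : ∑ l, (christoffel (graphMetric f) k k l x * christoffel (graphMetric f) l i j x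
        - christoffel (graphMetric f) k j l x * christoffel (graphMetric f) l i k x)
        = (pderiv k f x * hessVec f x k * pderiv i (pderiv j f) x
          - pderiv k f x * pderiv i (pderiv k f) x * hessVec f x j) / w ^ 2 := by
      simp only [christoffel_graphMetric hf2, hessVec, Finset.mul_sum, Finset.sum_mul,
        ← Finset.sum_sub_distrib, Finset.sum_div]
      refine Finset.sum_congr rfl fun l _ => ?_
      rw [← hwdef]
      field_simp
    rw [hs, pderiv_christoffel_graphMetric hf, pderiv_christoffel_graphMetric hf, ← hwdef,
      pderiv_pderiv_pderiv_comm hf i j k, pderiv_comm hf2 i k, pderiv_comm hf2 j k]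
    field_simp
    ring
  rw [ricci, Finset.sum_congr rfl fun k _ => hterm k, Finset.sum_sub_distrib, ← Finset.sum_div,
    ← Finset.sum_div, Finset.sum_sub_distrib, Finset.sum_sub_distrib, ← Finset.sum_mul,
    ← Finset.sum_mul, ← Finset.sum_mul, sum_pderiv_mul_hessVec]
  have : ∑ k, pderiv k f x * pderiv i (pderiv k f) x = hessVec f x i :=
    Finset.sum_congr rfl fun _ _ => mul_comm _ _
  rw [this]
  rfl

/-- The Gauss equation for the scalar curvature of a graph. -/
lemma scalarCurvature_graphMetric (hf : ContDiffAt ℝ 3 f x) :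
    scalarCurvature (graphMetric f) x
      = (lapl f x ^ 2 - hessSq f x) / (1 + gradSq f x)
        - 2 * (hessGrad f x * lapl f x - ∑ i, hessVec f x i ^ 2) / (1 + gradSq f x) ^ 2 := by
  have hw := (one_add_gradSq_pos f x).ne'
  have hf2 : ContDiffAt ℝ 2 f x := hf.of_le (by norm_num)
  set w := 1 + gradSq f x with hwdef
  -- the trace of the Ricci tensor with respect to the flat metric
  have h1 : ∑ i, ricci (graphMetric f) i i x
      = (lapl f x ^ 2 - hessSq f x) / w
        - (hessGrad f x * lapl f x - ∑ i, hessVec f x i ^ 2) / w ^ 2 := by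
    simp only [ricci_graphMetric hf, ← hwdef]
    rw [Finset.sum_sub_distrib, ← Finset.sum_div, ← Finset.sum_div, Finset.sum_sub_distrib,
      Finset.sum_sub_distrib, ← Finset.mul_sum, ← Finset.mul_sum, Finset.sum_comm]
    simp only [← pow_two, hessSq]
    rw [pow_two (lapl f x)]
    rfl
  -- the value of the Ricci tensor on `Df`
  have h2 : ∑ i, ∑ j, pderiv i f x * pderiv j f x * ricci (graphMetric f) i j x
      = (lapl f x * hessGrad f x - ∑ i, hessVec f x i ^ 2) / w := by
    have hA : ∑ i, ∑ j, pderiv i f x * pderiv j f x *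
        (∑ k, pderiv k (pderiv i f) x * pderiv k (pderiv j f) x) = ∑ k, hessVec f x k ^ 2 := by
      simp only [hessVec, pow_two, Finset.sum_mul_sum]
      conv_rhs => rw [Finset.sum_comm]
      refine Finset.sum_congr rfl fun i _ => ?_
      conv_rhs => rw [Finset.sum_comm]
      simp only [Finset.mul_sum]
      exact Finset.sum_congr rfl fun j _ => Finset.sum_congr rfl fun k _ => by ring
    have hB : ∑ i, ∑ j, pderiv i f x * pderiv j f x * (hessVec f x i * hessVec f x j)
        = hessGrad f x ^ 2 := by
      rw [← sum_pderiv_mul_hessVec, pow_two, Finset.sum_mul_sum]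
      exact Finset.sum_congr rfl fun j _ => Finset.sum_congr rfl fun k _ => by ring
    have hC : ∑ i, ∑ j, pderiv i f x * pderiv j f x * ricci (graphMetric f) i j x
        = (lapl f x * (∑ i, ∑ j, pderiv i f x * pderiv j f x * pderiv i (pderiv j f) x)
            - ∑ i, ∑ j, pderiv i f x * pderiv j f x *
            (∑ k, pderiv k (pderiv i f) x * pderiv k (pderiv j f) x)) / w
          - (hessGrad f x * (∑ i, ∑ j, pderiv i f x * pderiv j f x * pderiv i (pderiv j f) x)
            - ∑ i, ∑ j, pderiv i f x * pderiv j f x * (hessVec f x i * hessVec f x j)) / w ^ 2 := by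
      simp only [ricci_graphMetric hf, ← hwdef]
      rw [Finset.mul_sum, Finset.mul_sum, ← Finset.sum_sub_distrib, ← Finset.sum_sub_distrib,
        Finset.sum_div, Finset.sum_div, ← Finset.sum_sub_distrib]
      refine Finset.sum_congr rfl fun i _ => ?_
      rw [Finset.mul_sum, Finset.mul_sum, ← Finset.sum_sub_distrib, ← Finset.sum_sub_distrib,
        Finset.sum_div, Finset.sum_div, ← Finset.sum_sub_distrib]
      refine Finset.sum_congr rfl fun j _ => ?_
      ring
    rw [hC, hA, hB, ← hessGrad]
    ring
  have h3 : scalarCurvature (graphMetric f) x = ∑ i, ricci (graphMetric f) i i x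
      - (∑ i, ∑ j, pderiv i f x * pderiv j f x * ricci (graphMetric f) i j x) / w := by
    rw [scalarCurvature, Finset.sum_div, ← Finset.sum_sub_distrib]
    refine Finset.sum_congr rfl fun i _ => ?_
    simp only [graphMetric_inv_apply, ← hwdef, sub_mul, ite_mul, one_mul, zero_mul,
      Finset.sum_sub_distrib, Finset.sum_ite_eq, Finset.mem_univ, if_true, Finset.sum_div]
    congr 1
    exact Finset.sum_congr rfl fun j _ => by ring
  rw [h3, h1, h2]
  field_simp
  ring

/-- The numerator `(1 + |Df|²) Δf - D²f(Df, Df)` of the mean curvature of a graph. -/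
noncomputable def graphMean (f : Euc n → ℝ) (x : Euc n) : ℝ :=
  (1 + gradSq f x) * lapl f x - hessGrad f x

lemma continuousAt_graphMean (hf : ContDiffAt ℝ 2 f x) : ContinuousAt (graphMean f) x :=
  ((continuousAt_const.add (continuousAt_gradSq (hf.of_le (by norm_num)))).mul
    (continuousAt_lapl hf)).sub (continuousAt_hessGrad hf)

/-- The part of the Hessian orthogonal to `Df` has non-negative norm. -/
lemma hessSq_lower_bound (hf : ContDiffAt ℝ 2 f x) (h0 : fderiv ℝ f x ≠ 0) :
    2 * (∑ i, hessVec f x i ^ 2) / gradSq f x - hessGrad f x ^ 2 / gradSq f x ^ 2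
      ≤ hessSq f x := by
  have hP := gradSq_pos_iff.2 h0
  set P := gradSq f x with hPdef
  set α := hessGrad f x with hα
  have key : 0 ≤ ∑ i, ∑ j, (pderiv i (pderiv j f) x - pderiv i f x * hessVec f x j / P
      - hessVec f x i * pderiv j f x / P + α * pderiv i f x * pderiv j f x / P ^ 2) ^ 2 :=
    Finset.sum_nonneg fun _ _ => Finset.sum_nonneg fun _ _ => sq_nonneg _
  set S := ∑ i, hessVec f x i ^ 2 with hS
  have sq : ∀ i, hessVec f x i ^ 2
      = ∑ l, pderiv i (pderiv l f) x * pderiv l f x * hessVec f x i := fun i => by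
    rw [← Finset.sum_mul, ← hessVec, pow_two]
  have e1 : ∑ i, ∑ j, pderiv i f x * hessVec f x j * pderiv i (pderiv j f) x = S := by
    rw [Finset.sum_comm, hS]
    refine Finset.sum_congr rfl fun j _ => ?_
    rw [sq]
    refine Finset.sum_congr rfl fun i _ => ?_
    rw [pderiv_comm hf i j]; ring
  have e2 : ∑ i, ∑ j, hessVec f x i * pderiv j f x * pderiv i (pderiv j f) x = S := by
    rw [hS]
    refine Finset.sum_congr rfl fun i _ => ?_
    rw [sq]
    refine Finset.sum_congr rfl fun j _ => ?_
    ring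
  have prod : ∀ a b : Fin n → ℝ, ∑ i, ∑ j, a i * b j = (∑ i, a i) * ∑ j, b j :=
    fun a b => (Finset.sum_mul_sum _ _ _ _).symm
  have qq : ∑ i, pderiv i f x ^ 2 = P := rfl
  have qv : ∑ i, pderiv i f x * hessVec f x i = α := sum_pderiv_mul_hessVec f x
  have expand : ∑ i, ∑ j, (pderiv i (pderiv j f) x - pderiv i f x * hessVec f x j / P
      - hessVec f x i * pderiv j f x / P + α * pderiv i f x * pderiv j f x / P ^ 2) ^ 2
      = hessSq f x - 2 / P * (∑ i, ∑ j, pderiv i f x * hessVec f x j * pderiv i (pderiv j f) x)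
        - 2 / P * (∑ i, ∑ j, hessVec f x i * pderiv j f x * pderiv i (pderiv j f) x)
        + 2 * α / P ^ 2 * hessGrad f x
        + 1 / P ^ 2 * (∑ i, ∑ j, pderiv i f x ^ 2 * hessVec f x j ^ 2)
        + 1 / P ^ 2 * (∑ i, ∑ j, hessVec f x i ^ 2 * pderiv j f x ^ 2)
        + α ^ 2 / P ^ 4 * (∑ i, ∑ j, pderiv i f x ^ 2 * pderiv j f x ^ 2)
        + 2 / P ^ 2 * (∑ i, ∑ j, (pderiv i f x * hessVec f x i) * (pderiv j f x * hessVec f x j))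
        - 2 * α / P ^ 3 * (∑ i, ∑ j, pderiv i f x ^ 2 * (pderiv j f x * hessVec f x j))
        - 2 * α / P ^ 3 * (∑ i, ∑ j, (pderiv i f x * hessVec f x i) * pderiv j f x ^ 2) := by
    simp only [hessSq, hessGrad, Finset.mul_sum, ← Finset.sum_add_distrib,
      ← Finset.sum_sub_distrib]
    refine Finset.sum_congr rfl fun i _ => Finset.sum_congr rfl fun j _ => ?_
    field_simp
    ring
  rw [expand, e1, e2, prod, prod, prod, prod, prod, prod, qq, qv, ← hS, ← hα] at key
  have : hessSq f x - 2 / P * S - 2 / P * S + 2 * α / P ^ 2 * α + 1 / P ^ 2 * (P * S)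
      + 1 / P ^ 2 * (S * P) + α ^ 2 / P ^ 4 * (P * P) + 2 / P ^ 2 * (α * α)
      - 2 * α / P ^ 3 * (P * α) - 2 * α / P ^ 3 * (α * P)
      = hessSq f x - (2 * S / P - α ^ 2 / P ^ 2) := by
    field_simp
    ring
  linarith

lemma hessGrad_sq_le (f : Euc n → ℝ) (x : Euc n) :
    hessGrad f x ^ 2 ≤ gradSq f x * ∑ i, hessVec f x i ^ 2 := by
  rw [← sum_pderiv_mul_hessVec]
  exact Finset.sum_mul_sq_le_sq_mul_sq _ _ _

/-- Where the scalar curvature of a graph is non-negative and the level set is strictly mean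
convex, the mean curvature of the graph is positive. -/
lemma graphMean_pos (hf : ContDiffAt ℝ 3 f x) (h0 : fderiv ℝ f x ≠ 0)
    (hR : 0 ≤ scalarCurvature (graphMetric f) x)
    (hH : 0 < levelMeanCurvature (flatMetric n) f x) : 0 < graphMean f x := by
  have hf2 : ContDiffAt ℝ 2 f x := hf.of_le (by norm_num)
  have hP := gradSq_pos_iff.2 h0
  have hw := one_add_gradSq_pos f x
  rw [levelMeanCurvature_flat hf2 h0] at hH
  have hs : 0 < lapl f x - hessGrad f x / gradSq f x := by
    by_contra! hle
    exact absurd hH (not_lt.2 (div_nonpos_of_nonpos_of_nonneg hle (Real.sqrt_nonneg _)))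
  rw [scalarCurvature_graphMetric hf] at hR
  have hlow := hessSq_lower_bound hf2 h0
  have hcs := hessGrad_sq_le f x
  rw [graphMean]
  set P := gradSq f x with hPdef
  set α := hessGrad f x
  set S := ∑ i, hessVec f x i ^ 2
  set t := lapl f x
  set N := hessSq f x
  set w := 1 + P with hwdef
  -- `s` and `a` are the tangential and the normal parts of the trace of the Hessian
  set s := t - α / P with hsdef
  set a := α / (P * w) with hadef
  have hR' : 0 ≤ t ^ 2 - N - 2 * (α * t - S) / w := by
    have : (t ^ 2 - N) / w - 2 * (α * t - S) / w ^ 2 = (t ^ 2 - N - 2 * (α * t - S) / w) / w := by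
      field_simp
    rw [this] at hR
    by_contra! hneg
    exact absurd hR (not_le.2 (div_neg_of_neg_of_pos hneg hw))
  have hS : α ^ 2 / P ≤ S := by rw [div_le_iff₀ hP]; linarith
  have h2sa : s ^ 2 ≤ 2 * s * (a + s) := by
    have e : 2 * s * (a + s) - s ^ 2 = (t ^ 2 - N - 2 * (α * t - S) / w)
        + (N - (2 * S / P - α ^ 2 / P ^ 2)) + 2 * (S - α ^ 2 / P) / (P * w) := by
      rw [hsdef, hadef, hwdef]
      field_simp
      ring
    have : 0 ≤ 2 * (S - α ^ 2 / P) / (P * w) := by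
      have : 0 ≤ S - α ^ 2 / P := by linarith
      positivity
    linarith
  have hpos : 0 < a + s := by
    by_contra! hle
    nlinarith [sq_pos_of_pos hs]
  have : w * t - α = w * (a + s) := by
    rw [hsdef, hadef, hwdef]
    field_simp
    ring
  rw [this]
  positivity

end GraphMetric

/-! ### Local defining functions -/

section DefiningFunctions

variable {n : ℕ} {V : Set (Euc n)} {f φ ρ : Euc n → ℝ} {x : Euc n}

lemma exists_pos_fderiv (h : fderiv ℝ φ x ≠ 0) : ∃ v, 0 < fderiv ℝ φ x v := by
  obtain ⟨v, hv⟩ : ∃ v, fderiv ℝ φ x v ≠ 0 := by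
    by_contra! hc; exact h (by ext v; simpa using hc v)
  rcases lt_or_gt_of_ne hv with hv | hv
  · exact ⟨-v, by simpa using hv⟩
  · exact ⟨v, hv⟩

lemma tendsto_add_smul (x v : Euc n) :
    Filter.Tendsto (fun s : ℝ => x + s • v) (𝓝[>] 0) (𝓝 x) := by
  have : ContinuousAt (fun s : ℝ => x + s • v) 0 := by fun_prop
  have h := this.tendsto
  simp only [zero_smul, add_zero] at h
  exact h.mono_left nhdsWithin_le_nhds

lemma eventually_lt_add_smul {v : Euc n} (hφ : DifferentiableAt ℝ φ x)
    (hv : 0 < fderiv ℝ φ x v) : ∀ᶠ s : ℝ in 𝓝[>] 0, φ x < φ (x + s • v) := by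
  have hline : HasDerivAt (fun s : ℝ => φ (x + s • v)) (fderiv ℝ φ x v) 0 := by
    have h1 : HasDerivAt (fun s : ℝ => x + s • v) v 0 := by
      simpa using ((hasDerivAt_id (0 : ℝ)).smul_const v).const_add x
    have h2 : HasFDerivAt φ (fderiv ℝ φ x) (x + (0 : ℝ) • v) := by
      simpa using hφ.hasFDerivAt
    exact h2.comp_hasDerivAt 0 h1
  have hs := (hasDerivAt_iff_tendsto_slope.1 hline).eventually (eventually_gt_nhds hv)
  have hs' : ∀ᶠ s : ℝ in 𝓝[>] 0, 0 < slope (fun s : ℝ => φ (x + s • v)) 0 s :=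
    hs.filter_mono (nhdsWithin_mono _ fun s (hs : 0 < s) => hs.ne')
  filter_upwards [hs', self_mem_nhdsWithin] with s h1 h2
  have h2' : 0 < s := h2
  rw [slope_def_field] at h1
  simp only [zero_smul, add_zero, sub_zero] at h1
  have := (div_pos_iff_of_pos_right h2').1 h1
  linarith

lemma eventually_add_smul_lt {v : Euc n} (hφ : DifferentiableAt ℝ φ x)
    (hv : fderiv ℝ φ x v < 0) : ∀ᶠ s : ℝ in 𝓝[>] 0, φ (x + s • v) < φ x := by
  have : DifferentiableAt ℝ (fun y => -φ y) x := hφ.fun_neg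
  filter_upwards [eventually_lt_add_smul (v := v) this (by rw [fderiv_fun_neg]; simpa using hv)]
    with s hs
  linarith

lemma IsDefiningAt.contDiffAt (h : IsDefiningAt V x ρ) {k : ℕ} : ContDiffAt ℝ k ρ x :=
  (contDiff_infty.1 h.1 k).contDiffAt

lemma IsDefiningAt.differentiableAt (h : IsDefiningAt V x ρ) {y : Euc n} :
    DifferentiableAt ℝ ρ y :=
  h.1.differentiable (by simp) y

lemma IsDefiningAt.eventually (h : IsDefiningAt V x ρ) : ∀ᶠ y in 𝓝 x, IsDefiningAt V y ρ := by
  filter_upwards [h.2.2.eventually_nhds, fderiv_ne_zero_eventually h.contDiffAt h.2.1] with y h1 h2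
  exact ⟨h.1, h2, h1⟩

lemma IsDefiningAt.mem_iff (h : IsDefiningAt V x ρ) : x ∈ V ↔ ρ x < 0 := h.2.2.self_of_nhds

lemma IsDefiningAt.mem_closure_iff (h : IsDefiningAt V x ρ) : x ∈ closure V ↔ ρ x ≤ 0 := by
  constructor
  · intro hx
    by_contra! hpos
    have : ∀ᶠ y in 𝓝 x, y ∉ V := by
      filter_upwards [h.2.2, h.differentiableAt.continuousAt.eventually (eventually_gt_nhds hpos)]
        with y h1 h2
      rw [h1]; exact not_lt.2 h2.le
    rw [mem_closure_iff_frequently] at hx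
    exact hx this
  · intro hx
    rcases hx.lt_or_eq with hx | hx
    · exact subset_closure (h.mem_iff.2 hx)
    · obtain ⟨v, hv⟩ := exists_pos_fderiv h.2.1
      rw [mem_closure_iff_frequently]
      have h1 := eventually_add_smul_lt (v := -v) h.differentiableAt (by simpa using hv)
      have h2 := (tendsto_add_smul x (-v)).eventually h.2.2
      refine (tendsto_add_smul x (-v)).frequently (Filter.Eventually.frequently ?_)
      filter_upwards [h1, h2] with s h1 h2
      rw [h2]; linarith

lemma IsDefiningAt.mem_frontier_iff (h : IsDefiningAt V x ρ) : x ∈ frontier V ↔ ρ x = 0 := by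
  rw [frontier, Set.mem_sdiff, h.mem_closure_iff]
  constructor
  · rintro ⟨h1, h2⟩
    by_contra hne
    have hlt : ρ x < 0 := lt_of_le_of_ne h1 hne
    refine h2 (mem_interior_iff_mem_nhds.2 ?_)
    filter_upwards [h.2.2, h.differentiableAt.continuousAt.eventually (eventually_lt_nhds hlt)]
      with y h3 h4 using h3.2 h4
  · intro h0
    exact ⟨h0.le, fun hi => absurd (h.mem_iff.1 (interior_subset hi)) (by simp [h0])⟩

/-- A function which is constant along a hypersurface has a differential proportional to that of a
defining function. -/
lemma IsDefiningAt.exists_fderiv_eq_smul (h : IsDefiningAt V x ρ) (hx : x ∈ frontier V)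
    (hφ : ContDiffAt ℝ 1 φ x) (hc : ∀ᶠ y in 𝓝[frontier V] x, φ y = φ x) :
    ∃ c : ℝ, fderiv ℝ φ x = c • fderiv ℝ ρ x := by
  have hρ : ContDiffAt ℝ 1 ρ x := h.contDiffAt
  have hext : IsLocalExtrOn φ {y | ρ y = ρ x} x := by
    left
    have h1 : ∀ᶠ y in 𝓝[{y | ρ y = ρ x}] x, y ∈ frontier V := by
      filter_upwards [h.eventually.filter_mono nhdsWithin_le_nhds, self_mem_nhdsWithin] with y h1 h2
      rw [h1.mem_frontier_iff, show ρ y = ρ x from h2]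
      exact h.mem_frontier_iff.1 hx
    have h2 : 𝓝[{y | ρ y = ρ x}] x ≤ 𝓝[frontier V] x :=
      le_inf nhdsWithin_le_nhds (Filter.le_principal_iff.2 h1)
    exact (hc.filter_mono h2).mono fun y hy => hy.ge
  obtain ⟨a, b, hab, h0⟩ := hext.exists_multipliers_of_hasStrictFDerivAt_1d
    (hρ.hasStrictFDerivAt (by simp)) (hφ.hasStrictFDerivAt (by simp))
  have hb : b ≠ 0 := by
    rintro rfl
    simp only [zero_smul, add_zero, smul_eq_zero] at h0
    rcases h0 with rfl | h0
    · simp at hab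
    · exact h.2.1 h0
  refine ⟨-(b⁻¹ * a), ?_⟩
  have : b • fderiv ℝ φ x = -(a • fderiv ℝ ρ x) := by
    rw [eq_neg_iff_add_eq_zero, add_comm]; exact h0
  rw [neg_smul, mul_smul, ← smul_neg, ← this, smul_smul, inv_mul_cancel₀ hb, one_smul]

end DefiningFunctions

/-! ### Mean curvature in the metric of a graph -/

section MeanCurvature

variable {n : ℕ} {V : Set (Euc n)} {f φ ρ : Euc n → ℝ} {x : Euc n}

/-- The Euclidean inner product `Df · Dφ`. -/
noncomputable def gradDot (f φ : Euc n → ℝ) (x : Euc n) : ℝ := ∑ i, pderiv i f x * pderiv i φ x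

lemma gradDot_self (f : Euc n → ℝ) (x : Euc n) : gradDot f f x = gradSq f x := by
  simp [gradDot, gradSq, pow_two]

lemma gradDot_sq_le (f φ : Euc n → ℝ) (x : Euc n) :
    gradDot f φ x ^ 2 ≤ gradSq f x * gradSq φ x :=
  Finset.sum_mul_sq_le_sq_mul_sq _ _ _

lemma differentiableAt_gradDot (hf : ContDiffAt ℝ 2 f x) (hφ : ContDiffAt ℝ 2 φ x) :
    DifferentiableAt ℝ (gradDot f φ) x :=
  DifferentiableAt.fun_sum fun i _ =>
    (differentiableAt_pderiv hf i).fun_mul (differentiableAt_pderiv hφ i)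

lemma continuousAt_gradDot (hf : ContDiffAt ℝ 1 f x) (hφ : ContDiffAt ℝ 1 φ x) :
    ContinuousAt (gradDot f φ) x :=
  tendsto_finsetSum _ fun i _ => (continuousAt_pderiv hf i).mul (continuousAt_pderiv hφ i)

lemma pderiv_eq_mul {c : ℝ} (h : fderiv ℝ φ x = c • fderiv ℝ ρ x) (i : Fin n) :
    pderiv i φ x = c * pderiv i ρ x := by
  simp [pderiv, h]

lemma flatMetric_eq : flatMetric n = graphMetric (fun _ => (0 : ℝ)) := by
  ext x i j
  simp [flatMetric, graphMetric_apply, pderiv_const, Matrix.one_apply]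

/-- The square of the norm of `dφ` in the metric of the graph of `f`. -/
noncomputable def conormSq (f φ : Euc n → ℝ) (x : Euc n) : ℝ :=
  gradSq φ x - gradDot f φ x ^ 2 / (1 + gradSq f x)

lemma conormSq_pos (f : Euc n → ℝ) (h0 : fderiv ℝ φ x ≠ 0) : 0 < conormSq f φ x := by
  have hP := gradSq_pos_iff.2 h0
  have hw := one_add_gradSq_pos f x
  have := gradDot_sq_le f φ x
  rw [conormSq, sub_pos, div_lt_iff₀ hw]
  nlinarith

lemma unitNormal_graph (f φ : Euc n → ℝ) (x : Euc n) (i : Fin n) :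
    unitNormal (graphMetric f) φ x i
      = (pderiv i φ x - pderiv i f x * gradDot f φ x / (1 + gradSq f x))
        / Real.sqrt (conormSq f φ x) := by
  have h : ∀ k, ∑ j, (graphMetric f x)⁻¹ k j * pderiv j φ x
      = pderiv k φ x - pderiv k f x * gradDot f φ x / (1 + gradSq f x) :=
    fun k => sum_graphMetric_inv_mul f x k _
  have h2 : ∑ k, ∑ j, (graphMetric f x)⁻¹ k j * pderiv k φ x * pderiv j φ x
      = conormSq f φ x := by
    have : ∀ k, ∑ j, (graphMetric f x)⁻¹ k j * pderiv k φ x * pderiv j φ x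
        = pderiv k φ x ^ 2
          - (pderiv k f x * pderiv k φ x) * (gradDot f φ x / (1 + gradSq f x)) := by
      intro k
      have e : ∑ j, (graphMetric f x)⁻¹ k j * pderiv k φ x * pderiv j φ x
          = pderiv k φ x * ∑ j, (graphMetric f x)⁻¹ k j * pderiv j φ x := by
        rw [Finset.mul_sum]; exact Finset.sum_congr rfl fun j _ => by ring
      rw [e, h]; ring
    simp only [this, Finset.sum_sub_distrib, ← Finset.sum_mul]
    change gradSq φ x - gradDot f φ x * _ = _
    rw [conormSq]; ring
  rw [unitNormal, h, h2]

lemma contDiffAt_gradDot (hf : ContDiffAt ℝ 2 f x) (hφ : ContDiffAt ℝ 2 φ x) :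
    ContDiffAt ℝ 1 (gradDot f φ) x :=
  ContDiffAt.sum fun i _ =>
    (contDiffAt_pderiv hf (by norm_num) i).mul (contDiffAt_pderiv hφ (by norm_num) i)

lemma contDiffAt_one_add_gradSq (hf : ContDiffAt ℝ 2 f x) :
    ContDiffAt ℝ 1 (fun y => 1 + gradSq f y) x :=
  contDiffAt_const.add (contDiffAt_gradSq hf (by norm_num))

lemma contDiffAt_conormSq (hf : ContDiffAt ℝ 2 f x) (hφ : ContDiffAt ℝ 2 φ x) :
    ContDiffAt ℝ 1 (conormSq f φ) x :=
  (contDiffAt_gradSq hφ (by norm_num)).sub (((contDiffAt_gradDot hf hφ).pow 2).div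
    (contDiffAt_one_add_gradSq hf) (one_add_gradSq_pos f x).ne')

lemma contDiffAt_unitNormal_graph (hf : ContDiffAt ℝ 2 f x) (hφ : ContDiffAt ℝ 2 φ x)
    (h0 : fderiv ℝ φ x ≠ 0) (i : Fin n) :
    ContDiffAt ℝ 1 (fun y => unitNormal (graphMetric f) φ y i) x := by
  simp only [unitNormal_graph]
  have hc := conormSq_pos f h0
  exact ((contDiffAt_pderiv hφ (by norm_num) i).sub
    (((contDiffAt_pderiv hf (by norm_num) i).mul (contDiffAt_gradDot hf hφ)).div
      (contDiffAt_one_add_gradSq hf) (one_add_gradSq_pos f x).ne')).div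
    ((contDiffAt_conormSq hf hφ).sqrt hc.ne') (Real.sqrt_pos.2 hc).ne'

lemma sum_pderiv_mul_unitNormal_graph (f φ : Euc n → ℝ) (x : Euc n) :
    ∑ i, pderiv i f x * unitNormal (graphMetric f) φ x i
      = gradDot f φ x / (1 + gradSq f x) / Real.sqrt (conormSq f φ x) := by
  have hw := (one_add_gradSq_pos f x).ne'
  simp only [unitNormal_graph]
  have : ∀ i, pderiv i f x * ((pderiv i φ x - pderiv i f x * gradDot f φ x / (1 + gradSq f x))
      / Real.sqrt (conormSq f φ x)) = pderiv i f x * pderiv i φ x / Real.sqrt (conormSq f φ x)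
      - pderiv i f x ^ 2 * (gradDot f φ x / (1 + gradSq f x) / Real.sqrt (conormSq f φ x)) :=
    fun i => by ring
  simp only [this, Finset.sum_sub_distrib, ← Finset.sum_mul, ← Finset.sum_div]
  change gradDot f φ x / _ - gradSq f x * _ = _
  field_simp
  ring

/-- The unit normal has length one in the metric of the graph. -/
lemma unitNormal_graph_normSq (f : Euc n → ℝ) (h0 : fderiv ℝ φ x ≠ 0) :
    (∑ i, unitNormal (graphMetric f) φ x i ^ 2)
      + (∑ i, pderiv i f x * unitNormal (graphMetric f) φ x i) ^ 2 = 1 := by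
  have hc := conormSq_pos f h0
  have hw := (one_add_gradSq_pos f x).ne'
  have e1 : ∑ i, unitNormal (graphMetric f) φ x i ^ 2
      = (gradSq φ x - 2 * gradDot f φ x ^ 2 / (1 + gradSq f x)
        + gradSq f x * gradDot f φ x ^ 2 / (1 + gradSq f x) ^ 2) / conormSq f φ x := by
    simp only [unitNormal_graph, div_pow, Real.sq_sqrt hc.le]
    rw [← Finset.sum_div]
    congr 1
    have : ∀ i, (pderiv i φ x - pderiv i f x * gradDot f φ x / (1 + gradSq f x)) ^ 2
        = pderiv i φ x ^ 2 - pderiv i f x * pderiv i φ x * (2 * gradDot f φ x / (1 + gradSq f x))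
          + pderiv i f x ^ 2 * (gradDot f φ x ^ 2 / (1 + gradSq f x) ^ 2) := fun i => by
      field_simp
      ring
    simp only [this, Finset.sum_add_distrib, Finset.sum_sub_distrib, ← Finset.sum_mul]
    change gradSq φ x - gradDot f φ x * _ + gradSq f x * _ = _
    ring
  rw [e1, sum_pderiv_mul_unitNormal_graph, div_pow, div_pow, Real.sq_sqrt hc.le, ← add_div, div_eq_one_iff_eq hc.ne', conormSq]
  field_simp
  ring

lemma unitNormal_graph_lower (f φ : Euc n → ℝ) (x : Euc n) (i : Fin n) :
    unitNormal (graphMetric f) φ x i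
      + pderiv i f x * (∑ j, pderiv j f x * unitNormal (graphMetric f) φ x j)
      = pderiv i φ x / Real.sqrt (conormSq f φ x) := by
  rw [sum_pderiv_mul_unitNormal_graph, unitNormal_graph]
  ring

lemma unitNormal_of_fderiv_eq_smul (g : Euc n → Matrix (Fin n) (Fin n) ℝ) {c : ℝ} (hc : 0 < c)
    (h : fderiv ℝ φ x = c • fderiv ℝ ρ x) (i : Fin n) :
    unitNormal g φ x i = unitNormal g ρ x i := by
  simp only [unitNormal, pderiv_eq_mul h]
  have h1 : ∑ j, (g x)⁻¹ i j * (c * pderiv j ρ x) = c * ∑ j, (g x)⁻¹ i j * pderiv j ρ x := by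
    rw [Finset.mul_sum]; exact Finset.sum_congr rfl fun j _ => by ring
  have h2 : ∑ k, ∑ j, (g x)⁻¹ k j * (c * pderiv k ρ x) * (c * pderiv j ρ x)
      = c ^ 2 * ∑ k, ∑ j, (g x)⁻¹ k j * pderiv k ρ x * pderiv j ρ x := by
    simp only [Finset.mul_sum]
    exact Finset.sum_congr rfl fun k _ => Finset.sum_congr rfl fun j _ => by ring
  rw [h1, h2, Real.sqrt_mul (sq_nonneg c), Real.sqrt_sq hc.le, mul_div_mul_left _ _ hc.ne']

/-- The differential of the identity `unitNormal_graph_normSq`. -/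
lemma sum_pderiv_mul_pderiv_unitNormal (hf : ContDiffAt ℝ 2 f x) (hφ : ContDiffAt ℝ 2 φ x)
    (h0 : fderiv ℝ φ x ≠ 0) (k : Fin n) :
    (∑ i, pderiv i φ x * pderiv k (fun y => unitNormal (graphMetric f) φ y i) x)
        / Real.sqrt (conormSq f φ x)
      = -((∑ i, pderiv i f x * unitNormal (graphMetric f) φ x i)
        * ∑ i, pderiv k (pderiv i f) x * unitNormal (graphMetric f) φ x i) := by
  set X := unitNormal (graphMetric f) φ with hX
  have hd : ∀ i, DifferentiableAt ℝ (fun y => X y i) x := fun i =>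
    (contDiffAt_unitNormal_graph hf hφ h0 i).differentiableAt (by simp)
  have hdf := fun i => differentiableAt_pderiv hf i
  have hone : (fun y => (∑ i, X y i * X y i)
      + (∑ i, pderiv i f y * X y i) * (∑ i, pderiv i f y * X y i)) =ᶠ[𝓝 x] fun _ => 1 := by
    filter_upwards [fderiv_ne_zero_eventually (hφ.of_le (by norm_num)) h0] with y hy
    rw [← unitNormal_graph_normSq f hy]
    simp only [pow_two, hX]
  have hsum : DifferentiableAt ℝ (fun y => ∑ i, pderiv i f y * X y i) x :=
    DifferentiableAt.fun_sum fun i _ => (hdf i).fun_mul (hd i)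
  have h1 := pderiv_congr hone k
  rw [pderiv_const, pderiv_add (DifferentiableAt.fun_sum fun i _ => (hd i).fun_mul (hd i))
    (hsum.fun_mul hsum), pderiv_mul hsum hsum,
    pderiv_sum fun i _ => (hd i).fun_mul (hd i),
    pderiv_sum fun i _ => (hdf i).fun_mul (hd i)] at h1
  simp only [pderiv_mul (hd _) (hd _), pderiv_mul (hdf _) (hd _), Finset.sum_add_distrib] at h1
  have h2 : (∑ i, pderiv i φ x * pderiv k (fun y => X y i) x) / Real.sqrt (conormSq f φ x)
      = (∑ i, X x i * pderiv k (fun y => X y i) x)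
        + (∑ i, pderiv i f x * X x i) * ∑ i, pderiv i f x * pderiv k (fun y => X y i) x := by
    rw [Finset.sum_div, Finset.mul_sum, ← Finset.sum_add_distrib]
    refine Finset.sum_congr rfl fun i _ => ?_
    have := unitNormal_graph_lower f φ x i
    rw [mul_div_right_comm, ← this]
    simp only [hX]
    ring
  rw [h2]
  have h3 : ∑ i, pderiv k (fun y => X y i) x * X x i = ∑ i, X x i * pderiv k (fun y => X y i) x :=
    Finset.sum_congr rfl fun _ _ => mul_comm _ _
  rw [h3] at h1
  linarith

/-- The mean curvature of a hypersurface in the metric of a graph can be computed from any function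
`φ` which is constant along the hypersurface and increases in the outward direction.

The difference of the two unit normal fields vanishes along the hypersurface, so its differential
is `ξ ⊗ dρ`; as both fields have unit length, `dρ(ξ) = 0`, which is the difference of the two
divergences. -/
lemma IsDefiningAt.levelMeanCurvature_eq (h : IsDefiningAt V x ρ) (hx : x ∈ frontier V)
    (hf : ContDiffAt ℝ 2 f x) (hφ : ContDiffAt ℝ 2 φ x)
    (hc : ∀ᶠ y in 𝓝[frontier V] x, φ y = φ x) (hpos : 0 < gradDot φ ρ x) :
    levelMeanCurvature (graphMetric f) φ x = levelMeanCurvature (graphMetric f) ρ x := by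
  have hρ2 : ContDiffAt ℝ 2 ρ x := h.contDiffAt
  have hφ1 : ContDiffAt ℝ 1 φ x := hφ.of_le (by norm_num)
  have hφ0 : fderiv ℝ φ x ≠ 0 := fun h0 => by
    rw [fderiv_eq_zero_iff] at h0; simp [gradDot, h0] at hpos
  -- along the hypersurface the two unit normals agree
  have hprop : ∀ y, IsDefiningAt V y ρ → y ∈ frontier V → ContDiffAt ℝ 1 φ y →
      (∀ᶠ z in 𝓝[frontier V] y, φ z = φ y) → 0 < gradDot φ ρ y →
      ∃ c : ℝ, 0 < c ∧ fderiv ℝ φ y = c • fderiv ℝ ρ y := by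
    intro y h1 h2 h3 h4 h5
    obtain ⟨c, hcc⟩ := h1.exists_fderiv_eq_smul h2 h3 h4
    refine ⟨c, ?_, hcc⟩
    have e : gradDot φ ρ y = c * gradSq ρ y := by
      rw [gradDot, gradSq, Finset.mul_sum]
      exact Finset.sum_congr rfl fun i _ => by rw [pderiv_eq_mul hcc]; ring
    rw [e] at h5
    exact (pos_iff_pos_of_mul_pos h5).2 (gradSq_pos_iff.2 h1.2.1)
  have hagree : ∀ i, ∀ᶠ y in 𝓝[frontier V] x,
      unitNormal (graphMetric f) φ y i - unitNormal (graphMetric f) ρ y i = 0 := by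
    intro i
    have hc' : ∀ᶠ y in 𝓝[frontier V] x, ∀ᶠ z in 𝓝[frontier V] y, φ z = φ y := by
      filter_upwards [eventually_eventually_nhdsWithin.2 hc, hc] with y h1 h2
      filter_upwards [h1] with z h3
      rw [h2, h3]
    filter_upwards [h.eventually.filter_mono nhdsWithin_le_nhds,
      (hφ1.eventually (by simp)).filter_mono nhdsWithin_le_nhds, hc', self_mem_nhdsWithin,
      ((continuousAt_gradDot hφ1 h.contDiffAt).eventually
        (eventually_gt_nhds hpos)).filter_mono nhdsWithin_le_nhds] with y h1 h2 h3 h4 h5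
    obtain ⟨c, hcpos, hcc⟩ := hprop y h1 h4 h2 h3 h5
    rw [unitNormal_of_fderiv_eq_smul _ hcpos hcc, sub_self]
  obtain ⟨c, hcpos, hcc⟩ := hprop x h hx hφ1 hc hpos
  set X := unitNormal (graphMetric f) φ with hX
  set Y := unitNormal (graphMetric f) ρ with hY
  have hXc : ∀ i, ContDiffAt ℝ 1 (fun y => X y i) x := fun i =>
    contDiffAt_unitNormal_graph hf hφ hφ0 i
  have hYc : ∀ i, ContDiffAt ℝ 1 (fun y => Y y i) x := fun i =>
    contDiffAt_unitNormal_graph hf hρ2 h.2.1 i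
  have hXd : ∀ i, DifferentiableAt ℝ (fun y => X y i) x := fun i =>
    (hXc i).differentiableAt (by simp)
  have hYd : ∀ i, DifferentiableAt ℝ (fun y => Y y i) x := fun i =>
    (hYc i).differentiableAt (by simp)
  have hxx : ∀ i, X x i = Y x i := fun i => unitNormal_of_fderiv_eq_smul _ hcpos hcc i
  have hξ : ∀ i, ∃ ξ : ℝ, fderiv ℝ (fun y => X y i - Y y i) x = ξ • fderiv ℝ ρ x := fun i =>
    h.exists_fderiv_eq_smul hx ((hXc i).sub (hYc i)) (by
      filter_upwards [hagree i] with y hy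
      rw [hy, hxx, sub_self])
  choose ξ hξ using hξ
  have hdiff : ∀ k i, pderiv k (fun y => X y i) x - pderiv k (fun y => Y y i) x
      = ξ i * pderiv k ρ x := fun k i => by
    rw [← pderiv_sub (hXd i) (hYd i), pderiv_eq_mul (hξ i)]
  -- both fields have unit length
  have hcon : conormSq f φ x = c ^ 2 * conormSq f ρ x := by
    have e1 : gradSq φ x = c ^ 2 * gradSq ρ x := by
      simp only [gradSq, pderiv_eq_mul hcc, mul_pow, Finset.mul_sum]
    have e2 : gradDot f φ x = c * gradDot f ρ x := by
      simp only [gradDot, pderiv_eq_mul hcc, Finset.mul_sum]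
      exact Finset.sum_congr rfl fun i _ => by ring
    rw [conormSq, conormSq, e1, e2]; ring
  have hzero : ∀ k, (∑ i, pderiv i ρ x * ξ i) * pderiv k ρ x = 0 := by
    intro k
    have e1 := sum_pderiv_mul_pderiv_unitNormal hf hφ hφ0 k
    have e2 := sum_pderiv_mul_pderiv_unitNormal hf hρ2 h.2.1 k
    rw [← hX] at e1
    rw [← hY] at e2
    simp only [hxx] at e1
    rw [← e2, hcon, Real.sqrt_mul (sq_nonneg c), Real.sqrt_sq hcpos.le] at e1
    simp only [pderiv_eq_mul hcc, mul_assoc, ← Finset.mul_sum] at e1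
    rw [mul_div_mul_left _ _ hcpos.ne',
      div_left_inj' (Real.sqrt_pos.2 (conormSq_pos f h.2.1)).ne', ← sub_eq_zero,
      ← Finset.sum_sub_distrib] at e1
    rw [Finset.sum_mul, ← e1]
    refine Finset.sum_congr rfl fun i _ => ?_
    rw [← mul_sub, hdiff]; ring
  have htrace : ∑ i, pderiv i ρ x * ξ i = 0 := by
    by_contra hne
    exact h.2.1 (fderiv_eq_zero_iff.2 fun k => (mul_eq_zero.1 (hzero k)).resolve_left hne)
  have hsq : DifferentiableAt ℝ (fun y => Real.sqrt (graphMetric f y).det) x := by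
    simp only [det_graphMetric]
    exact ((differentiableAt_gradSq hf).const_add 1).sqrt (one_add_gradSq_pos f x).ne'
  rw [levelMeanCurvature, levelMeanCurvature, metricDiv, metricDiv, ← hX, ← hY]
  congr 1
  rw [← sub_eq_zero, ← Finset.sum_sub_distrib]
  have : ∀ i, pderiv i (fun y => Real.sqrt (graphMetric f y).det * X y i) x
      - pderiv i (fun y => Real.sqrt (graphMetric f y).det * Y y i) x
      = Real.sqrt (graphMetric f x).det * (pderiv i ρ x * ξ i) := by
    intro i
    rw [pderiv_mul hsq (hXd i), pderiv_mul hsq (hYd i), hxx, add_sub_add_left_eq_sub, ← mul_sub,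
      hdiff]
    ring
  simp only [this, ← Finset.mul_sum, htrace, mul_zero]

lemma IsDefiningAt.gradDot_pos {ρ' : Euc n → ℝ} (h : IsDefiningAt V x ρ)
    (h' : IsDefiningAt V x ρ') (hx : x ∈ frontier V) : 0 < gradDot ρ ρ' x := by
  have hc : ∀ᶠ y in 𝓝[frontier V] x, ρ y = ρ x := by
    filter_upwards [h.eventually.filter_mono nhdsWithin_le_nhds, self_mem_nhdsWithin] with y h1 h2
    rw [h1.mem_frontier_iff.1 h2, h.mem_frontier_iff.1 hx]
  obtain ⟨c, hcc⟩ := h'.exists_fderiv_eq_smul hx h.contDiffAt hc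
  have e : gradDot ρ ρ' x = c * gradSq ρ' x := by
    rw [gradDot, gradSq, Finset.mul_sum]
    exact Finset.sum_congr rfl fun i _ => by rw [pderiv_eq_mul hcc]; ring
  rw [e]
  refine mul_pos ?_ (gradSq_pos_iff.2 h'.2.1)
  by_contra! hle
  rcases hle.lt_or_eq with hlt | rfl
  · obtain ⟨v, hv⟩ := exists_pos_fderiv h'.2.1
    have h1 := eventually_lt_add_smul h'.differentiableAt hv
    have h2 := eventually_add_smul_lt (v := v) h.differentiableAt
      (by rw [hcc]; exact mul_neg_of_neg_of_pos hlt hv)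
    obtain ⟨s, h3, h4, h5, h6⟩ := (h1.and (h2.and (((tendsto_add_smul x v).eventually h.2.2).and
      ((tendsto_add_smul x v).eventually h'.2.2)))).exists
    rw [h.mem_frontier_iff.1 hx] at h4
    rw [h'.mem_frontier_iff.1 hx] at h3
    exact absurd (h6.1 (h5.2 h4)) (not_lt.2 h3.le)
  · exact h.2.1 (by simpa using hcc)

/-- The boundary mean curvature can be computed from any local defining function. -/
lemma IsDefiningAt.boundaryMeanCurvature_graph (h : IsDefiningAt V x ρ) (hx : x ∈ frontier V)
    (hf : ContDiffAt ℝ 2 f x) :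
    boundaryMeanCurvature (graphMetric f) V x = levelMeanCurvature (graphMetric f) ρ x := by
  have hex : ∃ ρ, IsDefiningAt V x ρ := ⟨ρ, h⟩
  rw [boundaryMeanCurvature, dif_pos hex]
  have h' := hex.choose_spec
  refine h.levelMeanCurvature_eq hx hf h'.contDiffAt ?_ (h'.gradDot_pos h hx)
  filter_upwards [h'.eventually.filter_mono nhdsWithin_le_nhds, self_mem_nhdsWithin] with y h1 h2
  rw [h1.mem_frontier_iff.1 h2, h'.mem_frontier_iff.1 hx]

lemma IsDefiningAt.boundaryMeanCurvature_flat (h : IsDefiningAt V x ρ) (hx : x ∈ frontier V) :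
    boundaryMeanCurvature (flatMetric n) V x = levelMeanCurvature (flatMetric n) ρ x := by
  rw [flatMetric_eq]
  exact h.boundaryMeanCurvature_graph hx contDiffAt_const

/-- The mean curvature of the level sets of `f` in the graph of `f`. -/
lemma levelMeanCurvature_graph_self (hf : ContDiffAt ℝ 2 f x) (h0 : fderiv ℝ f x ≠ 0) :
    levelMeanCurvature (graphMetric f) f x
      = levelMeanCurvature (flatMetric n) f x / Real.sqrt (1 + gradSq f x) := by
  have key : ∀ i, (fun y => Real.sqrt (graphMetric f y).det * unitNormal (graphMetric f) f y i)
      =ᶠ[𝓝 x] fun y => unitNormal (flatMetric n) f y i := by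
    intro i
    filter_upwards [fderiv_ne_zero_eventually (hf.of_le (by norm_num)) h0] with y hy
    have hP := gradSq_pos_iff.2 hy
    have hw := one_add_gradSq_pos f y
    have e : conormSq f f y = gradSq f y / (1 + gradSq f y) := by
      rw [conormSq, gradDot_self]; field_simp; ring
    rw [det_graphMetric, unitNormal_graph, unitNormal_flat, e, gradDot_self,
      Real.sqrt_div hP.le]
    have hs := (Real.sqrt_pos.2 hP).ne'
    have hsw := (Real.sqrt_pos.2 hw).ne'
    have hw2 := Real.sq_sqrt hw.le
    field_simp
    rw [hw2]
    ring
  rw [levelMeanCurvature, levelMeanCurvature, metricDiv_flat, metricDiv, det_graphMetric]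
  simp only [pderiv_congr (key _)]
  rw [div_eq_inv_mul]

/-- At a critical point of `f` the graph is tangent to `ℝⁿ` to first order. -/
lemma levelMeanCurvature_graph_of_fderiv_eq_zero (hf : ContDiffAt ℝ 2 f x)
    (hρ : ContDiffAt ℝ 2 ρ x) (h0 : fderiv ℝ ρ x ≠ 0) (hf0 : fderiv ℝ f x = 0) :
    levelMeanCurvature (graphMetric f) ρ x = levelMeanCurvature (flatMetric n) ρ x := by
  have hp : ∀ i, pderiv i f x = 0 := fderiv_eq_zero_iff.1 hf0
  have hP : gradSq f x = 0 := gradSq_eq_zero_iff.2 hf0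
  have hD : gradDot f ρ x = 0 := by simp [gradDot, hp]
  have hw : (1 + gradSq f x) ≠ 0 := (one_add_gradSq_pos f x).ne'
  have hdD := differentiableAt_gradDot hf hρ
  have hdw : DifferentiableAt ℝ (fun y => (1 + gradSq f y)⁻¹) x :=
    ((differentiableAt_gradSq hf).const_add 1).fun_inv hw
  have hPρ := gradSq_pos_iff.2 h0
  have hdP := differentiableAt_gradSq hρ
  have hcon : conormSq f ρ x = gradSq ρ x := by simp [conormSq, hD]
  have hs : Real.sqrt (gradSq ρ x) ≠ 0 := (Real.sqrt_pos.2 hPρ).ne'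
  have hdc : DifferentiableAt ℝ (conormSq f ρ) x :=
    (contDiffAt_conormSq hf hρ).differentiableAt (by simp)
  -- the metrics differ by a product of two functions vanishing at `x`
  have hpc : ∀ k, pderiv k (conormSq f ρ) x = pderiv k (gradSq ρ) x := by
    intro k
    have : conormSq f ρ
        = fun y => gradSq ρ y - gradDot f ρ y * (gradDot f ρ y * (1 + gradSq f y)⁻¹) := by
      ext y; rw [conormSq]; ring
    rw [this, pderiv_sub hdP (hdD.fun_mul (hdD.fun_mul hdw)), pderiv_mul hdD (hdD.fun_mul hdw),
      pderiv_mul hdD hdw, hD]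
    ring
  have hX : ∀ i, pderiv i (fun y => Real.sqrt (graphMetric f y).det
      * unitNormal (graphMetric f) ρ y i) x
      = pderiv i (fun y => unitNormal (flatMetric n) ρ y i) x := by
    intro i
    have hXd : DifferentiableAt ℝ (fun y => unitNormal (graphMetric f) ρ y i) x :=
      (contDiffAt_unitNormal_graph hf hρ h0 i).differentiableAt (by simp)
    have hsd : DifferentiableAt ℝ (fun y => Real.sqrt (1 + gradSq f y)) x :=
      ((differentiableAt_gradSq hf).const_add 1).sqrt hw
    have hdi := differentiableAt_pderiv hf i
    have hdρ := differentiableAt_pderiv hρ i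
    have hsc : DifferentiableAt ℝ (fun y => Real.sqrt (conormSq f ρ y)) x :=
      hdc.sqrt (by rw [hcon]; exact hPρ.ne')
    have hsP : DifferentiableAt ℝ (fun y => Real.sqrt (gradSq ρ y)) x := hdP.sqrt hPρ.ne'
    have hinner : DifferentiableAt ℝ
        (fun y => pderiv i f y * (gradDot f ρ y * (1 + gradSq f y)⁻¹)) x :=
      hdi.fun_mul (hdD.fun_mul hdw)
    simp only [det_graphMetric]
    rw [pderiv_mul hsd hXd, pderiv_sqrt ((differentiableAt_gradSq hf).const_add 1) hw,
      pderiv_add (by fun_prop) (differentiableAt_gradSq hf), pderiv_const, pderiv_gradSq hf]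
    simp only [hp, hP, zero_mul, Finset.sum_const_zero, mul_zero, add_zero, zero_div, zero_add,
      Real.sqrt_one, one_mul]
    have e1 : (fun y => unitNormal (graphMetric f) ρ y i) = fun y => (pderiv i ρ y
        - pderiv i f y * (gradDot f ρ y * (1 + gradSq f y)⁻¹))
          * (Real.sqrt (conormSq f ρ y))⁻¹ := by
      ext y; rw [unitNormal_graph]; ring
    have e2 : (fun y => unitNormal (flatMetric n) ρ y i)
        = fun y => pderiv i ρ y * (Real.sqrt (gradSq ρ y))⁻¹ := by
      ext y; rw [unitNormal_flat]; ring
    rw [e1, e2, pderiv_mul (hdρ.fun_sub hinner) (hsc.fun_inv (by rw [hcon]; exact hs)),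
      pderiv_mul hdρ (hsP.fun_inv hs), pderiv_inv hsc (by rw [hcon]; exact hs),
      pderiv_inv hsP hs, pderiv_sqrt hdc (by rw [hcon]; exact hPρ.ne'),
      pderiv_sqrt hdP hPρ.ne', hpc, hcon, pderiv_sub hdρ hinner, pderiv_mul hdi (hdD.fun_mul hdw),
      hD, hp]
    ring
  rw [levelMeanCurvature, levelMeanCurvature, metricDiv_flat, metricDiv, det_graphMetric, hP]
  simp [hX]

lemma pderiv_const_smul (c : ℝ) (i : Fin n) :
    pderiv i (fun y => c * f y) x = c * pderiv i f x := by
  rcases eq_or_ne c 0 with rfl | hc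
  · simp [pderiv_const]
  · have : fderiv ℝ (fun y => c * f y) x = c • fderiv ℝ f x :=
      congrFun (fderiv_const_smul_field (f := f) c) x
    exact pderiv_eq_mul this i

/-- If `f` is constant along `∂V`, then the mean curvature of `∂V` in the graph of `f` is its mean
curvature in `ℝⁿ` divided by `√(1 + |Df|²)`. -/
lemma IsDefiningAt.boundaryMeanCurvature_graph_eq_div (h : IsDefiningAt V x ρ)
    (hx : x ∈ frontier V) (hf : ContDiffAt ℝ 2 f x)
    (hc : ∀ᶠ y in 𝓝[frontier V] x, f y = f x) :
    boundaryMeanCurvature (graphMetric f) V x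
      = boundaryMeanCurvature (flatMetric n) V x / Real.sqrt (1 + gradSq f x) := by
  rw [h.boundaryMeanCurvature_graph hx hf, h.boundaryMeanCurvature_flat hx]
  by_cases hf0 : fderiv ℝ f x = 0
  · rw [levelMeanCurvature_graph_of_fderiv_eq_zero hf h.contDiffAt h.2.1 hf0,
      gradSq_eq_zero_iff.2 hf0]
    simp
  obtain ⟨c, hcc⟩ := h.exists_fderiv_eq_smul hx (hf.of_le (by norm_num)) hc
  have hc0 : c ≠ 0 := by rintro rfl; exact hf0 (by simpa using hcc)
  -- up to a sign, `f` itself is a defining function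
  obtain ⟨σ, hσ, hσc⟩ : ∃ σ : ℝ, σ ^ 2 = 1 ∧ 0 < σ * c := by
    rcases lt_or_gt_of_ne hc0 with hc0 | hc0
    · exact ⟨-1, by norm_num, by linarith⟩
    · exact ⟨1, by norm_num, by linarith⟩
  set φ : Euc n → ℝ := fun y => σ * f y with hφdef
  have hφ : ContDiffAt ℝ 2 φ x := contDiffAt_const.mul hf
  have hpφ : ∀ i y, pderiv i φ y = σ * pderiv i f y := fun i y => pderiv_const_smul σ i
  have hgm : graphMetric f = graphMetric φ := by
    ext y i j
    rw [graphMetric_apply, graphMetric_apply, hpφ, hpφ]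
    linear_combination (-(pderiv i f y * pderiv j f y)) * hσ
  have hgs : gradSq f x = gradSq φ x := by
    simp only [gradSq, hpφ, mul_pow, hσ, one_mul]
  have hφc : ∀ᶠ y in 𝓝[frontier V] x, φ y = φ x := hc.mono fun y hy => by rw [hφdef]; simp [hy]
  have hpos : 0 < gradDot φ ρ x := by
    have e : gradDot φ ρ x = σ * c * gradSq ρ x := by
      rw [gradDot, gradSq, Finset.mul_sum]
      exact Finset.sum_congr rfl fun i _ => by rw [hpφ, pderiv_eq_mul hcc]; ring
    rw [e]
    exact mul_pos hσc (gradSq_pos_iff.2 h.2.1)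
  have hφ0 : fderiv ℝ φ x ≠ 0 := fun h0 => by
    rw [fderiv_eq_zero_iff] at h0; simp [gradDot, h0] at hpos
  have e1 := h.levelMeanCurvature_eq hx hφ hφ hφc hpos
  have e2 := h.levelMeanCurvature_eq (f := fun _ => (0 : ℝ)) hx contDiffAt_const hφ hφc hpos
  rw [← flatMetric_eq] at e2
  rw [hgm, ← e1, levelMeanCurvature_graph_self hφ hφ0, e2, hgs]

/-- The mean curvature of a smooth boundary in `ℝⁿ` is continuous along the boundary. -/
lemma HasSmoothBoundary.continuousOn_boundaryMeanCurvature (hV : HasSmoothBoundary V) :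
    ContinuousOn (boundaryMeanCurvature (flatMetric n) V) (frontier V) := by
  intro x hx
  obtain ⟨ρ, h⟩ := hV x hx
  have h1 := (continuousAt_levelMeanCurvature_flat (h.contDiffAt (k := 2)) h.2.1).continuousWithinAt
    (s := frontier V)
  refine h1.congr_of_eventuallyEq ?_ (h.boundaryMeanCurvature_flat hx)
  filter_upwards [h.eventually.filter_mono nhdsWithin_le_nhds, self_mem_nhdsWithin] with y h2 h3
  exact h2.boundaryMeanCurvature_flat h3

end MeanCurvature

/-! ### The maximum principle for graphs of non-negative mean curvature -/

section MaximumPrinciple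

variable {n : ℕ} {f φ w v : Euc n → ℝ} {x y c : Euc n} {r M : ℝ}

/-- The second order linear operator `aⁱʲ ∂ᵢⱼ` with `aⁱʲ = (1 + |Df|²) δⁱʲ - fᵢ fⱼ`. -/
noncomputable def graphOp (f w : Euc n → ℝ) (x : Euc n) : ℝ :=
  (1 + gradSq f x) * lapl w x
    - ∑ i, ∑ j, pderiv i f x * pderiv j f x * pderiv i (pderiv j w) x

lemma graphOp_self (f : Euc n → ℝ) (x : Euc n) : graphOp f f x = graphMean f x := rfl

/-- The vectors `W eᵢ - fᵢ Df / (1 + W)`, with `W² = 1 + |Df|²`, give a square root of the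
coefficient matrix of `graphOp`. -/
lemma graphOp_nonpos (h : ∀ e : Euc n, ∑ i, ∑ j, e i * e j * pderiv i (pderiv j w) x ≤ 0) :
    graphOp f w x ≤ 0 := by
  have hw := one_add_gradSq_pos f x
  set P := gradSq f x with hP
  set W := Real.sqrt (1 + P) with hW
  have hW2 : W ^ 2 = 1 + P := Real.sq_sqrt hw.le
  have hWpos : 0 < W := Real.sqrt_pos.2 hw
  set κ := (1 + W)⁻¹ with hκ
  have hκeq : κ ^ 2 * P - 2 * W * κ = -1 := by
    have : P = W ^ 2 - 1 := by linarith
    rw [this, hκ]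
    field_simp
    ring
  set A : Fin n → Fin n → ℝ := fun i j => pderiv i (pderiv j w) x with hA
  set q : Fin n → ℝ := fun i => pderiv i f x with hq
  set b : Fin n → Fin n → ℝ := fun k i => W * (if k = i then 1 else 0) - κ * q k * q i with hb
  have hb2 : ∀ i j, ∑ k, b k i * b k j = W ^ 2 * (if i = j then 1 else 0) - q i * q j := by
    intro i j
    have e : ∀ k, b k i * b k j = W ^ 2 * ((if k = i then 1 else 0) * (if k = j then 1 else 0))
        - W * κ * q j * ((if k = i then 1 else 0) * q k)
        - W * κ * q i * ((if k = j then 1 else 0) * q k)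
        + κ ^ 2 * q i * q j * q k ^ 2 := fun k => by simp only [hb]; ring
    have hqP : ∑ k, q k ^ 2 = P := rfl
    simp only [e, Finset.sum_add_distrib, Finset.sum_sub_distrib, ← Finset.mul_sum, hqP, ite_mul,
      one_mul, zero_mul, Finset.sum_ite_eq', Finset.mem_univ, if_true]
    linear_combination (q i * q j) * hκeq
  have hsum : ∑ k, ∑ i, ∑ j, b k i * b k j * A i j = graphOp f w x := by
    have e1 : ∑ k, ∑ i, ∑ j, b k i * b k j * A i j = ∑ i, ∑ j, (∑ k, b k i * b k j) * A i j := by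
      rw [Finset.sum_comm]
      refine Finset.sum_congr rfl fun i _ => ?_
      rw [Finset.sum_comm]
      exact Finset.sum_congr rfl fun j _ => (Finset.sum_mul _ _ _).symm
    rw [e1, graphOp, ← hP, ← hW2, lapl, Finset.mul_sum, ← Finset.sum_sub_distrib]
    refine Finset.sum_congr rfl fun i _ => ?_
    simp only [hb2, sub_mul, Finset.sum_sub_distrib, mul_ite, mul_one, mul_zero, ite_mul, zero_mul,
      Finset.sum_ite_eq, Finset.mem_univ, if_true]
    rfl
  rw [← hsum]
  exact Finset.sum_nonpos fun k _ => by simpa using h (WithLp.toLp 2 (b k))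

lemma graphOp_nonpos_of_isLocalMax (hw : ContDiffAt ℝ 2 w x) (hmax : IsLocalMax w x) :
    graphOp f w x ≤ 0 := by
  refine graphOp_nonpos fun e => ?_
  have : IsLocalMax (fun s : ℝ => w (x + s • e + s ^ 2 • (0 : Euc n))) 0 := by
    have hc : ContinuousAt (fun s : ℝ => x + s • e + s ^ 2 • (0 : Euc n)) 0 := by fun_prop
    have h0 : x + (0 : ℝ) • e + (0 : ℝ) ^ 2 • (0 : Euc n) = x := by simp
    have := hc.tendsto
    rw [h0] at this
    filter_upwards [this.eventually hmax] with s hs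
    simpa using hs
  have := (secondOrder_of_isLocalMax hw this).2
  simpa using this

lemma graphOp_add (hw : ContDiffAt ℝ 2 w x) (hv : ContDiffAt ℝ 2 v x) (ε : ℝ) :
    graphOp f (fun y => w y + ε * v y) x = graphOp f w x + ε * graphOp f v x := by
  have h1 : ∀ j, pderiv j (fun y => w y + ε * v y) =ᶠ[𝓝 x]
      fun y => pderiv j w y + ε * pderiv j v y := by
    intro j
    filter_upwards [hw.eventually (by simp), hv.eventually (by simp)] with y h1 h2
    have h2' := h2.differentiableAt (by simp)
    rw [pderiv_add (h1.differentiableAt (by simp)) (h2'.const_mul ε), pderiv_const_mul h2']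
  have h2 : ∀ i j, pderiv i (pderiv j (fun y => w y + ε * v y)) x
      = pderiv i (pderiv j w) x + ε * pderiv i (pderiv j v) x := by
    intro i j
    have hd := differentiableAt_pderiv hv j
    rw [pderiv_congr (h1 j), pderiv_add (differentiableAt_pderiv hw j) (hd.const_mul ε),
      pderiv_const_mul hd]
  simp only [graphOp, lapl, h2, mul_add, Finset.sum_add_distrib, Finset.mul_sum]
  have : ∀ i j, pderiv i f x * pderiv j f x * (ε * pderiv i (pderiv j v) x)
      = ε * (pderiv i f x * pderiv j f x * pderiv i (pderiv j v) x) := fun i j => by ring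
  have h3 : ∀ i, (1 + gradSq f x) * (ε * pderiv i (pderiv i v) x)
      = ε * ((1 + gradSq f x) * pderiv i (pderiv i v) x) := fun i => by ring
  simp only [this, h3, mul_sub, Finset.mul_sum]
  ring

/-- The comparison function `exp(-α |x - c|²)` of Hopf's lemma. -/
noncomputable def barrier (α : ℝ) (c : Euc n) (x : Euc n) : ℝ :=
  Real.exp (-α * ∑ i, (x i - c i) ^ 2)

lemma sum_sq_eq_norm_sq (x c : Euc n) : ∑ i, (x i - c i) ^ 2 = ‖x - c‖ ^ 2 := by
  rw [EuclideanSpace.norm_sq_eq]; simp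

lemma contDiff_barrier (α : ℝ) (c : Euc n) : ContDiff ℝ 2 (barrier α c) := by
  unfold barrier
  refine Real.contDiff_exp.comp (contDiff_const.mul (ContDiff.sum fun i _ => ?_))
  exact ContDiff.pow (by fun_prop) 2

lemma pderiv_coord (i j : Fin n) : pderiv i (fun y : Euc n => y j) x = if i = j then 1 else 0 := by
  have : (fun y : Euc n => y j) = EuclideanSpace.proj j := rfl
  rw [pderiv, this, ContinuousLinearMap.fderiv]
  simp [eq_comm]

lemma pderiv_barrier (α : ℝ) (c x : Euc n) (i : Fin n) :
    pderiv i (barrier α c) x = -2 * α * (x i - c i) * barrier α c x := by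
  have hd : ∀ j, DifferentiableAt ℝ (fun y : Euc n => y j - c j) x := fun j => by fun_prop
  have hs : DifferentiableAt ℝ (fun y : Euc n => ∑ j, (y j - c j) * (y j - c j)) x :=
    DifferentiableAt.fun_sum fun j _ => (hd j).fun_mul (hd j)
  have e : barrier α c = fun y => Real.exp (-α * ∑ j, (y j - c j) * (y j - c j)) := by
    ext y; simp only [barrier, pow_two]
  rw [e, pderiv_comp (u := Real.exp) (Real.hasDerivAt_exp _) (hs.const_mul _),
    pderiv_const_mul hs, pderiv_sum fun j _ => (hd j).fun_mul (hd j)]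
  have : ∀ j, pderiv i (fun y : Euc n => (y j - c j) * (y j - c j)) x
      = if i = j then 2 * (x j - c j) else 0 := by
    intro j
    rw [pderiv_mul (hd j) (hd j), pderiv_sub (by fun_prop) (by fun_prop), pderiv_const,
      pderiv_coord]
    split_ifs <;> ring
  simp only [this, Finset.sum_ite_eq, Finset.mem_univ, if_true]
  ring

lemma pderiv_pderiv_barrier (α : ℝ) (c x : Euc n) (i j : Fin n) :
    pderiv i (pderiv j (barrier α c)) x
      = (4 * α ^ 2 * (x i - c i) * (x j - c j) - if i = j then 2 * α else 0) * barrier α c x := by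
  have e : pderiv j (barrier α c) = fun y => (-2 * α) * ((y j - c j) * barrier α c y) := by
    ext y; rw [pderiv_barrier]; ring
  have hb : DifferentiableAt ℝ (barrier α c) x := (contDiff_barrier α c).differentiable (by simp) x
  have hd : DifferentiableAt ℝ (fun y : Euc n => y j - c j) x := by fun_prop
  rw [e, pderiv_const_mul (hd.fun_mul hb), pderiv_mul hd hb, pderiv_barrier,
    pderiv_sub (by fun_prop) (by fun_prop), pderiv_const, pderiv_coord]
  split_ifs <;> ring

lemma graphOp_barrier_pos {α : ℝ} (hα : 0 < α)
    (h : n * (1 + gradSq f x) < 2 * α * ‖x - c‖ ^ 2) : 0 < graphOp f (barrier α c) x := by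
  have hb : 0 < barrier α c x := Real.exp_pos _
  have hP := gradSq_nonneg f x
  set q : Fin n → ℝ := fun i => pderiv i f x with hq
  set d : Fin n → ℝ := fun i => x i - c i with hd
  have hdn : ∑ i, d i ^ 2 = ‖x - c‖ ^ 2 := sum_sq_eq_norm_sq x c
  have hcs : (∑ i, q i * d i) ^ 2 ≤ gradSq f x * ‖x - c‖ ^ 2 := by
    rw [← hdn]; exact Finset.sum_mul_sq_le_sq_mul_sq _ _ _
  have e1 : lapl (barrier α c) x = (4 * α ^ 2 * ‖x - c‖ ^ 2 - 2 * α * n) * barrier α c x := by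
    have : ∀ i, pderiv i (pderiv i (barrier α c)) x
        = 4 * α ^ 2 * barrier α c x * d i ^ 2 - 2 * α * barrier α c x := fun i => by
      rw [pderiv_pderiv_barrier]
      simp only [hd, if_true]
      ring
    simp only [lapl, this, Finset.sum_sub_distrib, ← Finset.mul_sum, hdn, Finset.sum_const,
      Finset.card_univ, Fintype.card_fin, nsmul_eq_mul]
    ring
  have e2 : ∑ i, ∑ j, pderiv i f x * pderiv j f x * pderiv i (pderiv j (barrier α c)) x
      = (4 * α ^ 2 * (∑ i, q i * d i) ^ 2 - 2 * α * gradSq f x) * barrier α c x := by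
    have : ∀ i j, pderiv i f x * pderiv j f x * pderiv i (pderiv j (barrier α c)) x
        = 4 * α ^ 2 * barrier α c x * ((q i * d i) * (q j * d j))
          - if i = j then 2 * α * barrier α c x * (q i * q j) else 0 := by
      intro i j
      rw [pderiv_pderiv_barrier]
      simp only [hq, hd]
      split_ifs <;> ring
    simp only [this, Finset.sum_sub_distrib, ← Finset.mul_sum, Finset.sum_ite_eq, Finset.mem_univ,
      if_true, gradSq, ← Finset.sum_mul, pow_two]
    ring
  rw [graphOp, e1, e2]
  set D := ‖x - c‖ ^ 2
  set S := (∑ i, q i * d i) ^ 2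
  set P := gradSq f x
  have : 0 < 4 * α ^ 2 * ((1 + P) * D - S) - 2 * α * (n * (1 + P) - P) := by
    have h1 : 4 * α ^ 2 * D ≤ 4 * α ^ 2 * ((1 + P) * D - S) := by
      refine mul_le_mul_of_nonneg_left ?_ (by positivity); nlinarith
    have h2 : 2 * α * (n * (1 + P)) < 2 * α * (2 * α * D) :=
      mul_lt_mul_of_pos_left h (by positivity)
    nlinarith
  have e3 : (1 + P) * ((4 * α ^ 2 * D - 2 * α * n) * barrier α c x)
      - (4 * α ^ 2 * S - 2 * α * P) * barrier α c x
      = (4 * α ^ 2 * ((1 + P) * D - S) - 2 * α * (n * (1 + P) - P)) * barrier α c x := by ring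
  rw [e3]
  positivity

/-- Hopf's boundary point lemma for functions whose graph has non-negative mean curvature. -/
lemma hopf_boundary_point (hr : 0 < r) (hy : ‖y - c‖ = r)
    (hf : ∀ x ∈ Metric.closedBall c r, ContDiffAt ℝ 2 f x)
    (hQ : ∀ x ∈ Metric.ball c r, 0 ≤ graphMean f x)
    (hlt : ∀ x ∈ Metric.closedBall c r, x ≠ y → f x < M) (hM : f y = M)
    (hD : fderiv ℝ f y = 0) : False := by
  have hfc : ContinuousOn f (Metric.closedBall c r) := fun x hx =>
    (hf x hx).continuousAt.continuousWithinAt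
  have hPc : ContinuousOn (gradSq f) (Metric.closedBall c r) := fun x hx =>
    (continuousAt_gradSq ((hf x hx).of_le (by norm_num))).continuousWithinAt
  have hle : ∀ x ∈ Metric.closedBall c r, f x ≤ M := fun x hx => by
    rcases eq_or_ne x y with rfl | hne
    · exact hM.le
    · exact (hlt x hx hne).le
  obtain ⟨p, -, hp⟩ := (isCompact_closedBall c r).exists_isMaxOn
    ⟨c, Metric.mem_closedBall_self hr.le⟩ hPc
  set B := gradSq f p
  have hB0 : 0 ≤ B := gradSq_nonneg f p
  -- the barrier is a strict subsolution outside the ball of half the radius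
  set α := 2 * n * (1 + B) / r ^ 2 + 1 with hα
  have hαpos : 0 < α := by positivity
  have hop : ∀ x ∈ Metric.closedBall c r, r / 2 ≤ ‖x - c‖ → 0 < graphOp f (barrier α c) x := by
    intro x hx hxr
    refine graphOp_barrier_pos hαpos ?_
    have h1 : gradSq f x ≤ B := hp hx
    have h2 : (r / 2) ^ 2 ≤ ‖x - c‖ ^ 2 := pow_le_pow_left₀ (by positivity) hxr 2
    have h3 : 2 * α * (r / 2) ^ 2 = n * (1 + B) + r ^ 2 / 2 := by
      rw [hα]; field_simp
    have h4 : (n : ℝ) * (1 + gradSq f x) ≤ n * (1 + B) := by gcongr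
    have h5 : 2 * α * (r / 2) ^ 2 ≤ 2 * α * ‖x - c‖ ^ 2 := by gcongr
    have h6 : 0 < r ^ 2 / 2 := by positivity
    linarith
  have hsub : Metric.closedBall c (r / 2) ⊆ Metric.closedBall c r :=
    Metric.closedBall_subset_closedBall (by linarith)
  obtain ⟨z, hz, hzmax⟩ := (isCompact_closedBall c (r / 2)).exists_isMaxOn
    ⟨c, Metric.mem_closedBall_self (by linarith)⟩ (hfc.mono hsub)
  have hzM : f z < M := hlt z (hsub hz) (by
    rintro rfl
    rw [Metric.mem_closedBall, dist_eq_norm] at hz; linarith)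
  set ε := M - f z with hε
  have hεpos : 0 < ε := by linarith
  have hb1 : ∀ x, barrier α c x ≤ 1 := fun x => by
    rw [barrier, sum_sq_eq_norm_sq, Real.exp_le_one_iff]
    nlinarith [sq_nonneg ‖x - c‖]
  set b0 := barrier α c y with hb0
  have hb0pos : 0 < b0 := Real.exp_pos _
  set w : Euc n → ℝ := fun x => f x + ε * (barrier α c x - b0) with hw
  have hbc : ∀ x, ContDiffAt ℝ 2 (fun x => barrier α c x - b0) x := fun x =>
    (contDiff_barrier α c).contDiffAt.sub contDiffAt_const
  have hwc : ∀ x ∈ Metric.closedBall c r, ContDiffAt ℝ 2 w x := fun x hx =>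
    (hf x hx).add (contDiffAt_const.mul (hbc x))
  have hopw : ∀ x ∈ Metric.closedBall c r,
      graphOp f w x = graphMean f x + ε * graphOp f (barrier α c) x := by
    intro x hx
    rw [hw, graphOp_add (hf x hx) (hbc x), graphOp_self]
    congr 2
    have := graphOp_add (f := f) (contDiff_barrier α c).contDiffAt
      (contDiffAt_const (c := b0) (x := x)) (-1)
    have e : (fun x => barrier α c x - b0) = fun x => barrier α c x + -1 * b0 := by ext; ring
    rw [e, this]
    have hz : ∀ i j : Fin n, pderiv i (pderiv j fun _ => b0) x = 0 := fun i j => by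
      have : pderiv j (fun _ : Euc n => b0) = fun _ => 0 := by ext; exact pderiv_const j b0
      rw [this, pderiv_const]
    simp [graphOp, lapl, hz]
  set K := Metric.closedBall c r \ Metric.ball c (r / 2) with hK
  have hKc : IsCompact K := (isCompact_closedBall c r).diff Metric.isOpen_ball
  have hyr : y ∈ Metric.closedBall c r := by rw [Metric.mem_closedBall, dist_eq_norm, hy]
  have hyK : y ∈ K := ⟨hyr, by rw [Metric.mem_ball, dist_eq_norm, hy]; linarith⟩
  have hwK : ∀ x ∈ K, w x ≤ M := by
    obtain ⟨m, hmK, hmax⟩ := hKc.exists_isMaxOn ⟨y, hyK⟩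
      (fun x hx => (hwc x hx.1).continuousAt.continuousWithinAt)
    by_contra! hcon
    obtain ⟨x, hxK, hx⟩ := hcon
    have hm : M < w m := hx.trans_le (hmax hxK)
    have hm1 : ‖m - c‖ ≤ r := by simpa [dist_eq_norm] using hmK.1
    have hm2 : r / 2 ≤ ‖m - c‖ := by simpa [dist_eq_norm] using hmK.2
    have hm1' : ‖m - c‖ < r := by
      refine lt_of_le_of_ne hm1 fun heq => ?_
      have : barrier α c m = b0 := by
        rw [hb0, barrier, barrier, sum_sq_eq_norm_sq, sum_sq_eq_norm_sq, heq, hy]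
      have h2 := hle m hmK.1
      simp only [hw, this, sub_self, mul_zero, add_zero] at hm
      linarith
    have hm2' : r / 2 < ‖m - c‖ := by
      refine lt_of_le_of_ne hm2 fun heq => ?_
      have h1 : f m ≤ f z := hzmax (by
        rw [Metric.mem_closedBall, dist_eq_norm, ← heq])
      have h2 : ε * (barrier α c m - b0) ≤ ε * 1 := by
        refine mul_le_mul_of_nonneg_left ?_ hεpos.le; linarith [hb1 m]
      simp only [hw] at hm
      linarith
    have hloc : IsLocalMax w m := by
      have hopen : IsOpen {x : Euc n | ‖x - c‖ < r ∧ r / 2 < ‖x - c‖} :=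
        IsOpen.and (isOpen_lt (by fun_prop) (by fun_prop)) (isOpen_lt (by fun_prop) (by fun_prop))
      filter_upwards [hopen.mem_nhds ⟨hm1', hm2'⟩] with x hx
      refine hmax ⟨?_, ?_⟩
      · rw [Metric.mem_closedBall, dist_eq_norm]; exact hx.1.le
      · rw [Metric.mem_ball, dist_eq_norm]; exact not_lt.2 hx.2.le
    have h1 := graphOp_nonpos_of_isLocalMax (f := f) (hwc m hmK.1) hloc
    rw [hopw m hmK.1] at h1
    have h2 := hQ m (by rw [Metric.mem_ball, dist_eq_norm]; exact hm1')
    have h3 := mul_pos hεpos (hop m hmK.1 hm2)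
    linarith
  -- the radial derivative at `y`
  have hbd : DifferentiableAt ℝ (fun x => barrier α c x - b0) y := (hbc y).differentiableAt (by simp)
  have hpw : ∀ i, pderiv i w y = ε * (-2 * α * (y i - c i) * b0) := by
    intro i
    have hpf : pderiv i f y = 0 := fderiv_eq_zero_iff.1 hD i
    rw [hw, pderiv_add ((hf y hyr).differentiableAt (by simp)) (hbd.const_mul ε), hpf,
      pderiv_const_mul hbd, pderiv_sub ((contDiff_barrier α c).differentiable (by simp) y)
        (by fun_prop), pderiv_const, pderiv_barrier]
    ring
  have hpos : 0 < fderiv ℝ w y (c - y) := by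
    rw [fderiv_apply_eq_sum]
    have : ∀ i, (c - y) i * pderiv i w y = 2 * ε * α * b0 * (y i - c i) ^ 2 := fun i => by
      rw [hpw]; simp only [PiLp.sub_apply]; ring
    simp only [this, ← Finset.mul_sum]
    rw [sum_sq_eq_norm_sq, hy]
    positivity
  have hwy : w y = M := by simp [hw, hb0, hM]
  have h1 := eventually_lt_add_smul ((hwc y hyr).differentiableAt (by simp)) hpos
  have h2 : ∀ᶠ s : ℝ in 𝓝[>] 0, s ∈ Set.Ioo (0 : ℝ) (1 / 2) := Ioo_mem_nhdsGT (by norm_num)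
  obtain ⟨s, hs1, hs2, hs3⟩ := (h1.and h2).exists
  have hmem : y + s • (c - y) ∈ K := by
    have e : ‖y + s • (c - y) - c‖ = (1 - s) * r := by
      have : y + s • (c - y) - c = (1 - s) • (y - c) := by module
      rw [this, norm_smul, hy, Real.norm_of_nonneg (by linarith)]
    constructor
    · rw [Metric.mem_closedBall, dist_eq_norm, e]; nlinarith
    · rw [Metric.mem_ball, dist_eq_norm, e]; nlinarith
  have := hwK _ hmem
  linarith

/-- The strong maximum principle near a point `x`, which may lie on the boundary of the domain `D`
if the gradient vanishes along the boundary. -/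
lemma eq_max_near {D : Set (Euc n)} {R : ℝ} (hDo : IsOpen D)
    (hf : ∀ z ∈ Metric.ball x R ∩ closure D, ContDiffAt ℝ 2 f z)
    (hQ : ∀ z ∈ Metric.ball x R ∩ D, 0 ≤ graphMean f z)
    (hle : ∀ z ∈ Metric.ball x R ∩ D, f z ≤ M)
    (hbd : ∀ z ∈ Metric.ball x R ∩ closure D, z ∉ D → f z = M ∧ fderiv ℝ f z = 0)
    (hx : x ∉ D ∨ f x = M) :
    ∀ z ∈ Metric.ball x (R / 2) ∩ D, f z = M := by
  rintro z ⟨hzR, hzD⟩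
  by_contra hne
  rw [Metric.mem_ball] at hzR
  have hR : 0 < R := by have := dist_nonneg (x := z) (y := x); linarith
  have hzR' : z ∈ Metric.ball x R := by rw [Metric.mem_ball]; linarith
  have hzM : f z < M := lt_of_le_of_ne (hle z ⟨hzR', hzD⟩) hne
  -- the largest ball around `z` in which `f < M`
  set O := {y ∈ D ∩ Metric.ball x R | f y < M} with hO
  have hOo : IsOpen O := by
    have hc : ContinuousOn f (D ∩ Metric.ball x R) := fun y hy =>
      (hf y ⟨hy.2, subset_closure hy.1⟩).continuousAt.continuousWithinAt
    exact hc.isOpen_inter_preimage (hDo.inter Metric.isOpen_ball) isOpen_Iio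
  have hxO : x ∈ Oᶜ := fun h => by
    rcases hx with hx | hx
    · exact hx h.1.1
    · exact absurd h.2 (by simp [hx])
  have hzO : z ∈ O := ⟨⟨hzD, hzR'⟩, hzM⟩
  obtain ⟨y, hyO, hyd⟩ := hOo.isClosed_compl.exists_infDist_eq_dist ⟨x, hxO⟩ z
  set r := dist z y with hr
  have hrpos : 0 < r := dist_pos.2 fun h => hyO (h ▸ hzO)
  have hrx : r ≤ dist z x := by rw [← hyd]; exact Metric.infDist_le_dist_of_mem hxO
  have hball : Metric.ball z r ⊆ O := by
    intro a ha
    by_contra haO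
    have := Metric.infDist_le_dist_of_mem (s := Oᶜ) (x := z) haO
    rw [Metric.mem_ball, dist_comm] at ha
    linarith
  have hyR : y ∈ Metric.ball x R := by
    rw [Metric.mem_ball]
    calc dist y x ≤ dist y z + dist z x := dist_triangle _ _ _
      _ < R := by rw [dist_comm y z]; linarith
  have hyD : y ∈ closure D := by
    have h1 : y ∈ closure (Metric.ball z r) := by
      rw [closure_ball z hrpos.ne', Metric.mem_closedBall, dist_comm]
    exact closure_mono (fun a ha => (hball ha).1.1) h1
  have hyMD : f y = M ∧ fderiv ℝ f y = 0 := by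
    by_cases hyin : y ∈ D
    · have hyM : f y = M := by
        refine le_antisymm (hle y ⟨hyR, hyin⟩) ?_
        by_contra! hlt
        exact hyO ⟨⟨hyin, hyR⟩, hlt⟩
      refine ⟨hyM, IsLocalMax.fderiv_eq_zero ?_⟩
      filter_upwards [(hDo.inter Metric.isOpen_ball).mem_nhds ⟨hyin, hyR⟩] with a ha
      rw [hyM]; exact hle a ⟨ha.2, ha.1⟩
    · exact hbd y ⟨hyR, hyD⟩ hyin
  set c := (1 / 2 : ℝ) • (z + y) with hc
  have hyz : ‖y - z‖ = r := by rw [hr, dist_comm, dist_eq_norm]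
  have hyc : ‖y - c‖ = r / 2 := by
    have : y - c = (1 / 2 : ℝ) • (y - z) := by rw [hc]; module
    rw [this, norm_smul, hyz]; norm_num; ring
  have hcz : ‖c - z‖ = r / 2 := by
    have : c - z = (1 / 2 : ℝ) • (y - z) := by rw [hc]; module
    rw [this, norm_smul, hyz]; norm_num; ring
  have hin : ∀ a ∈ Metric.closedBall c (r / 2), a ≠ y → a ∈ O := by
    intro a ha hay
    apply hball
    rw [Metric.mem_closedBall, dist_eq_norm] at ha
    rw [Metric.mem_ball, dist_eq_norm]
    by_contra! hge
    have hpar := parallelogram_law_with_norm ℝ (a - c) (c - z)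
    rw [sub_add_sub_cancel, hcz] at hpar
    have h0 : ‖a - c - (c - z)‖ = 0 := by
      have : ‖a - c - (c - z)‖ * ‖a - c - (c - z)‖ ≤ 0 := by
        nlinarith [norm_nonneg (a - c), norm_nonneg (a - z)]
      nlinarith [norm_nonneg (a - c - (c - z))]
    rw [norm_eq_zero, sub_eq_zero] at h0
    apply hay
    have : c - z = y - c := by rw [hc]; module
    rw [this] at h0
    exact sub_left_injective h0
  refine hopf_boundary_point (c := c) (M := M) (half_pos hrpos) hyc (fun a ha => ?_)
    (fun a ha => ?_) (fun a ha hay => (hin a ha hay).2) hyMD.1 hyMD.2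
  · rcases eq_or_ne a y with rfl | hne
    · exact hf a ⟨hyR, hyD⟩
    · have := hin a ha hne
      exact hf a ⟨this.1.2, subset_closure this.1.1⟩
  · have hne : a ≠ y := by
      rintro rfl
      rw [Metric.mem_ball, dist_eq_norm] at ha; linarith
    have := hin a (Metric.ball_subset_closedBall ha) hne
    exact hQ a ⟨this.1.2, this.1.1⟩

end MaximumPrinciple

/-! ### Perimeter and first variation -/

section FirstVariation

open MeasureTheory

variable {n : ℕ} {ρ φ ζ : Euc n → ℝ} {X Y Z : Euc n → Euc n} {x y : Euc n}

lemma differentiableAt_comp_apply (h : DifferentiableAt ℝ X x) (i : Fin n) :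
    DifferentiableAt ℝ (fun y => X y i) x :=
  (differentiableAt_euclidean.1 h) i

lemma euclDiv_add (hX : DifferentiableAt ℝ X x) (hY : DifferentiableAt ℝ Y x) :
    euclDiv (fun y => X y + Y y) x = euclDiv X x + euclDiv Y x := by
  simp only [euclDiv, PiLp.add_apply, ← Finset.sum_add_distrib]
  exact Finset.sum_congr rfl fun i _ =>
    pderiv_add (differentiableAt_comp_apply hX i) (differentiableAt_comp_apply hY i) i

lemma euclDiv_sub (hX : DifferentiableAt ℝ X x) (hY : DifferentiableAt ℝ Y x) :
    euclDiv (fun y => X y - Y y) x = euclDiv X x - euclDiv Y x := by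
  simp only [euclDiv, PiLp.sub_apply, ← Finset.sum_sub_distrib]
  exact Finset.sum_congr rfl fun i _ =>
    pderiv_sub (differentiableAt_comp_apply hX i) (differentiableAt_comp_apply hY i) i

lemma euclDiv_congr (h : X =ᶠ[𝓝 x] Y) : euclDiv X x = euclDiv Y x :=
  Finset.sum_congr rfl fun i _ => pderiv_congr (h.mono fun y hy => by rw [hy]) i

lemma euclDiv_zero : euclDiv (fun _ : Euc n => (0 : Euc n)) x = 0 := by
  simp [euclDiv, pderiv_const]

lemma contDiff_comp_apply (h : ContDiff ℝ 1 X) (i : Fin n) : ContDiff ℝ 1 (fun y => X y i) :=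
  contDiff_euclidean.1 h i

lemma continuous_euclDiv (h : ContDiff ℝ 1 X) : Continuous (euclDiv X) :=
  continuous_finsetSum _ fun i _ => continuous_iff_continuousAt.2 fun _ =>
    continuousAt_pderiv (contDiff_comp_apply h i).contDiffAt i

lemma euclDiv_eq_zero_of_notMem_tsupport (h : x ∉ tsupport X) : euclDiv X x = 0 := by
  rw [euclDiv_congr (notMem_tsupport_iff_eventuallyEq.1 h)]
  exact euclDiv_zero

lemma hasCompactSupport_euclDiv (h : HasCompactSupport X) : HasCompactSupport (euclDiv X) :=
  HasCompactSupport.intro h fun _ hx => euclDiv_eq_zero_of_notMem_tsupport hx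

lemma integrable_euclDiv (h : ContDiff ℝ 1 X) (hc : HasCompactSupport X) :
    Integrable (euclDiv X) :=
  (continuous_euclDiv h).integrable_of_hasCompactSupport (hasCompactSupport_euclDiv hc)

lemma hasCompactSupport_comp_apply (hc : HasCompactSupport X) (i : Fin n) :
    HasCompactSupport (fun y => X y i) :=
  HasCompactSupport.intro hc fun y hy => by rw [image_eq_zero_of_notMem_tsupport hy]; rfl

/-- Integration by parts for a compactly supported vector field. -/
lemma integral_mul_euclDiv (hφ : ContDiff ℝ 1 φ) (hX : ContDiff ℝ 1 X) (hc : HasCompactSupport X) :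
    ∫ y, φ y * euclDiv X y = -∫ y, fderiv ℝ φ y (X y) := by
  have hXi := contDiff_comp_apply hX
  have hci := hasCompactSupport_comp_apply hc
  have hp : ∀ i, Continuous (pderiv i fun y => X y i) := fun i =>
    continuous_iff_continuousAt.2 fun _ => continuousAt_pderiv (hXi i).contDiffAt i
  have hpφ : ∀ i, Continuous (pderiv i φ) := fun i =>
    continuous_iff_continuousAt.2 fun _ => continuousAt_pderiv hφ.contDiffAt i
  have h1 : ∀ i, Integrable fun y => pderiv i φ y * X y i := fun i =>
    ((hpφ i).mul (hXi i).continuous).integrable_of_hasCompactSupport (hci i).mul_left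
  have h2 : ∀ i, Integrable fun y => φ y * pderiv i (fun z => X z i) y := fun i =>
    (hφ.continuous.mul (hp i)).integrable_of_hasCompactSupport
      (HasCompactSupport.mul_left (HasCompactSupport.intro (hci i) fun y hy => by
        rw [pderiv_congr (notMem_tsupport_iff_eventuallyEq.1 hy)]
        exact pderiv_const i 0))
  have h3 : ∀ i, ∫ y, φ y * pderiv i (fun z => X z i) y = -∫ y, pderiv i φ y * X y i := fun i =>
    integral_mul_fderiv_eq_neg_fderiv_mul_of_integrable (h1 i) (h2 i)
      ((hφ.continuous.mul (hXi i).continuous).integrable_of_hasCompactSupport (hci i).mul_left)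
      (fun y _ => hφ.differentiable (by simp) y) (fun y _ => (hXi i).differentiable (by simp) y)
  have e1 : ∀ y, φ y * euclDiv X y = ∑ i, φ y * pderiv i (fun z => X z i) y := fun y => by
    rw [euclDiv, Finset.mul_sum]
  have e2 : ∀ y, fderiv ℝ φ y (X y) = ∑ i, pderiv i φ y * X y i := fun y => by
    rw [fderiv_apply_eq_sum]; exact Finset.sum_congr rfl fun i _ => mul_comm _ _
  simp only [e1, e2]
  rw [integral_finsetSum _ fun i _ => h2 i, integral_finsetSum _ fun i _ => h1 i,
    ← Finset.sum_neg_distrib]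
  exact Finset.sum_congr rfl fun i _ => h3 i

/-- The flux of a vector field out of a sublevel set of `ρ` is non-negative if the field points in
the direction in which `ρ` increases. The indicator function of the sublevel set is approximated
by smooth functions of `ρ`. -/
lemma setIntegral_euclDiv_nonneg (hρ : ContDiff ℝ 1 ρ) (hZ : ContDiff ℝ 1 Z)
    (hc : HasCompactSupport Z) (h : ∀ y, 0 ≤ fderiv ℝ ρ y (Z y)) :
    0 ≤ ∫ y in {y | ρ y ≤ 0}, euclDiv Z y := by
  set χ : ℕ → Euc n → ℝ := fun k y => Real.smoothTransition (1 - k * ρ y) with hχ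
  have hst : ContDiff ℝ 1 Real.smoothTransition := Real.smoothTransition.contDiff (n := 1)
  have hχc : ∀ k, ContDiff ℝ 1 (χ k) := fun k =>
    hst.comp (contDiff_const.sub (contDiff_const.mul hρ))
  have hderiv : ∀ k y, fderiv ℝ (χ k) y (Z y)
      = -(deriv Real.smoothTransition (1 - k * ρ y) * k * fderiv ℝ ρ y (Z y)) := by
    intro k y
    have h1 : HasDerivAt (fun t : ℝ => Real.smoothTransition (1 - k * t))
        (deriv Real.smoothTransition (1 - k * ρ y) * -(k * 1)) (ρ y) := by
      have h2 : HasDerivAt (fun t : ℝ => 1 - k * t) (-(k * 1)) (ρ y) :=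
        ((hasDerivAt_id (ρ y)).const_mul (k : ℝ)).const_sub 1
      exact ((hst.differentiable (by simp) _).hasDerivAt).comp (ρ y) h2
    have h3 := h1.comp_hasFDerivAt y (hρ.differentiable (by simp) y).hasFDerivAt
    have h4 : fderiv ℝ (χ k) y = _ := h3.fderiv
    rw [h4]
    simp
  have hnn : ∀ k, 0 ≤ ∫ y, χ k y * euclDiv Z y := by
    intro k
    rw [integral_mul_euclDiv (hχc k) hZ hc, ← integral_neg]
    refine integral_nonneg fun y => ?_
    simp only [hderiv, neg_neg]
    exact mul_nonneg (mul_nonneg (Real.smoothTransition.monotone.deriv_nonneg) (Nat.cast_nonneg _))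
      (h y)
  have hmeas : MeasurableSet {y | ρ y ≤ 0} := (isClosed_le hρ.continuous continuous_const).measurableSet
  rw [← integral_indicator hmeas]
  have hint := integrable_euclDiv hZ hc
  have hlim : Filter.Tendsto (fun k => ∫ y, χ k y * euclDiv Z y) Filter.atTop
      (𝓝 (∫ y, Set.indicator {y | ρ y ≤ 0} (euclDiv Z) y)) := by
    refine tendsto_integral_of_dominated_convergence (fun y => ‖euclDiv Z y‖)
      (fun k => ((hχc k).continuous.mul (continuous_euclDiv hZ)).aestronglyMeasurable)
      hint.norm (fun k => Filter.Eventually.of_forall fun y => ?_)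
      (Filter.Eventually.of_forall fun y => ?_)
    · rw [norm_mul, Real.norm_of_nonneg (Real.smoothTransition.nonneg _)]
      exact mul_le_of_le_one_left (norm_nonneg _) (Real.smoothTransition.le_one _)
    · by_cases hy : ρ y ≤ 0
      · rw [Set.indicator_of_mem (by exact hy)]
        refine tendsto_const_nhds.congr fun k => ?_
        have : 1 ≤ 1 - k * ρ y := by
          have : (k : ℝ) * ρ y ≤ 0 := mul_nonpos_of_nonneg_of_nonpos (Nat.cast_nonneg _) hy
          linarith
        simp [hχ, Real.smoothTransition.one_of_one_le this]
      · rw [Set.indicator_of_notMem (by exact hy)]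
        push Not at hy
        obtain ⟨N, hN⟩ := exists_nat_ge (ρ y)⁻¹
        refine tendsto_const_nhds.congr' ?_
        filter_upwards [Filter.eventually_ge_atTop N] with k hk
        have : 1 - k * ρ y ≤ 0 := by
          have h1 : (ρ y)⁻¹ ≤ k := hN.trans (by exact_mod_cast hk)
          have h2 := mul_le_mul_of_nonneg_right h1 hy.le
          rw [inv_mul_cancel₀ hy.ne'] at h2
          linarith
        simp [hχ, Real.smoothTransition.zero_of_nonpos this]
  exact ge_of_tendsto' hlim hnn

/-- The Euclidean unit normal field `Dρ / |Dρ|`. -/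
noncomputable def unitField (ρ : Euc n → ℝ) (y : Euc n) : Euc n :=
  WithLp.toLp 2 fun i => pderiv i ρ y / Real.sqrt (gradSq ρ y)

lemma euclDiv_unitField (ρ : Euc n → ℝ) (y : Euc n) :
    euclDiv (unitField ρ) y = levelMeanCurvature (flatMetric n) ρ y := by
  rw [levelMeanCurvature, metricDiv_flat, euclDiv]
  simp only [unitNormal_flat]
  rfl

lemma contDiffAt_unitField (hρ : ContDiffAt ℝ 2 ρ y) (h0 : fderiv ℝ ρ y ≠ 0) :
    ContDiffAt ℝ 1 (unitField ρ) y := by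
  have hP := gradSq_pos_iff.2 h0
  refine contDiffAt_euclidean.2 fun i => ?_
  exact (contDiffAt_pderiv hρ (by norm_num) i).div
    ((contDiffAt_gradSq hρ (by norm_num)).sqrt hP.ne') (Real.sqrt_pos.2 hP).ne'

lemma norm_unitField_le (ρ : Euc n → ℝ) (y : Euc n) : ‖unitField ρ y‖ ≤ 1 := by
  have h : ‖unitField ρ y‖ ^ 2 ≤ 1 := by
    rw [EuclideanSpace.norm_sq_eq]
    simp only [unitField, Real.norm_eq_abs, sq_abs, div_pow, Real.sq_sqrt (gradSq_nonneg ρ y)]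
    rw [← Finset.sum_div]
    exact div_self_le_one _
  nlinarith [norm_nonneg (unitField ρ y)]

lemma fderiv_apply_le (ρ : Euc n → ℝ) (y v : Euc n) :
    fderiv ℝ ρ y v ≤ Real.sqrt (gradSq ρ y) * ‖v‖ := by
  rw [fderiv_apply_eq_sum, EuclideanSpace.norm_eq]
  have h := Finset.sum_mul_sq_le_sq_mul_sq Finset.univ (fun i => pderiv i ρ y) (fun i => v i)
  rw [← Real.sqrt_mul (gradSq_nonneg ρ y)]
  refine Real.le_sqrt_of_sq_le ?_
  simp only [Real.norm_eq_abs, sq_abs]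
  calc (∑ i, v i * pderiv i ρ y) ^ 2 = (∑ i, pderiv i ρ y * v i) ^ 2 := by
        simp only [mul_comm]
    _ ≤ _ := h

lemma fderiv_unitField (h0 : fderiv ℝ ρ y ≠ 0) :
    fderiv ℝ ρ y (unitField ρ y) = Real.sqrt (gradSq ρ y) := by
  have hP := gradSq_pos_iff.2 h0
  rw [fderiv_apply_eq_sum]
  have : ∀ i, unitField ρ y i * pderiv i ρ y = pderiv i ρ y ^ 2 / Real.sqrt (gradSq ρ y) :=
    fun i => by simp only [unitField]; ring
  simp only [this]
  rw [← Finset.sum_div]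
  exact Real.div_sqrt

lemma contDiff_smul_of_tsupport (hζ : ContDiff ℝ 1 ζ) (hX : ∀ y ∈ tsupport ζ, ContDiffAt ℝ 1 X y) :
    ContDiff ℝ 1 (fun y => ζ y • X y) := by
  refine contDiff_iff_contDiffAt.2 fun y => ?_
  by_cases hy : y ∈ tsupport ζ
  · exact hζ.contDiffAt.smul (hX y hy)
  · have : (fun y => ζ y • X y) =ᶠ[𝓝 y] fun _ => 0 := by
      filter_upwards [notMem_tsupport_iff_eventuallyEq.1 hy] with z hz
      simp [hz]
    exact contDiffAt_const.congr_of_eventuallyEq this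

lemma hasCompactSupport_smul_left (hζ : HasCompactSupport ζ) :
    HasCompactSupport (fun y => ζ y • X y) :=
  HasCompactSupport.intro hζ fun y hy => by simp [image_eq_zero_of_notMem_tsupport hy]

lemma setIntegral_euclDiv_congr {A B : Set (Euc n)} (hA : MeasurableSet A) (hB : MeasurableSet B)
    (h : ∀ y ∈ tsupport X, (y ∈ A ↔ y ∈ B)) :
    ∫ y in A, euclDiv X y = ∫ y in B, euclDiv X y := by
  rw [← integral_indicator hA, ← integral_indicator hB]
  congr 1
  ext y
  by_cases hy : y ∈ tsupport X
  · by_cases hyA : y ∈ A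
    · rw [Set.indicator_of_mem hyA, Set.indicator_of_mem ((h y hy).1 hyA)]
    · rw [Set.indicator_of_notMem hyA, Set.indicator_of_notMem fun hB => hyA ((h y hy).2 hB)]
  · simp [Set.indicator, euclDiv_eq_zero_of_notMem_tsupport hy]

lemma ofReal_setIntegral_le_perimeter (A : Set (Euc n)) (hX : ContDiff ℝ 1 X)
    (hc : HasCompactSupport X) (h1 : ∀ y, ‖X y‖ ≤ 1) :
    ENNReal.ofReal (∫ y in A, euclDiv X y) ≤ perimeter A :=
  le_iSup₂_of_le (f := fun X (_ : X ∈ {X : Euc n → Euc n | ContDiff ℝ 1 X ∧ HasCompactSupport X ∧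
    ∀ x, ‖X x‖ ≤ 1}) => ENNReal.ofReal (∫ x in A, euclDiv X x)) X ⟨hX, hc, h1⟩ le_rfl

lemma perimeter_le {A : Set (Euc n)} {C : ℝ≥0∞} (h : ∀ X : Euc n → Euc n, ContDiff ℝ 1 X →
    HasCompactSupport X → (∀ y, ‖X y‖ ≤ 1) → ENNReal.ofReal (∫ y in A, euclDiv X y) ≤ C) :
    perimeter A ≤ C :=
  iSup₂_le fun X hX => h X hX.1 hX.2.1 hX.2.2

lemma fderiv_norm_sq_sub (R : ℝ) (y v : Euc n) :
    fderiv ℝ (fun z : Euc n => ‖z‖ ^ 2 - R) y v = 2 * inner ℝ y v := by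
  rw [fderiv_sub_const, (hasStrictFDerivAt_norm_sq y).hasFDerivAt.fderiv]
  simp

/-- Balls have finite perimeter. -/
lemma perimeter_ball_lt_top {R : ℝ} (hR : 2 ≤ R) :
    perimeter {y : Euc n | ‖y‖ ^ 2 - R ^ 2 ≤ 0} < ⊤ := by
  set A := {y : Euc n | ‖y‖ ^ 2 - R ^ 2 ≤ 0} with hA
  have hρ : ContDiff ℝ 1 (fun y : Euc n => ‖y‖ ^ 2 - R ^ 2) := (contDiff_norm_sq ℝ).sub contDiff_const
  have hAm : MeasurableSet A := (isClosed_le hρ.continuous continuous_const).measurableSet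
  let θ : ContDiffBump (0 : Euc n) := ⟨1, 2, by norm_num, by norm_num⟩
  let ψ : ContDiffBump (0 : Euc n) := ⟨R + 1, R + 2, by linarith, by linarith⟩
  have hθ : ContDiff ℝ 1 θ := θ.contDiff
  have hψ : ContDiff ℝ 1 ψ := ψ.contDiff
  have hT : ContDiff ℝ 1 (fun y => (1 - θ y) * ψ y) := (contDiff_const.sub hθ).mul hψ
  have hTc : HasCompactSupport (fun y => (1 - θ y) * ψ y) := ψ.hasCompactSupport.mul_left
  set C := ∫ y in A, euclDiv (fun y => ((1 - θ y) * ψ y) • y) y with hC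
  refine (perimeter_le (C := ENNReal.ofReal C) fun X hX hc h1 => ENNReal.ofReal_le_ofReal ?_).trans_lt
    ENNReal.ofReal_lt_top
  -- the part of `X` near the centre does not contribute
  have hθX : ContDiff ℝ 1 (fun y => θ y • X y) := hθ.smul hX
  have hθXc : HasCompactSupport (fun y => θ y • X y) := hasCompactSupport_smul_left θ.hasCompactSupport
  have hTX : ContDiff ℝ 1 (fun y => ((1 - θ y) * ψ y) • X y) := hT.smul hX
  have hTXc : HasCompactSupport (fun y => ((1 - θ y) * ψ y) • X y) := hasCompactSupport_smul_left hTc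
  have hTY : ContDiff ℝ 1 (fun y => ((1 - θ y) * ψ y) • y) := hT.smul contDiff_id
  have hTYc : HasCompactSupport (fun y => ((1 - θ y) * ψ y) • y) := hasCompactSupport_smul_left hTc
  have hd : ∀ {X : Euc n → Euc n}, ContDiff ℝ 1 X → ∀ y, DifferentiableAt ℝ X y := fun h y =>
    h.differentiable (by simp) y
  have e0 : ∫ y in A, euclDiv (fun y => θ y • X y) y = 0 := by
    rw [setIntegral_euclDiv_congr (B := Set.univ) hAm MeasurableSet.univ]
    · have := integral_mul_euclDiv (φ := fun _ => (1 : ℝ)) contDiff_const hθX hθXc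
      simpa using this
    · intro y hy
      have h2 : y ∈ tsupport θ := tsupport_smul_subset_left _ _ hy
      rw [θ.tsupport_eq, mem_closedBall_zero_iff] at h2
      have h3 : ‖y‖ ≤ 2 := h2
      refine ⟨fun _ => Set.mem_univ _, fun _ => ?_⟩
      change ‖y‖ ^ 2 - R ^ 2 ≤ 0
      nlinarith [norm_nonneg y]
  have e1 : ∫ y in A, euclDiv X y = (∫ y in A, euclDiv (fun y => θ y • X y) y)
      + ∫ y in A, euclDiv (fun y => ((1 - θ y) * ψ y) • X y) y := by
    rw [← integral_add (integrable_euclDiv hθX hθXc).integrableOn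
      (integrable_euclDiv hTX hTXc).integrableOn]
    refine setIntegral_congr_fun hAm fun y hy => ?_
    change euclDiv X y = euclDiv _ y + euclDiv _ y
    rw [← euclDiv_add (hd hθX y) (hd hTX y)]
    refine euclDiv_congr ?_
    have hyR : y ∈ Metric.ball (0 : Euc n) ψ.rIn := by
      rw [mem_ball_zero_iff]
      have : ‖y‖ ^ 2 - R ^ 2 ≤ 0 := hy
      change ‖y‖ < R + 1
      nlinarith [norm_nonneg y]
    filter_upwards [ψ.eventuallyEq_one_of_mem_ball hyR] with z hz
    rw [hz, ← add_smul]
    simp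
  have e2 : 0 ≤ ∫ y in A, euclDiv (fun y => ((1 - θ y) * ψ y) • y - ((1 - θ y) * ψ y) • X y) y := by
    refine setIntegral_euclDiv_nonneg hρ (hTY.sub hTX) (hTYc.sub hTXc) fun y => ?_
    rw [fderiv_norm_sq_sub, ← smul_sub, inner_smul_right, inner_sub_right]
    by_cases hy : ‖y‖ ≤ 1
    · have : θ y = 1 := θ.one_of_mem_closedBall (by rw [mem_closedBall_zero_iff]; exact hy)
      simp [this]
    · have h2 : inner ℝ y (X y) ≤ ‖y‖ * ‖X y‖ := real_inner_le_norm _ _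
      have h3 : ‖y‖ * ‖X y‖ ≤ ‖y‖ * 1 := mul_le_mul_of_nonneg_left (h1 y) (norm_nonneg _)
      have h4 : 0 ≤ (1 - θ y) * ψ y := mul_nonneg (by linarith [θ.le_one (x := y)]) ψ.nonneg
      have h5 : 0 ≤ inner ℝ y y - inner ℝ y (X y) := by
        rw [real_inner_self_eq_norm_sq]; nlinarith
      positivity
  have e3 : ∫ y in A, euclDiv (fun y => ((1 - θ y) * ψ y) • y - ((1 - θ y) * ψ y) • X y) y
      = C - ∫ y in A, euclDiv (fun y => ((1 - θ y) * ψ y) • X y) y := by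
    rw [hC, ← integral_sub (integrable_euclDiv hTY hTYc).integrableOn
      (integrable_euclDiv hTX hTXc).integrableOn]
    exact setIntegral_congr_fun hAm fun y _ => euclDiv_sub (hd hTY y) (hd hTX y)
  rw [e1, e0]
  linarith

lemma IsOuterMinimizing.perimeter_ne_top {A : Set (Euc n)} (h : IsOuterMinimizing A)
    (hA : Bornology.IsBounded A) : perimeter A ≠ ⊤ := by
  obtain ⟨R, hR⟩ := hA.subset_closedBall 0
  set R' := max R 2
  have hρ : Continuous (fun y : Euc n => ‖y‖ ^ 2 - R' ^ 2) := by fun_prop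
  have hsub : {y : Euc n | ‖y‖ ^ 2 - R' ^ 2 ≤ 0} ⊆ Metric.closedBall 0 R' := fun y hy => by
    have hy' : ‖y‖ ^ 2 - R' ^ 2 ≤ 0 := hy
    rw [mem_closedBall_zero_iff]
    have : 2 ≤ R' := le_max_right _ _
    nlinarith [norm_nonneg y]
  refine ((h {y | ‖y‖ ^ 2 - R' ^ 2 ≤ 0} (fun y hy => ?_)
    (isClosed_le hρ continuous_const).measurableSet
    (Metric.isBounded_closedBall.subset hsub)).trans_lt
      (perimeter_ball_lt_top (le_max_right _ _))).ne
  have h1 : ‖y‖ ≤ R := by simpa using hR hy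
  have h2 : R ≤ R' := le_max_left _ _
  change ‖y‖ ^ 2 - R' ^ 2 ≤ 0
  nlinarith [norm_nonneg y]

lemma continuous_pderiv (hρ : ContDiff ℝ ∞ ρ) (i : Fin n) : Continuous (pderiv i ρ) :=
  (contDiff_pderiv hρ i).continuous

lemma pderiv_perturbation {η : Euc n → ℝ} (hρ : Differentiable ℝ ρ) (hη : Differentiable ℝ η)
    (t : ℝ) (i : Fin n) :
    pderiv i (fun z => ρ z - t * η z) = fun y => pderiv i ρ y - t * pderiv i η y := by
  ext y
  rw [pderiv_sub (hρ y) ((hη y).const_mul t), pderiv_const_mul (hη y)]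

lemma levelMeanCurvature_flat_neg_iff (hφ : ContDiffAt ℝ 2 φ y) (h0 : fderiv ℝ φ y ≠ 0) :
    levelMeanCurvature (flatMetric n) φ y < 0 ↔ gradSq φ y * lapl φ y - hessGrad φ y < 0 := by
  have hP := gradSq_pos_iff.2 h0
  rw [levelMeanCurvature_flat hφ h0, div_lt_iff₀ (Real.sqrt_pos.2 hP), zero_mul,
    sub_neg, sub_neg, lt_div_iff₀ hP, mul_comm]

lemma eventually_levelMeanCurvature_neg {G : ℝ → Euc n → ℝ}
    (hsm : ∀ t y, ContDiffAt ℝ 2 (G t) y)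
    (c1 : ∀ i, Continuous fun p : ℝ × Euc n => pderiv i (G p.1) p.2)
    (c2 : ∀ i j, Continuous fun p : ℝ × Euc n => pderiv i (pderiv j (G p.1)) p.2)
    {K : Set (Euc n)} (hK : IsCompact K) (h0 : ∀ y ∈ K, fderiv ℝ (G 0) y ≠ 0)
    (hH : ∀ y ∈ K, levelMeanCurvature (flatMetric n) (G 0) y < 0) :
    ∀ᶠ t : ℝ in 𝓝 0, ∀ y ∈ K, fderiv ℝ (G t) y ≠ 0 ∧
      levelMeanCurvature (flatMetric n) (G t) y < 0 := by
  have cP : Continuous fun p : ℝ × Euc n => gradSq (G p.1) p.2 := by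
    unfold gradSq
    exact continuous_finsetSum _ fun i _ => (c1 i).pow 2
  have cL : Continuous fun p : ℝ × Euc n => lapl (G p.1) p.2 := by
    unfold lapl
    exact continuous_finsetSum _ fun i _ => c2 i i
  have cH : Continuous fun p : ℝ × Euc n => hessGrad (G p.1) p.2 := by
    unfold hessGrad
    exact continuous_finsetSum _ fun i _ => continuous_finsetSum _ fun j _ =>
      ((c1 i).mul (c1 j)).mul (c2 i j)
  have cQ := (cP.mul cL).sub cH
  refine hK.eventually_forall_of_forall_eventually (P := fun t y =>
    fderiv ℝ (G t) y ≠ 0 ∧ levelMeanCurvature (flatMetric n) (G t) y < 0) fun y hy => ?_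
  have e0 : 0 < gradSq (G 0) y := gradSq_pos_iff.2 (h0 y hy)
  have e1 := (levelMeanCurvature_flat_neg_iff (hsm 0 y) (h0 y hy)).1 (hH y hy)
  filter_upwards [(isOpen_lt continuous_const cP).mem_nhds (show (0, y) ∈ _ from e0),
    (isOpen_lt cQ continuous_const).mem_nhds (show (0, y) ∈ _ from e1)] with p h1 h2
  have h3 := gradSq_pos_iff.1 h1
  exact ⟨h3, (levelMeanCurvature_flat_neg_iff (hsm _ _) h3).2 h2⟩

/-- The derivative conditions on `ρ - t η` used in the first variation hold for small `t`. -/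
lemma eventually_perturbation {η : Euc n → ℝ} (hρ : ContDiff ℝ ∞ ρ) (hη : ContDiff ℝ ∞ η)
    {K : Set (Euc n)} (hK : IsCompact K) (h0 : ∀ y ∈ K, fderiv ℝ ρ y ≠ 0)
    (hH : ∀ y ∈ K, levelMeanCurvature (flatMetric n) ρ y < 0) :
    ∀ᶠ t : ℝ in 𝓝 0, ∀ y ∈ K, fderiv ℝ (fun z => ρ z - t * η z) y ≠ 0 ∧
      levelMeanCurvature (flatMetric n) (fun z => ρ z - t * η z) y < 0 := by
  have hp : ∀ (t : ℝ) i, pderiv i (fun z => ρ z - t * η z)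
      = fun y => pderiv i ρ y - t * pderiv i η y := fun t i =>
    pderiv_perturbation (hρ.differentiable (by simp)) (hη.differentiable (by simp)) t i
  have hpp : ∀ (t : ℝ) i j, pderiv i (pderiv j (fun z => ρ z - t * η z))
      = fun y => pderiv i (pderiv j ρ) y - t * pderiv i (pderiv j η) y := fun t i j => by
    rw [hp]
    exact pderiv_perturbation ((contDiff_pderiv hρ j).differentiable (by simp))
      ((contDiff_pderiv hη j).differentiable (by simp)) t i
  have h00 : (fun z => ρ z - (0 : ℝ) * η z) = ρ := by ext; simp
  refine eventually_levelMeanCurvature_neg (G := fun t z => ρ z - t * η z)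
    (fun t y => (contDiff_infty.1 (hρ.sub (contDiff_const.mul hη)) 2).contDiffAt)
    (fun i => ?_) (fun i j => ?_) hK ?_ ?_
  · simp only [hp]
    exact ((continuous_pderiv hρ i).comp continuous_snd).sub
      (continuous_fst.mul ((continuous_pderiv hη i).comp continuous_snd))
  · simp only [hpp]
    exact ((continuous_pderiv (contDiff_pderiv hρ j) i).comp continuous_snd).sub
      (continuous_fst.mul ((continuous_pderiv (contDiff_pderiv hη j) i).comp continuous_snd))
  · simpa only [h00] using h0
  · simpa only [h00] using hH

/-- The first variation of area: a set whose boundary has negative mean curvature at a point `x`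
is not outer-minimizing.

With `η ≥ 0` a bump function at `x`, the competitor `F` is `{ρ ≤ tη}` near `x`, and the unit normal
fields `N` of `ρ` and `Nₜ` of `ρ - tη` calibrate the two boundaries: replacing a field `X` by `N`
near `x` changes its flux through `∂E` by at least the flux through `∂F` of its replacement by `Nₜ`,
minus the integral of `div Nₜ < 0` over the region between the two boundaries. -/
lemma not_isOuterMinimizing {E : Set (Euc n)} (hE : MeasurableSet E) (hEb : Bornology.IsBounded E)
    (hρ : ContDiff ℝ ∞ ρ) (hx : ρ x = 0) (h0 : fderiv ℝ ρ x ≠ 0)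
    (hH : levelMeanCurvature (flatMetric n) ρ x < 0)
    (hloc : ∀ᶠ y in 𝓝 x, (y ∈ E ↔ ρ y ≤ 0)) : ¬ IsOuterMinimizing E := by
  intro hmin
  have hρ2 : ∀ y, ContDiffAt ℝ 2 ρ y := fun y => (contDiff_infty.1 hρ 2).contDiffAt
  have hρ1 : ContDiff ℝ 1 ρ := contDiff_infty.1 hρ 1
  obtain ⟨R, hR, hball⟩ : ∃ R > 0, ∀ y ∈ Metric.ball x R, (y ∈ E ↔ ρ y ≤ 0) ∧
      fderiv ℝ ρ y ≠ 0 ∧ levelMeanCurvature (flatMetric n) ρ y < 0 := by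
    have := hloc.and ((fderiv_ne_zero_eventually ((hρ2 x).of_le (by norm_num)) h0).and
      ((continuousAt_levelMeanCurvature_flat (hρ2 x) h0).eventually (eventually_lt_nhds hH)))
    exact Metric.eventually_nhds_iff_ball.1 this
  let η : ContDiffBump x := ⟨R / 4, R / 2, by linarith, by linarith⟩
  let ζ : ContDiffBump x := ⟨R / 2, 3 * R / 4, by linarith, by linarith⟩
  have hη : ContDiff ℝ ∞ η := η.contDiff
  have hζ : ContDiff ℝ 1 ζ := ζ.contDiff
  have hζc : HasCompactSupport ζ := ζ.hasCompactSupport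
  have hζsupp : tsupport ζ = Metric.closedBall x (3 * R / 4) := ζ.tsupport_eq
  have hsub : Metric.closedBall x (3 * R / 4) ⊆ Metric.ball x R :=
    Metric.closedBall_subset_ball (by linarith)
  have hpert := eventually_perturbation hρ hη (isCompact_closedBall x (3 * R / 4))
    (fun y hy => (hball y (hsub hy)).2.1) (fun y hy => (hball y (hsub hy)).2.2)
  obtain ⟨t, htpert, ht⟩ := ((hpert.filter_mono nhdsWithin_le_nhds).and
    (self_mem_nhdsWithin (s := Set.Ioi (0 : ℝ)))).exists
  replace ht : 0 < t := ht
  set ρt : Euc n → ℝ := fun z => ρ z - t * η z with hρt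
  have hρt' : ContDiff ℝ ∞ ρt := hρ.sub (contDiff_const.mul hη)
  have hρt2 : ∀ y, ContDiffAt ℝ 2 ρt y := fun y => (contDiff_infty.1 hρt' 2).contDiffAt
  have hρt1 : ContDiff ℝ 1 ρt := contDiff_infty.1 hρt' 1
  set S := {y | ρ y ≤ 0} with hS
  set St := {y | ρt y ≤ 0} with hSt
  have hSm : MeasurableSet S := (isClosed_le hρ.continuous continuous_const).measurableSet
  have hStm : MeasurableSet St := (isClosed_le hρt'.continuous continuous_const).measurableSet
  set F := E ∪ (Metric.ball x R ∩ St) with hF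
  have hFm : MeasurableSet F := hE.union (Metric.isOpen_ball.measurableSet.inter hStm)
  have hSSt : S ⊆ St := fun y hy => by
    have h1 : ρ y ≤ 0 := hy
    have h2 : 0 ≤ t * η y := mul_nonneg ht.le η.nonneg
    change ρ y - t * η y ≤ 0
    linarith
  have hES : ∀ y ∈ Metric.ball x R, (y ∈ E ↔ y ∈ S) := fun y hy => (hball y hy).1
  have hFS : ∀ y ∈ Metric.ball x R, (y ∈ F ↔ y ∈ St) := fun y hy => by
    constructor
    · rintro (h | h)
      · exact hSSt ((hES y hy).1 h)
      · exact h.2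
    · exact fun h => Or.inr ⟨hy, h⟩
  have hEF : E ⊆ F := Set.subset_union_left
  -- the two boundaries agree outside the ball in which `ζ = 1`
  have hdiff : ∀ y ∈ F \ E, y ∈ Metric.ball x (R / 2) := by
    rintro y ⟨hyF, hyE⟩
    rcases hyF with h | ⟨hyR, hySt⟩
    · exact absurd h hyE
    by_contra hout
    have hz : η y = 0 := η.zero_of_le_dist (by simpa using hout)
    refine hyE ((hES y hyR).2 ?_)
    have : ρ y - t * η y ≤ 0 := hySt
    change ρ y ≤ 0
    rw [hz] at this; linarith
  -- the calibrating fields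
  set N : Euc n → Euc n := fun y => ζ y • unitField ρ y with hN
  set Nt : Euc n → Euc n := fun y => ζ y • unitField ρt y with hNt
  have hNc : ContDiff ℝ 1 N := contDiff_smul_of_tsupport hζ fun y hy =>
    contDiffAt_unitField (hρ2 y) (hball y (hsub (hζsupp ▸ hy))).2.1
  have hNtc : ContDiff ℝ 1 Nt := contDiff_smul_of_tsupport hζ fun y hy =>
    contDiffAt_unitField (hρt2 y) (htpert y (hζsupp ▸ hy)).1
  have hNs : HasCompactSupport N := hasCompactSupport_smul_left hζc
  have hNts : HasCompactSupport Nt := hasCompactSupport_smul_left hζc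
  have hd : ∀ {X : Euc n → Euc n}, ContDiff ℝ 1 X → ∀ y, DifferentiableAt ℝ X y := fun h y =>
    h.differentiable (by simp) y
  have hint : ∀ {X : Euc n → Euc n} (A : Set (Euc n)), ContDiff ℝ 1 X → HasCompactSupport X →
      IntegrableOn (euclDiv X) A := fun A h1 h2 => (integrable_euclDiv h1 h2).integrableOn
  have hsupp : ∀ {X : Euc n → Euc n} y, y ∈ tsupport (fun y => ζ y • X y) →
      y ∈ Metric.ball x R := fun {X} y hy => by
    have h2 : y ∈ tsupport ζ := tsupport_smul_subset_left _ _ hy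
    rw [hζsupp] at h2
    exact hsub h2
  -- comparison of the flux of a field with that of a calibrating field
  have hcal : ∀ {φ : Euc n → ℝ} {X Y : Euc n → Euc n} (A : Set (Euc n)), MeasurableSet A →
      ContDiff ℝ 1 φ → (∀ y ∈ Metric.ball x R, (y ∈ A ↔ φ y ≤ 0)) →
      ContDiff ℝ 1 (fun y => ζ y • X y) → ContDiff ℝ 1 (fun y => ζ y • Y y) →
      (∀ y ∈ Metric.closedBall x (3 * R / 4), fderiv ℝ φ y (X y) ≤ fderiv ℝ φ y (Y y)) →
      ∫ y in A, euclDiv (fun y => ζ y • X y) y ≤ ∫ y in A, euclDiv (fun y => ζ y • Y y) y := by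
    intro φ X Y A hA hφ hAφ hX hY hle
    have hXs : HasCompactSupport (fun y => ζ y • X y) := hasCompactSupport_smul_left hζc
    have hYs : HasCompactSupport (fun y => ζ y • Y y) := hasCompactSupport_smul_left hζc
    have hφm : MeasurableSet {y | φ y ≤ 0} :=
      (isClosed_le hφ.continuous continuous_const).measurableSet
    rw [setIntegral_euclDiv_congr hA hφm fun y hy => hAφ y (hsupp y hy),
      setIntegral_euclDiv_congr hA hφm fun y hy => hAφ y (hsupp y hy), ← sub_nonneg,
      ← integral_sub (hint _ hY hYs) (hint _ hX hXs)]
    have := setIntegral_euclDiv_nonneg hφ (hY.sub hX) (hYs.sub hXs) fun y => by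
      rw [← smul_sub, map_smul, smul_eq_mul, map_sub]
      by_cases hy : y ∈ Metric.closedBall x (3 * R / 4)
      · exact mul_nonneg ζ.nonneg (sub_nonneg.2 (hle y hy))
      · rw [← hζsupp] at hy
        rw [image_eq_zero_of_notMem_tsupport hy, zero_mul]
    refine this.trans_eq ?_
    exact setIntegral_congr_fun hφm fun y _ => euclDiv_sub (hd hY y) (hd hX y)
  have hNtN : ∫ y in E, euclDiv Nt y ≤ ∫ y in E, euclDiv N y := by
    refine hcal E hE hρ1 hES hNtc hNc fun y hy => ?_
    rw [fderiv_unitField (hball y (hsub hy)).2.1]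
    exact (fderiv_apply_le _ _ _).trans
      (mul_le_of_le_one_right (Real.sqrt_nonneg _) (norm_unitField_le _ _))
  -- the gain
  have hNtdiv : ∀ y ∈ F \ E, euclDiv Nt y < 0 := by
    intro y hy
    have hy2 := hdiff y hy
    have : euclDiv Nt y = euclDiv (unitField ρt) y := by
      refine euclDiv_congr ?_
      filter_upwards [ζ.eventuallyEq_one_of_mem_ball hy2] with z hz
      simp [hNt, hz]
    rw [this, euclDiv_unitField]
    refine (htpert y ?_).2
    rw [Metric.mem_ball] at hy2
    rw [Metric.mem_closedBall]; linarith
  set ε := -∫ y in F \ E, euclDiv Nt y with hε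
  have hεpos : 0 < ε := by
    rw [hε, ← integral_neg, setIntegral_pos_iff_support_of_nonneg_ae]
    · have hopen : IsOpen {y | y ∈ Metric.ball x (R / 4) ∧ (0 < ρ y ∧ ρt y < 0)} :=
        Metric.isOpen_ball.and ((isOpen_lt continuous_const hρ.continuous).and
          (isOpen_lt hρt'.continuous continuous_const))
      have hne : {y | y ∈ Metric.ball x (R / 4) ∧ (0 < ρ y ∧ ρt y < 0)}.Nonempty := by
        obtain ⟨v, hv⟩ := exists_pos_fderiv h0
        have h1 := eventually_lt_add_smul (hρ1.differentiable (by simp) x) hv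
        have h2 := (tendsto_add_smul x v).eventually (Metric.ball_mem_nhds x (ε := R / 4) (by linarith))
        have h3 : ∀ᶠ y in 𝓝 x, ρt y < 0 := by
          refine hρt'.continuous.continuousAt.eventually (eventually_lt_nhds ?_)
          have : η x = 1 := η.one_of_mem_closedBall (Metric.mem_closedBall_self η.rIn_pos.le)
          simp only [hρt, hx, this]; linarith
        obtain ⟨s, h4, h5, h6⟩ := (h1.and (h2.and ((tendsto_add_smul x v).eventually h3))).exists
        exact ⟨_, h5, hx ▸ h4, h6⟩
      refine (hopen.measure_pos volume hne).trans_le (measure_mono fun y hy => ?_)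
      have hyR : y ∈ Metric.ball x R := Metric.ball_subset_ball (by linarith) hy.1
      have hyFE : y ∈ F \ E := ⟨(hFS y hyR).2 (le_of_lt hy.2.2),
        fun hyE => absurd ((hES y hyR).1 hyE) (not_le.2 hy.2.1)⟩
      exact ⟨(neg_pos.2 (hNtdiv y hyFE)).ne', hyFE⟩
    · filter_upwards [ae_restrict_mem (hFm.diff hE)] with y hy
      exact (neg_pos.2 (hNtdiv y hy)).le
    · exact (hint _ hNtc hNts).neg
  have hsplit : ∫ y in F, euclDiv Nt y = (∫ y in E, euclDiv Nt y) - ε := by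
    rw [hε, sub_neg_eq_add, ← setIntegral_union Set.disjoint_sdiff_right (hFm.diff hE)
      (hint _ hNtc hNts) (hint _ hNtc hNts), Set.union_sdiff_cancel hEF]
  have hkey : ∀ X : Euc n → Euc n, ContDiff ℝ 1 X → HasCompactSupport X → (∀ y, ‖X y‖ ≤ 1) →
      ENNReal.ofReal (∫ y in F, euclDiv X y) ≤ perimeter E - ENNReal.ofReal ε ∧
      ENNReal.ofReal ((∫ y in F, euclDiv X y) + ε) ≤ perimeter E := by
    intro X hX hXs hX1
    have hζX : ContDiff ℝ 1 (fun y => ζ y • X y) := hζ.smul hX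
    have hζXs : HasCompactSupport (fun y => ζ y • X y) := hasCompactSupport_smul_left hζc
    set X0 : Euc n → Euc n := fun y => X y - ζ y • X y with hX0
    have hX0c : ContDiff ℝ 1 X0 := hX.sub hζX
    have hX0s : HasCompactSupport X0 := hXs.sub hζXs
    set X' : Euc n → Euc n := fun y => X0 y + N y with hX'
    have hX'c : ContDiff ℝ 1 X' := hX0c.add hNc
    have hX's : HasCompactSupport X' := hX0s.add hNs
    have hX'1 : ∀ y, ‖X' y‖ ≤ 1 := by
      intro y
      have e : X' y = (1 - ζ y) • X y + ζ y • unitField ρ y := by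
        simp only [hX', hX0, hN]; module
      rw [e]
      have h1 : 0 ≤ 1 - ζ y := by linarith [ζ.le_one (x := y)]
      calc _ ≤ ‖(1 - ζ y) • X y‖ + ‖ζ y • unitField ρ y‖ := norm_add_le _ _
        _ ≤ (1 - ζ y) * 1 + ζ y * 1 := by
          rw [norm_smul, norm_smul, Real.norm_of_nonneg h1, Real.norm_of_nonneg ζ.nonneg]
          exact add_le_add (mul_le_mul_of_nonneg_left (hX1 y) h1)
            (mul_le_mul_of_nonneg_left (norm_unitField_le _ _) ζ.nonneg)
        _ = 1 := by ring
    have a1 : ∫ y in F, euclDiv X y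
        = (∫ y in F, euclDiv X0 y) + ∫ y in F, euclDiv (fun y => ζ y • X y) y := by
      rw [← integral_add (hint _ hX0c hX0s) (hint _ hζX hζXs)]
      refine setIntegral_congr_fun hFm fun y _ => ?_
      change euclDiv X y = euclDiv X0 y + euclDiv _ y
      rw [← euclDiv_add (hd hX0c y) (hd hζX y)]
      simp only [hX0, sub_add_cancel]
    have a2 : ∫ y in F, euclDiv X0 y = ∫ y in E, euclDiv X0 y := by
      have : ∫ y in F \ E, euclDiv X0 y = 0 := by
        rw [setIntegral_eq_zero_of_forall_eq_zero]
        intro y hy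
        have : X0 =ᶠ[𝓝 y] fun _ => 0 := by
          filter_upwards [ζ.eventuallyEq_one_of_mem_ball (hdiff y hy)] with z hz
          simp [hX0, hz]
        rw [euclDiv_congr this, euclDiv_zero]
      rw [← Set.union_sdiff_cancel hEF, setIntegral_union Set.disjoint_sdiff_right (hFm.diff hE)
        (hint _ hX0c hX0s) (hint _ hX0c hX0s), this, add_zero]
    have a3 : ∫ y in F, euclDiv (fun y => ζ y • X y) y ≤ ∫ y in F, euclDiv Nt y := by
      refine hcal F hFm hρt1 hFS hζX hNtc fun y hy => ?_
      rw [fderiv_unitField (htpert y hy).1]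
      exact (fderiv_apply_le _ _ _).trans (mul_le_of_le_one_right (Real.sqrt_nonneg _) (hX1 y))
    have a4 : ∫ y in E, euclDiv X' y = (∫ y in E, euclDiv X0 y) + ∫ y in E, euclDiv N y := by
      rw [← integral_add (hint _ hX0c hX0s) (hint _ hNc hNs)]
      exact setIntegral_congr_fun hE fun y _ => euclDiv_add (hd hX0c y) (hd hNc y)
    have a5 : (∫ y in F, euclDiv X y) + ε ≤ ∫ y in E, euclDiv X' y := by linarith
    have a6 := ofReal_setIntegral_le_perimeter E hX'c hX's hX'1
    refine ⟨?_, (ENNReal.ofReal_le_ofReal a5).trans a6⟩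
    calc ENNReal.ofReal (∫ y in F, euclDiv X y)
        ≤ ENNReal.ofReal ((∫ y in E, euclDiv X' y) - ε) := ENNReal.ofReal_le_ofReal (by linarith)
      _ = ENNReal.ofReal (∫ y in E, euclDiv X' y) - ENNReal.ofReal ε :=
        ENNReal.ofReal_sub _ hεpos.le
      _ ≤ _ := tsub_le_tsub_right a6 _
  have hFb : Bornology.IsBounded F :=
    hEb.union (Metric.isBounded_ball.subset Set.inter_subset_left)
  have hle : perimeter E ≤ perimeter E - ENNReal.ofReal ε :=
    (hmin F hEF hFm hFb).trans (perimeter_le fun X h1 h2 h3 => (hkey X h1 h2 h3).1)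
  have hεE : ENNReal.ofReal ε ≤ perimeter E := by
    have := (hkey (fun _ => 0) contDiff_const HasCompactSupport.zero (by simp)).2
    simpa [euclDiv_zero] using this
  have hε0 : ENNReal.ofReal ε ≠ 0 := (ENNReal.ofReal_pos.2 hεpos).ne'
  exact absurd hle (not_le.2 (ENNReal.sub_lt_self (hmin.perimeter_ne_top hEb)
    (fun h => hε0 (le_zero_iff.1 (h ▸ hεE))) hε0))

end FirstVariation

/-! ### The area of a smooth boundary -/

section Area

open MeasureTheory Measure

lemma _root_.LipschitzOnWith.euclideanHausdorffMeasure_image_le {X Y : Type*} [EMetricSpace X]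
    [EMetricSpace Y] [MeasurableSpace X] [BorelSpace X] [MeasurableSpace Y] [BorelSpace Y]
    {K : ℝ≥0} {f : X → Y} {s : Set X} (h : LipschitzOnWith K f s) (d : ℕ) :
    μHE[d] (f '' s) ≤ (K : ℝ≥0∞) ^ d * μHE[d] s := by
  have := h.hausdorffMeasure_image_le (d := d) (Nat.cast_nonneg d)
  rw [ENNReal.rpow_natCast] at this
  simp only [euclideanHausdorffMeasure_def, Measure.smul_apply, ENNReal.smul_def, smul_eq_mul]
  calc _ ≤ _ * ((K : ℝ≥0∞) ^ d * μH[d] s) := by gcongr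
    _ = _ := by ring

variable {n : ℕ} {V : Set (Euc n)} {ρ : Euc n → ℝ} {x : Euc n}

lemma range_eq_top_of_ne_zero {f' : Euc n →L[ℝ] ℝ} (h : f' ≠ 0) : f'.range = ⊤ := by
  rw [LinearMap.range_eq_top]
  refine LinearMap.surjective_of_ne_zero fun h0 => h ?_
  ext v
  exact LinearMap.congr_fun h0 v

lemma finrank_ker_of_ne_zero {f' : Euc n →L[ℝ] ℝ} (h : f' ≠ 0) :
    Module.finrank ℝ f'.ker = n - 1 := by
  have h1 := LinearMap.finrank_range_add_finrank_ker (f' : Euc n →ₗ[ℝ] ℝ)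
  have h2 : LinearMap.range (f' : Euc n →ₗ[ℝ] ℝ) = ⊤ := range_eq_top_of_ne_zero h
  rw [h2, finrank_top, finrank_euclideanSpace, Fintype.card_fin, Module.finrank_self] at h1
  omega

/-- A smooth hypersurface is locally parametrized by its tangent space. -/
lemma exists_local_parametrization (hρ : ContDiffAt ℝ 1 ρ x) (h0 : fderiv ℝ ρ x ≠ 0)
    (hx : ρ x = 0) :
    ∃ (g : (fderiv ℝ ρ x).ker → Euc n) (π : Euc n → (fderiv ℝ ρ x).ker),
      g 0 = x ∧ π x = 0 ∧ HasStrictFDerivAt g (fderiv ℝ ρ x).ker.subtypeL 0 ∧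
      ContinuousAt π x ∧ (∀ᶠ z in 𝓝 0, ρ (g z) = 0) ∧
      ∀ᶠ y in 𝓝 x, ρ y = 0 → g (π y) = y := by
  have hf := hρ.hasStrictFDerivAt (by simp)
  have hf' := range_eq_top_of_ne_zero h0
  refine ⟨hf.implicitFunction ρ _ hf' (ρ x),
    fun y => (hf.implicitToOpenPartialHomeomorph ρ _ hf' y).2, ?_, ?_, ?_, ?_, ?_, ?_⟩
  · exact hf.implicitFunction_apply_image hf'
  · simp
  · exact hf.to_implicitFunction hf'
  · exact continuousAt_snd.comp ((hf.implicitToOpenPartialHomeomorph ρ _ hf').continuousAt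
      (hf.mem_implicitToOpenPartialHomeomorph_source hf'))
  · have h1 := hf.map_implicitFunction_eq hf'
    have h2 : ContinuousAt (fun z : (fderiv ℝ ρ x).ker => (ρ x, z)) 0 := by fun_prop
    filter_upwards [h2.eventually h1] with z hz
    rw [hz, hx]
  · filter_upwards [hf.eq_implicitFunction hf'] with y hy hy0
    rw [hy0] at hy
    rw [hx]
    exact hy

lemma IsDefiningAt.finiteAtFilter (h : IsDefiningAt V x ρ) (hx : x ∈ frontier V) :
    (μHE[n - 1] : Measure (Euc n)).FiniteAtFilter (𝓝[frontier V] x) := by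
  obtain ⟨g, π, hg0, hπ0, hg, hπ, -, hgπ⟩ :=
    exists_local_parametrization h.contDiffAt h.2.1 (h.mem_frontier_iff.1 hx)
  obtain ⟨K, s, hs, hK⟩ := hg.exists_lipschitzOnWith
  set s' := s ∩ Metric.ball 0 1 with hs'
  have hs'n : s' ∈ 𝓝 (0 : (fderiv ℝ ρ x).ker) := Filter.inter_mem hs (Metric.ball_mem_nhds _ one_pos)
  refine ⟨g '' s', ?_, ?_⟩
  · have h1 : ∀ᶠ y in 𝓝 x, π y ∈ s' := hπ.eventually (by rw [hπ0]; exact hs'n)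
    filter_upwards [h1.filter_mono nhdsWithin_le_nhds, hgπ.filter_mono nhdsWithin_le_nhds,
      h.eventually.filter_mono nhdsWithin_le_nhds, self_mem_nhdsWithin] with y h2 h3 h4 h5
    exact ⟨π y, h2, h3 (h4.mem_frontier_iff.1 h5)⟩
  · refine ((hK.mono Set.inter_subset_left).euclideanHausdorffMeasure_image_le (n - 1)).trans_lt ?_
    refine ENNReal.mul_lt_top (by simp) ((measure_mono Set.inter_subset_right).trans_lt ?_)
    rw [← finrank_ker_of_ne_zero h.2.1]
    exact measure_ball_lt_top

lemma IsDefiningAt.measure_pos (h : IsDefiningAt V x ρ) (hx : x ∈ frontier V) {O : Set (Euc n)}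
    (hO : O ∈ 𝓝 x) : 0 < (μHE[n - 1] : Measure (Euc n)) (frontier V ∩ O) := by
  obtain ⟨g, π, hg0, -, hg, -, hρg, -⟩ :=
    exists_local_parametrization h.contDiffAt h.2.1 (h.mem_frontier_iff.1 hx)
  -- `g` expands distances by at least `1 / 2` near `0`
  have hanti : ∀ᶠ p in 𝓝 ((0, 0) : (fderiv ℝ ρ x).ker × (fderiv ℝ ρ x).ker),
      ‖p.1 - p.2‖ ≤ 2 * ‖g p.1 - g p.2‖ := by
    filter_upwards [hg.isLittleO.def (c := 1 / 2) (by norm_num)] with p hp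
    have e : ‖(fderiv ℝ ρ x).ker.subtypeL (p.1 - p.2)‖ = ‖p.1 - p.2‖ := rfl
    have := norm_sub_norm_le ((fderiv ℝ ρ x).ker.subtypeL (p.1 - p.2)) (g p.1 - g p.2)
    rw [norm_sub_rev ((fderiv ℝ ρ x).ker.subtypeL (p.1 - p.2)), e] at this
    linarith
  have hmem : ∀ᶠ z in 𝓝 (0 : (fderiv ℝ ρ x).ker), g z ∈ frontier V ∩ O := by
    have hgc : ContinuousAt g 0 := hg.continuousAt
    have h1 : ∀ᶠ z in 𝓝 (0 : (fderiv ℝ ρ x).ker), IsDefiningAt V (g z) ρ :=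
      hgc.eventually (by rw [hg0]; exact h.eventually)
    have h2 : ∀ᶠ z in 𝓝 (0 : (fderiv ℝ ρ x).ker), g z ∈ O :=
      hgc.eventually (by rw [hg0]; exact hO)
    filter_upwards [h1, h2, hρg] with z h3 h4 h5
    exact ⟨h3.mem_frontier_iff.2 h5, h4⟩
  rw [nhds_prod_eq] at hanti
  obtain ⟨t, ht, hanti⟩ := (Filter.eventually_prod_self_iff
    (r := fun p q => ‖p - q‖ ≤ 2 * ‖g p - g q‖)).1 hanti
  obtain ⟨δ, hδ, hball⟩ := Metric.mem_nhds_iff.1 (Filter.inter_mem ht hmem)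
  set b := Metric.ball (0 : (fderiv ℝ ρ x).ker) δ
  have hinj : Set.InjOn g b := fun a ha c hc hac => by
    have := hanti a (hball ha).1 c (hball hc).1
    rw [hac, sub_self, norm_zero, mul_zero] at this
    exact sub_eq_zero.1 (norm_le_zero_iff.1 this)
  have hlip : LipschitzOnWith 2 (Function.invFunOn g b) (g '' b) := by
    refine LipschitzOnWith.of_dist_le_mul ?_
    rintro _ ⟨a, ha, rfl⟩ _ ⟨c, hc, rfl⟩
    rw [hinj.leftInvOn_invFunOn ha, hinj.leftInvOn_invFunOn hc, dist_eq_norm, dist_eq_norm]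
    exact hanti a (hball ha).1 c (hball hc).1
  have h1 := hlip.euclideanHausdorffMeasure_image_le (n - 1)
  rw [hinj.leftInvOn_invFunOn.image_image] at h1
  have h2 : 0 < (μHE[n - 1] : Measure (fderiv ℝ ρ x).ker) b := by
    rw [← finrank_ker_of_ne_zero h.2.1]
    exact Metric.measure_ball_pos _ _ hδ
  have h3 : 0 < (μHE[n - 1] : Measure (Euc n)) (g '' b) := by
    by_contra! h0
    rw [nonpos_iff_eq_zero.1 h0, mul_zero] at h1
    exact absurd h1 (not_le.2 h2)
  refine h3.trans_le (measure_mono ?_)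
  rintro _ ⟨a, ha, rfl⟩
  exact (hball ha).2

lemma isCompact_frontier_of_isBounded (hb : Bornology.IsBounded V) : IsCompact (frontier V) :=
  hb.isCompact_closure.of_isClosed_subset isClosed_frontier frontier_subset_closure

lemma HasSmoothBoundary.measure_frontier_lt_top (hV : HasSmoothBoundary V)
    (hb : Bornology.IsBounded V) : (μHE[n - 1] : Measure (Euc n)) (frontier V) < ⊤ := by
  refine (isCompact_frontier_of_isBounded hb).measure_lt_top_of_nhdsWithin fun x hx => ?_
  obtain ⟨ρ, h⟩ := hV x hx
  exact h.finiteAtFilter hx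

/-- A non-negative continuous function on a smooth closed hypersurface with vanishing integral
vanishes identically. -/
lemma HasSmoothBoundary.eq_zero_of_integral_eq_zero (hV : HasSmoothBoundary V)
    (hb : Bornology.IsBounded V) {G : Euc n → ℝ} (hG : ContinuousOn G (frontier V))
    (hnn : ∀ x ∈ frontier V, 0 ≤ G x) (h0 : ∫ x in frontier V, G x ∂(μHE[n - 1]) = 0) :
    ∀ x ∈ frontier V, G x = 0 := by
  have hcomp := isCompact_frontier_of_isBounded hb
  have hm : MeasurableSet (frontier V) := isClosed_frontier.measurableSet
  obtain ⟨C, hC⟩ := hcomp.exists_bound_of_continuousOn hG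
  have hint : IntegrableOn G (frontier V) (μHE[n - 1]) :=
    ⟨hG.aestronglyMeasurable hm, .restrict_of_bounded (C := C) (hV.measure_frontier_lt_top hb)
      ((ae_restrict_iff' hm).2 (Filter.Eventually.of_forall hC))⟩
  rw [setIntegral_eq_zero_iff_of_nonneg_ae
    ((ae_restrict_iff' hm).2 (Filter.Eventually.of_forall hnn)) hint] at h0
  intro x hx
  by_contra hne
  obtain ⟨ρ, h⟩ := hV x hx
  have h1 : ∀ᶠ y in 𝓝[frontier V] x, G y ≠ 0 := (hG x hx).eventually_ne hne
  obtain ⟨O, hO, hOG⟩ := mem_nhdsWithin_iff_exists_mem_nhds_inter.1 h1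
  have h2 := h.measure_pos hx hO
  rw [Filter.EventuallyEq, ae_restrict_iff' hm, ae_iff] at h0
  refine absurd h2 (not_lt.2 (le_of_le_of_eq (measure_mono fun y hy => ?_) h0))
  simp only [Set.mem_ofPred_eq, not_forall]
  exact ⟨hy.1, hOG ⟨hy.2, hy.1⟩⟩

end Area

/-! ### Mean curvature at a point of contact with a sphere -/

section Sphere

variable {n : ℕ} {φ : Euc n → ℝ} {y : Euc n}

lemma not_eventually_norm_le (hn : n ≠ 0) (y : Euc n) : ¬ ∀ᶠ z in 𝓝 y, ‖z‖ ≤ ‖y‖ := by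
  intro h
  have : Nonempty (Fin n) := ⟨⟨0, Nat.pos_of_ne_zero hn⟩⟩
  have h1 : y ∈ interior (Metric.closedBall (0 : Euc n) ‖y‖) := by
    rw [mem_interior_iff_mem_nhds]
    filter_upwards [h] with z hz
    simpa using hz
  rcases eq_or_ne y 0 with rfl | hy
  · simp at h1
  · rw [interior_closedBall _ (norm_ne_zero_iff.2 hy)] at h1
    simp at h1

/-- A superlevel set which near `y` lies inside the ball through `y` centred at the origin bends
at least as much as that ball, by comparison of `φ` with its values on the parabolas
`y + s e - s² |e|² y / (2 |y|²)`, `e ⊥ y`, which lie outside the ball. -/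
lemma gradSq_mul_lapl_sub_hessGrad_neg (hn : 2 ≤ n) (hφ : ContDiffAt ℝ 2 φ y)
    (h0 : fderiv ℝ φ y ≠ 0) (hle : ∀ᶠ z in 𝓝 y, ‖y‖ < ‖z‖ → φ z ≤ φ y) :
    gradSq φ y * lapl φ y - hessGrad φ y < 0 := by
  have hy : y ≠ 0 := by
    rintro rfl
    refine h0 (IsLocalMax.fderiv_eq_zero ?_)
    filter_upwards [hle] with z hz
    rcases eq_or_ne z 0 with rfl | hz0
    · exact le_rfl
    · exact hz (by simpa using hz0)
  have hr : 0 < ‖y‖ := norm_pos_iff.2 hy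
  have hr2 : 0 < ‖y‖ ^ 2 := by positivity
  set N := fderiv ℝ φ y y with hN
  set A : Fin n → Fin n → ℝ := fun i j => pderiv i (pderiv j φ) y with hA
  have hd : DifferentiableAt ℝ φ y := hφ.differentiableAt (by norm_num)
  have key : ∀ e : Euc n, inner ℝ y e = 0 → fderiv ℝ φ y e = 0 ∧
      ∑ i, ∑ j, e i * e j * A i j ≤ ‖e‖ ^ 2 / ‖y‖ ^ 2 * N := by
    intro e he
    set k : Euc n := (-(‖e‖ ^ 2 / (2 * ‖y‖ ^ 2))) • y with hk
    have hmax : IsLocalMax (fun s : ℝ => φ (y + s • e + s ^ 2 • k)) 0 := by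
      have ht : Filter.Tendsto (fun s : ℝ => y + s • e + s ^ 2 • k) (𝓝 0) (𝓝 y) := by
        have : Continuous (fun s : ℝ => y + s • e + s ^ 2 • k) := by fun_prop
        simpa using this.tendsto 0
      filter_upwards [ht.eventually hle] with s hs
      have e0 : y + (0 : ℝ) • e + (0 : ℝ) ^ 2 • k = y := by simp
      rw [e0]
      by_cases hse : s = 0 ∨ e = 0
      · have : y + s • e + s ^ 2 • k = y := by
          rcases hse with h | h <;> simp [h, hk]
        rw [this]
      · push Not at hse
        refine hs ?_
        have hrep : y + s • e + s ^ 2 • k = (1 - s ^ 2 * (‖e‖ ^ 2 / (2 * ‖y‖ ^ 2))) • y + s • e := by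
          rw [hk]; module
        have hnorm : ‖y + s • e + s ^ 2 • k‖ ^ 2
            = ‖y‖ ^ 2 + s ^ 4 * ‖e‖ ^ 4 / (4 * ‖y‖ ^ 2) := by
          rw [hrep, norm_add_sq_real, inner_smul_left, inner_smul_right, he, norm_smul, norm_smul,
            mul_pow, mul_pow, Real.norm_eq_abs, Real.norm_eq_abs, sq_abs, sq_abs]
          field_simp
          ring
        have h4 : 0 < s ^ 4 * ‖e‖ ^ 4 / (4 * ‖y‖ ^ 2) := by
          have := norm_pos_iff.2 hse.2
          have : 0 < s ^ 4 := by have := hse.1; positivity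
          positivity
        exact lt_of_pow_lt_pow_left₀ 2 (norm_nonneg _) (by linarith)
    obtain ⟨h1, h2⟩ := secondOrder_of_isLocalMax hφ hmax
    refine ⟨h1, ?_⟩
    rw [hk, map_smul, smul_eq_mul, ← hN] at h2
    have : 2 * (-(‖e‖ ^ 2 / (2 * ‖y‖ ^ 2)) * N) = -(‖e‖ ^ 2 / ‖y‖ ^ 2 * N) := by
      field_simp
    linarith
  -- the projections of the standard basis to the orthogonal complement of `y`
  set v : Fin n → Euc n := fun m => EuclideanSpace.single m 1 - (y m / ‖y‖ ^ 2) • y with hv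
  have hvy : ∀ m, inner ℝ y (v m) = 0 := fun m => by
    rw [hv, inner_sub_right, inner_smul_right, real_inner_self_eq_norm_sq,
      EuclideanSpace.inner_single_right]
    simp [hr2.ne']
  have hvn : ∀ m, ‖v m‖ ^ 2 = 1 - y m ^ 2 / ‖y‖ ^ 2 := fun m => by
    rw [hv, norm_sub_sq_real, inner_smul_right, EuclideanSpace.inner_single_left, norm_smul, mul_pow,
      Real.norm_eq_abs, sq_abs, PiLp.norm_single]
    simp
    field_simp
    ring
  have hq : ∀ i, pderiv i φ y = N / ‖y‖ ^ 2 * y i := fun i => by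
    have := (key (v i) (hvy i)).1
    rw [hv, map_sub, map_smul, smul_eq_mul, ← hN] at this
    unfold pderiv
    linear_combination this
  have hysum : ∑ i, y i ^ 2 = ‖y‖ ^ 2 := (EuclideanSpace.real_norm_sq_eq y).symm
  have hNneg : N < 0 := by
    refine lt_of_le_of_ne ?_ fun hN0 => h0 ((fderiv_eq_zero_iff).2 fun i => by simp [hq, hN0])
    by_contra! hNpos
    obtain ⟨s, hs1, hs2, hs3⟩ := ((eventually_lt_add_smul hd hNpos).and
      (((tendsto_add_smul y y).eventually hle).and self_mem_nhdsWithin)).exists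
    refine absurd (hs2 ?_) (not_le.2 hs1)
    have hs3 : (0 : ℝ) < s := hs3
    have : y + s • y = (1 + s) • y := by module
    rw [this, norm_smul, Real.norm_eq_abs, abs_of_pos (by linarith)]
    nlinarith
  set B := ∑ i, ∑ j, y i * y j * A i j with hB
  have htr : ∑ m, ∑ i, ∑ j, v m i * v m j * A i j = lapl φ y - B / ‖y‖ ^ 2 := by
    have hm : ∀ m, ∑ i, ∑ j, v m i * v m j * A i j = A m m
        - (y m / ‖y‖ ^ 2) * ∑ j, y j * A m j - (y m / ‖y‖ ^ 2) * ∑ i, y i * A i m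
        + y m ^ 2 / ‖y‖ ^ 4 * B := by
      intro m
      have hvi : ∀ i, v m i = (if i = m then 1 else 0) - y m / ‖y‖ ^ 2 * y i := fun i => by
        simp [hv]
      have hij : ∀ i j, v m i * v m j * A i j = (if i = m then (if j = m then A i j else 0) else 0)
          - (if i = m then y m / ‖y‖ ^ 2 * (y j * A i j) else 0)
          - (if j = m then y m / ‖y‖ ^ 2 * (y i * A i j) else 0)
          + y m ^ 2 / ‖y‖ ^ 4 * (y i * y j * A i j) := fun i j => by
        rw [hvi, hvi]
        split_ifs <;> ring
      simp only [hij, Finset.sum_add_distrib, Finset.sum_sub_distrib, Finset.sum_ite_irrel,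
        Finset.sum_ite_eq', Finset.mem_univ, if_true, Finset.sum_const_zero, hB, Finset.mul_sum]
    have s1 : ∑ m, y m / ‖y‖ ^ 2 * ∑ j, y j * A m j = B / ‖y‖ ^ 2 := by
      simp only [hB, Finset.sum_div, Finset.mul_sum]
      exact Finset.sum_congr rfl fun i _ => Finset.sum_congr rfl fun j _ => by ring
    have s2 : ∑ m, y m / ‖y‖ ^ 2 * ∑ i, y i * A i m = B / ‖y‖ ^ 2 := by
      simp only [hB, Finset.sum_div, Finset.mul_sum]
      rw [Finset.sum_comm]
      exact Finset.sum_congr rfl fun i _ => Finset.sum_congr rfl fun j _ => by ring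
    have s3 : ∑ m, y m ^ 2 / ‖y‖ ^ 4 * B = B / ‖y‖ ^ 2 := by
      rw [← Finset.sum_mul, ← Finset.sum_div, hysum]; field_simp
    simp only [hm, Finset.sum_add_distrib, Finset.sum_sub_distrib, s1, s2, s3]
    simp only [lapl, hA]
    ring
  have hle' : lapl φ y - B / ‖y‖ ^ 2 ≤ (n - 1) / ‖y‖ ^ 2 * N := by
    rw [← htr]
    refine (Finset.sum_le_sum fun m _ => (key (v m) (hvy m)).2).trans_eq ?_
    simp only [hvn, ← Finset.sum_mul, ← Finset.sum_div, Finset.sum_sub_distrib, hysum]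
    simp [hr2.ne']
  have hgs : gradSq φ y = N ^ 2 / ‖y‖ ^ 2 := by
    simp only [gradSq, hq, mul_pow, ← Finset.mul_sum, hysum]
    field_simp
  have hhg : hessGrad φ y = N ^ 2 / ‖y‖ ^ 4 * B := by
    simp only [hessGrad, hq, hB, Finset.mul_sum]
    refine Finset.sum_congr rfl fun i _ => Finset.sum_congr rfl fun j _ => ?_
    simp only [hA]
    ring
  have e : gradSq φ y * lapl φ y - hessGrad φ y
      = N ^ 2 / ‖y‖ ^ 2 * (lapl φ y - B / ‖y‖ ^ 2) := by
    rw [hgs, hhg]; field_simp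
  have hn' : (2 : ℝ) ≤ n := by exact_mod_cast hn
  rw [e]
  have h1 : (n - 1) / ‖y‖ ^ 2 * N < 0 :=
    mul_neg_of_pos_of_neg (div_pos (by linarith) hr2) hNneg
  exact mul_neg_of_pos_of_neg (div_pos (by have := hNneg.ne; positivity) hr2) (by linarith)

lemma levelMeanCurvature_flat_pos_iff (hφ : ContDiffAt ℝ 2 φ y) (h0 : fderiv ℝ φ y ≠ 0) :
    0 < levelMeanCurvature (flatMetric n) φ y ↔ 0 < gradSq φ y * lapl φ y - hessGrad φ y := by
  have hq := gradSq_pos_iff.2 h0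
  have e : lapl φ y - hessGrad φ y / gradSq φ y
      = (gradSq φ y * lapl φ y - hessGrad φ y) / gradSq φ y := by field_simp
  rw [levelMeanCurvature_flat hφ h0, e, div_pos_iff_of_pos_right (Real.sqrt_pos.2 hq),
    div_pos_iff_of_pos_right hq]

/-- A sublevel set which near `y` lies inside the ball through `y` centred at the origin is
strictly mean convex at `y`. -/
lemma levelMeanCurvature_flat_pos_of_sphere (hn : 2 ≤ n) (hφ : ContDiffAt ℝ 2 φ y)
    (h0 : fderiv ℝ φ y ≠ 0) (hle : ∀ᶠ z in 𝓝 y, ‖y‖ < ‖z‖ → φ y ≤ φ z) :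
    0 < levelMeanCurvature (flatMetric n) φ y := by
  rw [levelMeanCurvature_flat_pos_iff hφ h0]
  have hneg : ∀ i, pderiv i (fun z => -φ z) = fun z => -pderiv i φ z :=
    fun i => funext fun z => pderiv_neg i
  have h0' : fderiv ℝ (fun z => -φ z) y ≠ 0 := by
    rw [fderiv_fun_neg]; exact neg_ne_zero.2 h0
  have := gradSq_mul_lapl_sub_hessGrad_neg hn hφ.neg h0'
    (hle.mono fun z hz h => neg_le_neg (hz h))
  simp only [gradSq, lapl, hessGrad, hneg, pderiv_neg, Finset.sum_neg_distrib, neg_sq, mul_neg,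
    neg_mul, neg_neg] at this ⊢
  linarith

end Sphere

/-! ### Compact graphs and their level sets -/

section CompactGraphs

open MeasureTheory

variable {n : ℕ} {U Uₒ : Set (Euc n)} {f F : Euc n → ℝ} {x : Euc n}

lemma countable_image_of_locally_constant {s : Set (Euc n)}
    (h : ∀ x ∈ s, ∀ᶠ y in 𝓝[s] x, F y = F x) : (F '' s).Countable := by
  obtain ⟨t, -, ht, hst⟩ := TopologicalSpace.countable_cover_nhdsWithin h
  refine (ht.image F).mono ?_
  rintro _ ⟨y, hy, rfl⟩
  obtain ⟨z, hz, hyz⟩ := Set.mem_iUnion₂.1 (hst hy)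
  exact ⟨z, hz, Eq.symm hyz⟩

lemma IsDefiningAt.notMem_interior_closure {V : Set (Euc n)} {ρ : Euc n → ℝ}
    (h : IsDefiningAt V x ρ) (hx : x ∈ frontier V) : x ∉ interior (closure V) := by
  intro hi
  refine h.2.1 (IsLocalMax.fderiv_eq_zero ?_)
  filter_upwards [h.eventually, mem_interior_iff_mem_nhds.1 hi] with y hy hyV
  rw [h.mem_frontier_iff.1 hx]
  exact hy.mem_closure_iff.1 hyV

namespace IsCompactGraph

lemma frontier_subset (h : IsCompactGraph U Uₒ f) : frontier U ⊆ closure U \ closure Uₒ := by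
  intro x hx
  rw [h.isOpen.frontier_eq] at hx
  exact ⟨hx.1, fun hc => hx.2 (h.closure_inner_subset hc)⟩

lemma frontier_subset_frontier (h : IsCompactGraph U Uₒ f) :
    frontier U ⊆ frontier (closure U \ Uₒ) := by
  intro x hx
  have h1 := h.frontier_subset hx
  obtain ⟨ρ, hρ⟩ := h.smoothBoundary x hx
  exact ⟨subset_closure ⟨h1.1, fun hc => h1.2 (subset_closure hc)⟩,
    fun hi => hρ.notMem_interior_closure hx (interior_mono Set.sdiff_subset hi)⟩

lemma frontier_inner_subset (h : IsCompactGraph U Uₒ f) : frontier Uₒ ⊆ closure U \ Uₒ := by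
  intro x hx
  rw [h.isOpen_inner.frontier_eq] at hx
  exact ⟨subset_closure (h.closure_inner_subset hx.1), hx.2⟩

lemma isCompact_closure (h : IsCompactGraph U Uₒ f) : IsCompact (closure U) :=
  h.isBounded.isCompact_closure

lemma isOpen_diff (h : IsCompactGraph U Uₒ f) : IsOpen (U \ closure Uₒ) :=
  h.isOpen.sdiff isClosed_closure

lemma diff_subset (_ : IsCompactGraph U Uₒ f) : U \ closure Uₒ ⊆ closure U \ closure Uₒ :=
  Set.sdiff_subset_sdiff_left subset_closure

lemma contDiffAt (h : IsCompactGraph U Uₒ f) (hx : x ∈ closure U \ closure Uₒ) {k : ℕ} :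
    ContDiffAt ℝ k f x :=
  (h.smooth x hx).of_le (by exact_mod_cast le_top)

lemma differentiableAt (h : IsCompactGraph U Uₒ f) (hx : x ∈ closure U \ closure Uₒ) :
    DifferentiableAt ℝ f x :=
  (h.contDiffAt (k := 1) hx).differentiableAt (by norm_num)

end IsCompactGraph

/-- The set of points through which there passes a regular, strictly mean convex level set. -/
def meanConvexPoints (U Uₒ : Set (Euc n)) (f : Euc n → ℝ) : Set (Euc n) :=
  {y ∈ U \ closure Uₒ | fderiv ℝ f y ≠ 0 ∧ 0 < levelMeanCurvature (flatMetric n) f y}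

namespace IsFillIn

lemma eq (h : IsFillIn U Uₒ f F) (hx : x ∈ closure U \ closure Uₒ) : F x = f x :=
  h.1 ⟨hx.1, fun hc => hx.2 (subset_closure hc)⟩

lemma countable_image (h : IsFillIn U Uₒ f F) (hf : IsCompactGraph U Uₒ f) :
    (F '' closure Uₒ).Countable := by
  rw [closure_eq_self_union_frontier, Set.image_union]
  refine (countable_image_of_locally_constant fun x hx =>
    (h.2.2 x hx).filter_mono nhdsWithin_le_nhds).union
    (countable_image_of_locally_constant fun x hx => ?_)
  filter_upwards [hf.locallyConstant_inner x hx, self_mem_nhdsWithin] with y hy hy'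
  rw [h.1 (hf.frontier_inner_subset hx), h.1 (hf.frontier_inner_subset hy'), hy]

end IsFillIn

/-- A height whose level set avoids `Ūₒ` and satisfies the two conditions imposed on almost every
level set of an admissible graph. -/
def IsGoodHeight (U Uₒ : Set (Euc n)) (f F : Euc n → ℝ) (h : ℝ) : Prop :=
  h ∉ F '' closure Uₒ ∧ StrictlyMeanConvexLevel U Uₒ f h ∧
    IsOuterMinimizing {x ∈ closure U | F x < h}

namespace IsAdmissible

/-- There are good heights between any two different values of the fill-in, because the excluded
heights form a null set; by connectedness such a height is attained. -/
lemma exists_isGoodHeight (hA : IsAdmissible U Uₒ f) (hF : IsFillIn U Uₒ f F)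
    (hO : ∀ᵐ h : ℝ, h ∈ f '' (closure U \ Uₒ) → IsOuterMinimizing {x ∈ closure U | F x < h})
    {s : Set (Euc n)} (hs : s ⊆ closure U) (hsc : IsPreconnected s) {x z : Euc n}
    (hx : x ∈ s) (hz : z ∈ s) (hlt : F x < F z) :
    ∃ h ∈ Set.Ioo (F x) (F z), IsGoodHeight U Uₒ f F h ∧ ∃ y ∈ s, F y = h ∧ y ∉ closure Uₒ := by
  have h1 : ∀ᵐ h : ℝ, h ∉ F '' closure Uₒ :=
    (hF.countable_image hA.toIsCompactGraph).ae_notMem _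
  have h2 := h1.and (hA.strictlyMeanConvex.and hO)
  obtain ⟨h, ⟨hn, hS, hm⟩, hh⟩ := (Measure.dense_of_ae h2).exists_between hlt
  obtain ⟨y, hy, hyh⟩ : h ∈ F '' s :=
    (hsc.image F (hF.2.1.mono hs)).ordConnected.out (Set.mem_image_of_mem F hx)
      (Set.mem_image_of_mem F hz) (Set.Ioo_subset_Icc_self hh)
  have hyo : y ∉ closure Uₒ := fun hc => hn ⟨y, hc, hyh⟩
  have him : h ∈ f '' (closure U \ Uₒ) :=
    ⟨y, ⟨hs hy, fun hc => hyo (subset_closure hc)⟩, by rw [← hyh, hF.eq ⟨hs hy, hyo⟩]⟩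
  exact ⟨h, hh, ⟨hn, hS him, hm him⟩, y, hy, hyh, hyo⟩

/-- Away from the mean convex level sets `f` is locally constant, since otherwise it would take an
interval of values there, almost all of which are good heights. -/
lemma eventually_fderiv_eq_zero (hA : IsAdmissible U Uₒ f) (hx : x ∈ closure U \ closure Uₒ)
    (hxP : x ∉ closure (meanConvexPoints U Uₒ f)) : ∀ᶠ y in 𝓝[U] x, fderiv ℝ f y = 0 := by
  obtain ⟨F, hF, hO⟩ := hA.outerMinimizing
  have h1 : ∀ᶠ y in 𝓝 x, y ∈ (closure (meanConvexPoints U Uₒ f))ᶜ ∩ (closure Uₒ)ᶜ :=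
    (isClosed_closure.isOpen_compl.inter isClosed_closure.isOpen_compl).mem_nhds ⟨hxP, hx.2⟩
  filter_upwards [h1.filter_mono nhdsWithin_le_nhds, self_mem_nhdsWithin] with y hy hyU
  by_contra hne
  obtain ⟨v, hv⟩ := exists_pos_fderiv hne
  set O := U ∩ ((closure (meanConvexPoints U Uₒ f))ᶜ ∩ (closure Uₒ)ᶜ) with hOdef
  have hOo : IsOpen O :=
    hA.isOpen.inter (isClosed_closure.isOpen_compl.inter isClosed_closure.isOpen_compl)
  obtain ⟨ε, hε, hball⟩ := Metric.isOpen_iff.1 hOo y ⟨hyU, hy⟩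
  have hOc : O ⊆ closure U \ closure Uₒ := fun z hz => ⟨subset_closure hz.1, hz.2.2⟩
  have hd := hA.differentiableAt (hOc ⟨hyU, hy⟩)
  obtain ⟨s, hs1, hs2⟩ := ((eventually_lt_add_smul hd hv).and
    ((tendsto_add_smul y v).eventually (Metric.ball_mem_nhds y hε))).exists
  have hyb := Metric.mem_ball_self (x := y) hε
  obtain ⟨h, -, hg, z, hz, hzh, -⟩ := hA.exists_isGoodHeight hF hO
    (fun z hz => (hOc (hball hz)).1) (convex_ball y ε).isPreconnected hyb hs2
    (by rwa [hF.eq (hOc (hball hyb)), hF.eq (hOc (hball hs2))])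
  have hzO := hball hz
  have := hg.2.1 z (hOc hzO) (by rw [← hzh, hF.eq (hOc hzO)])
  exact hzO.2.1 (subset_closure ⟨⟨hzO.1, hzO.2.2⟩, this⟩)

/-- The graph is mean convex: on the mean convex level sets this follows from the Gauss equation, and
the remaining points are limits of these or have a horizontal neighbourhood. -/
lemma graphMean_nonneg (hA : IsAdmissible U Uₒ f) (hx : x ∈ U \ closure Uₒ) :
    0 ≤ graphMean f x := by
  have hx' := hA.diff_subset hx
  by_cases hxP : x ∈ closure (meanConvexPoints U Uₒ f)
  · have hc := continuousAt_graphMean (hA.contDiffAt (k := 2) hx')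
    by_contra! hneg
    obtain ⟨y, hyn, hy⟩ := ((hc.eventually_lt continuousAt_const hneg).and_frequently
      (mem_closure_iff_frequently.1 hxP)).exists
    have hy' := hA.diff_subset hy.1
    exact absurd hyn (not_lt.2 (graphMean_pos (hA.contDiffAt (k := 3) hy') hy.2.1
      (hA.scalarCurvature_nonneg y hy') hy.2.2).le)
  · have h1 := hA.eventually_fderiv_eq_zero hx' hxP
    rw [hA.isOpen.nhdsWithin_eq hx.1] at h1
    have h2 : ∀ i, pderiv i f =ᶠ[𝓝 x] fun _ => 0 := fun i => by
      filter_upwards [h1] with y hy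
      exact (fderiv_eq_zero_iff).1 hy i
    have h3 : ∀ i j, pderiv i (pderiv j f) x = 0 := fun i j => by
      rw [pderiv_congr (h2 j), pderiv_const]
    simp [graphMean, lapl, hessGrad, h3]

lemma eventually_eq_frontier (hA : IsAdmissible U Uₒ f) (hx : x ∈ frontier U) :
    ∀ᶠ y in 𝓝[frontier U] x, f y = f x :=
  (hA.locallyConstant x (hA.frontier_subset_frontier hx)).filter_mono
    (nhdsWithin_mono _ hA.frontier_subset_frontier)

/-- Where the graph is not horizontal, the outer boundary is mean convex: below the maximal height
because the sublevel sets just above are outer-minimizing, and at the maximal height as a limit of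
mean convex level sets. -/
lemma boundaryMeanCurvature_nonneg (hA : IsAdmissible U Uₒ f) (hx : x ∈ frontier U)
    (hne : fderiv ℝ f x ≠ 0) : 0 ≤ boundaryMeanCurvature (flatMetric n) U x := by
  obtain ⟨F, hF, hO⟩ := hA.outerMinimizing
  have hx' := hA.frontier_subset hx
  obtain ⟨ρ, hρ⟩ := hA.smoothBoundary x hx
  rw [hρ.boundaryMeanCurvature_flat hx]
  by_cases hmax : ∀ z ∈ closure U, F z ≤ F x
  · obtain ⟨c, hc⟩ := hρ.exists_fderiv_eq_smul hx (hA.contDiffAt (k := 1) hx')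
      (hA.eventually_eq_frontier hx)
    have hc0 : 0 < c := by
      rcases lt_trichotomy c 0 with h | h | h
      · obtain ⟨v, hv⟩ := exists_pos_fderiv hρ.2.1
        have hv' : fderiv ℝ ρ x (-v) < 0 := by rw [map_neg]; linarith
        have hv'' : 0 < fderiv ℝ f x (-v) := by
          rw [hc, smul_apply, smul_eq_mul]
          exact mul_pos_of_neg_of_neg h hv'
        obtain ⟨s, hs1, hs2, hs3, hs4⟩ := ((eventually_lt_add_smul (hA.differentiableAt hx') hv'').and
          ((eventually_add_smul_lt hρ.differentiableAt hv').and
          (((tendsto_add_smul x (-v)).eventually hρ.2.2).and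
          ((tendsto_add_smul x (-v)).eventually
            (isClosed_closure.isOpen_compl.mem_nhds hx'.2))))).exists
        rw [hρ.mem_frontier_iff.1 hx] at hs2
        have hsU := subset_closure (hs3.2 hs2)
        have := hmax _ hsU
        rw [hF.eq hx', hF.eq ⟨hsU, hs4⟩] at this
        exact absurd hs1 (not_lt.2 this)
      · exact absurd (by rw [hc, h, zero_smul]) hne
      · exact h
    have hdot : 0 < gradDot f ρ x := by
      have : gradDot f ρ x = c * gradSq ρ x := by
        simp only [gradDot, gradSq, pderiv_eq_mul hc, Finset.mul_sum]
        exact Finset.sum_congr rfl fun i _ => by ring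
      rw [this]
      exact mul_pos hc0 (gradSq_pos_iff.2 hρ.2.1)
    have h1 := hρ.levelMeanCurvature_eq hx (f := fun _ => 0) contDiffAt_const
      (hA.contDiffAt (k := 2) hx') (hA.eventually_eq_frontier hx) hdot
    rw [← flatMetric_eq] at h1
    rw [← h1]
    have hxP : x ∈ closure (meanConvexPoints U Uₒ f) := by
      by_contra hxP
      have h2 := hA.eventually_fderiv_eq_zero hx' hxP
      have h3 : ∃ᶠ y in 𝓝 x, y ∈ U := mem_closure_iff_frequently.1 hx'.1
      obtain ⟨y, hy, hyU, hy0⟩ := ((fderiv_ne_zero_eventually (hA.contDiffAt (k := 1) hx')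
        hne).and_frequently (h3.and_eventually (eventually_nhdsWithin_iff.1 h2))).exists
      exact hy (hy0 hyU)
    have hcont := continuousAt_levelMeanCurvature_flat (hA.contDiffAt (k := 2) hx') hne
    by_contra! hneg
    obtain ⟨y, hyn, hy⟩ := ((hcont.eventually_lt continuousAt_const hneg).and_frequently
      (mem_closure_iff_frequently.1 hxP)).exists
    exact absurd hyn (not_lt.2 hy.2.2.le)
  · push Not at hmax
    obtain ⟨z, hz, hlt⟩ := hmax
    obtain ⟨h, hh, hg, -⟩ := hA.exists_isGoodHeight hF hO subset_rfl
      hA.isConnected.closure.isPreconnected hx'.1 hz hlt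
    by_contra! hneg
    refine not_isOuterMinimizing ?_ (hA.isBounded.closure.subset fun y hy => hy.1) hρ.1
      (hρ.mem_frontier_iff.1 hx) hρ.2.1 hneg ?_ hg.2.2
    · obtain ⟨u, hu, hu'⟩ := (continuousOn_iff'.1 hF.2.1) (Set.Iio h) isOpen_Iio
      have : {y ∈ closure U | F y < h} = F ⁻¹' Set.Iio h ∩ closure U := by
        ext y; exact and_comm
      rw [this, hu']
      exact hu.measurableSet.inter isClosed_closure.measurableSet
    · have h1 : ∀ᶠ y in 𝓝[closure U] x, F y < h :=
        (hF.2.1 x hx'.1).eventually_lt_const hh.1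
      filter_upwards [hρ.eventually, eventually_nhdsWithin_iff.1 h1] with y hy1 hy2
      rw [← hy1.mem_closure_iff]
      exact ⟨fun hy => hy.1, fun hy => ⟨hy, hy2 hy⟩⟩

end IsAdmissible

end CompactGraphs

/-! ### Positivity of the Brown–York mass -/

section Positivity

open MeasureTheory

variable {n : ℕ} {U Uₒ : Set (Euc n)} {f F : Euc n → ℝ} {x : Euc n}

lemma IsCompactGraph.boundaryMeanCurvature_sub_eq (h : IsCompactGraph U Uₒ f)
    (hx : x ∈ frontier U) (hc : ∀ᶠ y in 𝓝[frontier U] x, f y = f x) :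
    boundaryMeanCurvature (flatMetric n) U x - boundaryMeanCurvature (graphMetric f) U x
      = boundaryMeanCurvature (flatMetric n) U x * (1 - 1 / √(1 + gradSq f x)) := by
  obtain ⟨ρ, hρ⟩ := h.smoothBoundary x hx
  rw [hρ.boundaryMeanCurvature_graph_eq_div hx (h.contDiffAt (k := 2) (h.frontier_subset hx)) hc]
  ring

lemma one_sub_inv_sqrt_nonneg (f : Euc n → ℝ) (x : Euc n) : 0 ≤ 1 - 1 / √(1 + gradSq f x) := by
  have h1 : 1 ≤ √(1 + gradSq f x) := Real.one_le_sqrt.2 (by linarith [gradSq_nonneg f x])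
  have := (div_le_one (by linarith)).2 h1
  linarith

lemma fderiv_eq_zero_of_one_sub_inv_sqrt (h : 1 - 1 / √(1 + gradSq f x) = 0) :
    fderiv ℝ f x = 0 := by
  by_contra hne
  have h1 := gradSq_pos_iff.2 hne
  have h2 : 1 < √(1 + gradSq f x) := Real.lt_sqrt_of_sq_lt (by linarith)
  have := (div_lt_one (by linarith)).2 h2
  linarith

lemma toSphere_real_univ_pos (hn : n ≠ 0) :
    0 < (volume : Measure (Euc n)).toSphere.real Set.univ := by
  have : Nonempty (Fin n) := ⟨⟨0, Nat.pos_of_ne_zero hn⟩⟩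
  rw [Measure.toSphere_real_apply_univ, finrank_euclideanSpace, Fintype.card_fin]
  refine mul_pos (by exact_mod_cast Nat.pos_of_ne_zero hn) ?_
  exact ENNReal.toReal_pos (Metric.measure_ball_pos _ _ one_pos).ne' measure_ball_lt_top.ne

lemma brownYorkMass_eq_zero_iff (hn : 2 ≤ n) : brownYorkMass U f = 0 ↔
    ∫ x in frontier U, (boundaryMeanCurvature (flatMetric n) U x
      - boundaryMeanCurvature (graphMetric f) U x) ∂(μHE[n - 1]) = 0 := by
  have hn' : (2 : ℝ) ≤ n := by exact_mod_cast hn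
  have h1 : 0 < ((n : ℝ) - 1) * (volume : Measure (Euc n)).toSphere.real Set.univ :=
    mul_pos (by linarith) (toSphere_real_univ_pos (by omega))
  rw [brownYorkMass, mul_eq_zero, or_iff_right (one_div_pos.2 h1).ne']

namespace IsAdmissible

/-- The point of a high superlevel set farthest from the origin: it lies on `∂U`, because a
level set through an interior point would be curved the wrong way there. -/
lemma exists_frontier_isMax (hn : 2 ≤ n) (hA : IsAdmissible U Uₒ f) (hF : IsFillIn U Uₒ f F)
    (hO : ∀ᵐ h : ℝ, h ∈ f '' (closure U \ Uₒ) → IsOuterMinimizing {x ∈ closure U | F x < h}) :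
    ∃ y ∈ frontier U, (∀ z ∈ closure U, F z ≤ F y) ∧
      0 < boundaryMeanCurvature (flatMetric n) U y := by
  obtain ⟨z₀, hz₀, hmax⟩ := hA.isCompact_closure.exists_isMaxOn hA.isConnected.nonempty.closure
    hF.2.1
  have hmax : ∀ z ∈ closure U, F z ≤ F z₀ := hmax
  obtain ⟨z₁, hz₁, hlt⟩ : ∃ z ∈ closure U, F z < F z₀ := by
    by_contra! hcon
    refine hA.not_constant ⟨F z₀, fun x hx => ?_⟩
    rw [← hF.1 hx]
    exact le_antisymm (hmax x hx.1) (hcon x hx.1)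
  -- the values on `∂U` below the maximum stay away from the maximum
  obtain ⟨z₂, hz₂, hlt₂, hgap⟩ : ∃ z ∈ closure U, F z < F z₀ ∧
      ∀ x ∈ frontier U, F z < F x → F x = F z₀ := by
    set K := {x ∈ frontier U | F x < F z₀} with hK
    have hFc : ∀ x ∈ frontier U, ∀ᶠ y in 𝓝[frontier U] x, F y = F x := fun x hx => by
      filter_upwards [hA.eventually_eq_frontier hx, self_mem_nhdsWithin] with y hy hy'
      rw [hF.eq (hA.frontier_subset hx), hF.eq (hA.frontier_subset hy'), hy]
    have hKc : IsCompact K := by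
      refine (isCompact_frontier_of_isBounded hA.isBounded).of_isClosed_subset
        (isClosed_of_closure_subset fun x hx => ?_) fun x hx => hx.1
      have hxU : x ∈ frontier U :=
        isClosed_frontier.closure_subset_iff.2 (fun y hy => hy.1) hx
      obtain ⟨y, hy, hyK⟩ := ((eventually_nhdsWithin_iff.1 (hFc x hxU)).and_frequently
        (mem_closure_iff_frequently.1 hx)).exists
      exact ⟨hxU, by rw [← hy hyK.1]; exact hyK.2⟩
    have hgap' : ∀ w ∈ closure U, (∀ x ∈ K, F x ≤ F w) → ∀ x ∈ frontier U, F w < F x →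
        F x = F z₀ := fun w _ hKw x hx hwx =>
      (hmax x hx.1).eq_of_not_lt fun h => absurd (hKw x ⟨hx, h⟩) (not_le.2 hwx)
    rcases K.eq_empty_or_nonempty with hKe | hKne
    · exact ⟨z₁, hz₁, hlt, hgap' z₁ hz₁ (by simp [hKe])⟩
    · obtain ⟨w, hw, hwmax⟩ := hKc.exists_isMaxOn hKne (hF.2.1.mono fun x hx => hx.1.1)
      exact ⟨w, hw.1.1, hw.2, hgap' w hw.1.1 hwmax⟩
  obtain ⟨h, hh, hg, w, hw, hwh, -⟩ := hA.exists_isGoodHeight hF hO subset_rfl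
    hA.isConnected.closure.isPreconnected hz₂ hz₀ hlt₂
  set S := {x ∈ closure U | h ≤ F x} with hS
  have hSc : IsCompact S := by
    refine hA.isCompact_closure.of_isClosed_subset ?_ fun x hx => hx.1
    exact hF.2.1.preimage_isClosed_of_isClosed isClosed_closure isClosed_Ici
  obtain ⟨y, hy, hymax⟩ := hSc.exists_isMaxOn ⟨w, hw, hwh.ge⟩ continuous_norm.continuousOn
  have hymax : ∀ z ∈ S, ‖z‖ ≤ ‖y‖ := hymax
  have hyU : y ∉ U := by
    intro hyU
    have hnear : ∀ᶠ z in 𝓝 y, z ∈ U := hA.isOpen.mem_nhds hyU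
    rcases hy.2.lt_or_eq with hlt' | heq
    · refine not_eventually_norm_le (by omega) y ?_
      have hc : ContinuousAt F y := hF.2.1.continuousAt (Filter.mem_of_superset hnear subset_closure)
      filter_upwards [hnear, hc.eventually_const_lt hlt'] with z hz hz'
      exact hymax z ⟨subset_closure hz, hz'.le⟩
    · have hyo : y ∈ U \ closure Uₒ := ⟨hyU, fun hc => hg.1 ⟨y, hc, heq.symm⟩⟩
      have hy' := hA.diff_subset hyo
      have hfy : f y = h := by rw [← hF.eq hy', heq]
      obtain ⟨h0, hpos⟩ := hg.2.1 y hy' hfy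
      have hcd := hA.contDiffAt (k := 2) hy'
      refine absurd (gradSq_mul_lapl_sub_hessGrad_neg hn hcd h0 ?_)
        (not_lt.2 ((levelMeanCurvature_flat_pos_iff hcd h0).1 hpos).le)
      filter_upwards [hA.isOpen_diff.mem_nhds hyo] with z hz hzn
      have hz' := hA.diff_subset hz
      by_contra! hcon
      refine absurd (hymax z ⟨hz'.1, ?_⟩) (not_le.2 hzn)
      rw [hF.eq hz', ← hfy]
      exact hcon.le
  have hyf : y ∈ frontier U := by rw [hA.isOpen.frontier_eq]; exact ⟨hy.1, hyU⟩
  have hFy : F y = F z₀ := hgap y hyf (hh.1.trans_le hy.2)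
  refine ⟨y, hyf, fun z hz => (hmax z hz).trans_eq hFy.symm, ?_⟩
  obtain ⟨ρ, hρ⟩ := hA.smoothBoundary y hyf
  rw [hρ.boundaryMeanCurvature_flat hyf]
  refine levelMeanCurvature_flat_pos_of_sphere hn (hρ.contDiffAt (k := 2)) hρ.2.1 ?_
  have h1 : ∀ᶠ z in 𝓝[closure U] y, h < F z :=
    (hF.2.1 y hy.1).eventually_const_lt (by rw [hFy]; exact hh.2)
  filter_upwards [hρ.2.2, eventually_nhdsWithin_iff.1 h1] with z hz1 hz2 hzn
  rw [hρ.mem_frontier_iff.1 hyf]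
  by_contra! hneg
  have hzU := subset_closure (hz1.2 hneg)
  exact absurd (hymax z ⟨hzU, (hz2 hzU).le⟩) (not_le.2 hzn)

/-- An interior maximum propagates to all of `U` by the strong maximum principle; it cannot reach
`∂Uₒ`, where `|Df| → ∞`, so `Uₒ` would be empty and `f` constant. -/
lemma not_exists_interior_max (hA : IsAdmissible U Uₒ f) {y : Euc n} {M : ℝ}
    (hle : ∀ z ∈ U \ closure Uₒ, f z ≤ M) (hy : y ∈ U \ closure Uₒ) (hyM : f y = M) : False := by
  set Z := {z ∈ U \ closure Uₒ | f z = M} with hZ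
  have hZo : IsOpen Z := by
    refine isOpen_iff_mem_nhds.2 fun x hx => ?_
    obtain ⟨R, hR, hball⟩ := Metric.isOpen_iff.1 hA.isOpen_diff x hx.1
    have h1 := eq_max_near (f := f) (x := x) (M := M) (R := R) hA.isOpen_diff
      (fun z hz => hA.contDiffAt (k := 2) (hA.diff_subset (hball hz.1)))
      (fun z hz => hA.graphMean_nonneg hz.2) (fun z hz => hle z hz.2)
      (fun z hz hzn => absurd (hball hz.1) hzn) (Or.inr hx.2)
    filter_upwards [Metric.ball_mem_nhds x (half_pos hR), Metric.ball_mem_nhds x hR] with z hz hz'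
    exact ⟨hball hz', h1 z ⟨hz, hball hz'⟩⟩
  have hZd : ∀ z ∈ Z, fderiv ℝ f z = 0 := fun z hz => by
    have : f =ᶠ[𝓝 z] fun _ => M := by
      filter_upwards [hZo.mem_nhds hz] with w hw using hw.2
    rw [this.fderiv_eq, fderiv_fun_const]
    rfl
  have hZc : closure Z ∩ U ⊆ Z := by
    rintro z ⟨hz, hzU⟩
    have hfreq := mem_closure_iff_frequently.1 hz
    by_cases hzo : z ∈ closure Uₒ
    · exfalso
      by_cases hzi : z ∈ Uₒ
      · obtain ⟨w, hw, hw'⟩ := (hfreq.and_eventually (hA.isOpen_inner.mem_nhds hzi)).exists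
        exact hw.1.2 (subset_closure hw')
      · have hzf : z ∈ frontier Uₒ := by rw [hA.isOpen_inner.frontier_eq]; exact ⟨hzo, hzi⟩
        have h1 := (hA.tendsto_inner z hzf).eventually_gt_atTop 0
        obtain ⟨w, hw, hw'⟩ := (hfreq.and_eventually (eventually_nhdsWithin_iff.1 h1)).exists
        have := hw' (hA.diff_subset hw.1)
        rw [hZd w hw, norm_zero] at this
        exact lt_irrefl _ this
    · refine ⟨⟨hzU, hzo⟩, ?_⟩
      have hc := (hA.differentiableAt (hA.diff_subset ⟨hzU, hzo⟩)).continuousAt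
      by_contra hne
      obtain ⟨w, hw, hw'⟩ := (hfreq.and_eventually (hc.eventually_ne hne)).exists
      exact hw' hw.2
  have hUZ : U ⊆ Z := hA.isConnected.isPreconnected.subset_of_closure_inter_subset hZo
    ⟨y, hy.1, hy, hyM⟩ hZc
  have hUo : Uₒ = ∅ := Set.eq_empty_of_forall_notMem fun z hz =>
    (hUZ (hA.closure_inner_subset (subset_closure hz))).1.2 (subset_closure hz)
  refine hA.not_constant ⟨M, fun x hx => ?_⟩
  have hx' : x ∈ closure U \ closure Uₒ := ⟨hx.1, by simp [hUo]⟩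
  have hc := (hA.differentiableAt hx').continuousAt
  by_contra hne
  obtain ⟨w, hw, hw'⟩ := ((mem_closure_iff_frequently.1 hx.1).and_eventually
    (hc.eventually_ne hne)).exists
  exact hw' (hUZ hw).2

/-- If the mass vanished, then `Df = 0` on `∂U` near a point where `H_o > 0` and `f` is maximal, and by
the boundary point lemma `f` would attain its maximum in the interior. -/
theorem brownYorkMass_ne_zero (hn : 2 ≤ n) (hA : IsAdmissible U Uₒ f) :
    brownYorkMass U f ≠ 0 := by
  rw [Ne, brownYorkMass_eq_zero_iff hn,
    setIntegral_congr_fun isClosed_frontier.measurableSet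
      (fun x hx => hA.boundaryMeanCurvature_sub_eq hx (hA.eventually_eq_frontier hx))]
  intro h0
  have hHc := hA.smoothBoundary.continuousOn_boundaryMeanCurvature
  have hG := hA.smoothBoundary.eq_zero_of_integral_eq_zero hA.isBounded
    (G := fun x => boundaryMeanCurvature (flatMetric n) U x * (1 - 1 / √(1 + gradSq f x)))
    (hHc.mul fun x hx => ContinuousAt.continuousWithinAt (by
      have hc := continuousAt_gradSq (hA.contDiffAt (k := 1) (hA.frontier_subset hx))
      exact continuousAt_const.sub (continuousAt_const.div (continuousAt_const.add hc).sqrt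
        (Real.sqrt_pos.2 (one_add_gradSq_pos f x)).ne')))
    (fun x hx => by
      by_cases hd : fderiv ℝ f x = 0
      · simp [gradSq_eq_zero_iff.2 hd]
      · exact mul_nonneg (hA.boundaryMeanCurvature_nonneg hx hd) (one_sub_inv_sqrt_nonneg f x)) h0
  obtain ⟨F, hF, hO⟩ := hA.outerMinimizing
  obtain ⟨y, hy, hmax, hpos⟩ := hA.exists_frontier_isMax hn hF hO
  have hy' := hA.frontier_subset hy
  have hle : ∀ z ∈ closure U \ closure Uₒ, f z ≤ f y := fun z hz => by
    rw [← hF.eq hz, ← hF.eq hy']; exact hmax z hz.1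
  -- the graph is horizontal along `∂U` near `y`
  have h1 : ∀ᶠ z in 𝓝[frontier U] y, f z = f y ∧ fderiv ℝ f z = 0 := by
    filter_upwards [hA.eventually_eq_frontier hy, (hHc y hy).eventually_const_lt hpos,
      self_mem_nhdsWithin] with z hz hzH hzf
    exact ⟨hz, fderiv_eq_zero_of_one_sub_inv_sqrt
      ((mul_eq_zero.1 (hG z hzf)).resolve_left hzH.ne')⟩
  obtain ⟨R, hR, hball⟩ := Metric.eventually_nhds_iff_ball.1 ((eventually_nhdsWithin_iff.1 h1).and
    (isClosed_closure.isOpen_compl.mem_nhds hy'.2))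
  have h2 := eq_max_near (f := f) (x := y) (M := f y) (R := R) hA.isOpen
    (fun z hz => hA.contDiffAt (k := 2) ⟨hz.2, (hball z hz.1).2⟩)
    (fun z hz => hA.graphMean_nonneg ⟨hz.2, (hball z hz.1).2⟩)
    (fun z hz => hle z ⟨subset_closure hz.2, (hball z hz.1).2⟩)
    (fun z hz hzn => (hball z hz.1).1 (by rw [hA.isOpen.frontier_eq]; exact ⟨hz.2, hzn⟩))
    (Or.inl (by rw [hA.isOpen.frontier_eq] at hy; exact hy.2))
  obtain ⟨z, hz, hz1, hz2⟩ := ((mem_closure_iff_frequently.1 hy'.1).and_eventually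
    (Filter.inter_mem (Metric.ball_mem_nhds y (half_pos hR)) (Metric.ball_mem_nhds y hR))).exists
  exact hA.not_exists_interior_max (fun w hw => hle w (hA.diff_subset hw))
    ⟨hz, (hball z hz2).2⟩ (h2 z ⟨hz1, hz⟩)

end IsAdmissible

end Positivity

/-! ### Two embeddings of one Riemannian manifold -/

section Embeddings

open Filter

/-- On a convex set, a `C¹` function has a strict derivative within the set, by the mean value
inequality. -/
lemma _root_.ContDiffWithinAt.hasFDerivAtFilter_prod {E G : Type*} [NormedAddCommGroup E]
    [NormedSpace ℝ E] [NormedAddCommGroup G] [NormedSpace ℝ G] {f : E → G} {s : Set E} {x : E}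
    (hf : ContDiffWithinAt ℝ 1 f s x) (hs : Convex ℝ s) (hx : x ∈ s) (hu : UniqueDiffOn ℝ s) :
    HasFDerivAtFilter f (fderivWithin ℝ f s x) (𝓝[s] x ×ˢ 𝓝[s] x) := by
  rw [show (1 : WithTop ℕ∞) = 0 + 1 from rfl,
    contDiffWithinAt_succ_iff_hasFDerivWithinAt' (by simp)] at hf
  obtain ⟨u, hu', -, -, f', hf', hc⟩ := hf
  rw [Set.insert_eq_of_mem hx] at hu'
  have hxu : x ∈ u := mem_of_mem_nhdsWithin hx hu'
  have hfx : fderivWithin ℝ f s x = f' x := (hf' x hxu).fderivWithin (hu x hx)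
  rw [hfx, hasFDerivAtFilter_iff_isLittleO, Asymptotics.isLittleO_iff]
  intro c hcpos
  have h1 : ∀ᶠ y in 𝓝[s] x, ‖f' y - f' x‖ ≤ c := by
    filter_upwards [hc.continuousWithinAt (Metric.ball_mem_nhds _ hcpos)] with y hy
    rw [← dist_eq_norm]
    exact le_of_lt hy
  obtain ⟨ε, hε, hball⟩ := Metric.mem_nhdsWithin_iff.1 (inter_mem hu' h1)
  have h2 : Metric.ball x ε ∩ s ∈ 𝓝[s] x :=
    inter_mem (mem_nhdsWithin_of_mem_nhds (Metric.ball_mem_nhds x hε)) self_mem_nhdsWithin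
  filter_upwards [prod_mem_prod h2 h2] with p hp
  exact ((convex_ball x ε).inter hs).norm_image_sub_le_of_norm_hasFDerivWithin_le'
    (fun y hy => (hf' y (hball hy).1).mono Set.inter_subset_right)
    (fun y hy => (hball hy).2) hp.2 hp.1

/-- A shortcut, since the general search for this instance is slow. -/
instance {n : ℕ} : ContinuousSMul ℝ (Amb n) := IsBoundedSMul.continuousSMul

variable {n : ℕ} [NeZero n] {Ω : Type*} [TopologicalSpace Ω]
  [ChartedSpace (EuclideanHalfSpace n) Ω]

/-- The derivative of a smooth map into `ℝⁿ⁺¹`, in the coordinates of the preferred chart, is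
strict up to the boundary of the half-space. -/
lemma hasFDerivAtFilter_chart {Φ : Ω → Amb n} (hΦ : ContMDiff (𝓡∂ n) 𝓘(ℝ, Amb n) ∞ Φ) (p : Ω) :
    HasFDerivAtFilter (Φ ∘ (extChartAt (𝓡∂ n) p).symm)
      (mfderiv (𝓡∂ n) 𝓘(ℝ, Amb n) Φ p : Euc n →L[ℝ] Amb n)
      (𝓝[Set.range (𝓡∂ n)] (extChartAt (𝓡∂ n) p p) ×ˢ
        𝓝[Set.range (𝓡∂ n)] (extChartAt (𝓡∂ n) p p)) := by
  have h1 := (contMDiffAt_iff.1 (hΦ.contMDiffAt (x := p))).2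
  have h2 := (hΦ.contMDiffAt (x := p)).mdifferentiableAt (by simp)
  have h3 := (h1.of_le (m := 1) (by exact_mod_cast le_top)).hasFDerivAtFilter_prod
    (𝓡∂ n).convex_range (Set.mem_range_self _) (𝓡∂ n).uniqueDiffOn
  have h4 : (mfderiv (𝓡∂ n) 𝓘(ℝ, Amb n) Φ p : Euc n →L[ℝ] Amb n)
      = fderivWithin ℝ (writtenInExtChartAt (𝓡∂ n) 𝓘(ℝ, Amb n) p Φ) (Set.range (𝓡∂ n))
        (extChartAt (𝓡∂ n) p p) := h2.mfderiv
  rw [h4]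
  exact h3

/-- The transition map between two realizations of `(Ω, g)`, when the second one is the graph of
a constant function: a bijection of the base `Ū` of the latter with the former, which at each
point, up to the boundary, has a strict derivative that is a linear isometry. -/
theorem exists_isometric_transition [IsManifold (𝓡∂ n) ∞ Ω] {g : SmoothMetric n Ω}
    {U V W : Set (Euc n)}
    {f f₂ : Euc n → ℝ} {c : ℝ} (hW : (closure W).Nonempty) (h₁ : IsRealizedBy g U V f)
    (h₂ : IsRealizedBy g W ∅ f₂) (hc : ∀ x ∈ closure W, f₂ x = c) :
    ∃ ψ : Euc n → Amb n, Set.BijOn ψ (closure W) (graphSet U V f) ∧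
      ∀ x ∈ closure W, ∃ L : Euc n →ₗᵢ[ℝ] Amb n,
        HasFDerivAtFilter ψ L.toContinuousLinearMap
          (𝓝[closure W] x ×ˢ 𝓝[closure W] x) := by
  obtain ⟨Φ₁, hΦ₁, hr₁⟩ := h₁
  obtain ⟨Φ₂, hΦ₂, hr₂⟩ := h₂
  set S := closure W with hS
  set q : Euc n → Amb n := fun x => WithLp.toLp 2 (x, c) with hq
  have hqr : ∀ x ∈ S, q x ∈ Set.range Φ₂ := fun x hx => by
    rw [hr₂]
    exact ⟨x, ⟨hx, by simp⟩, by rw [hc x hx]⟩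
  have hΩ : Nonempty Ω := by
    obtain ⟨x, hx⟩ := hW
    obtain ⟨m, -⟩ := hqr x hx
    exact ⟨m⟩
  set p : Euc n → Ω := fun x => Function.invFun Φ₂ (q x) with hp
  have hΦp : ∀ x ∈ S, Φ₂ (p x) = q x := fun x hx => Function.invFun_eq (hqr x hx)
  have hpsurj : ∀ m, ∃ x ∈ S, p x = m := fun m => by
    obtain ⟨x, hx, hm⟩ : Φ₂ m ∈ graphSet W ∅ f₂ := hr₂ ▸ Set.mem_range_self m
    refine ⟨x, hx.1, hΦ₂.isEmbedding.injective ?_⟩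
    rw [hΦp x hx.1, hm, hc x hx.1]
  have hpinj : Set.InjOn p S := fun x hx y hy hxy => by
    have := congrArg Φ₂ hxy
    rw [hΦp x hx, hΦp y hy] at this
    exact congrArg (fun z : Amb n => z.fst) this
  have hqc : Continuous q := by fun_prop
  have hpc : ContinuousOn p S :=
    hΦ₂.isEmbedding.continuousOn_iff.2 (hqc.continuousOn.congr fun x hx => hΦp x hx)
  refine ⟨Φ₁ ∘ p, ⟨fun x _ => ?_, hΦ₁.isEmbedding.injective.comp_injOn hpinj, fun z hz => ?_⟩,
    fun x hx => ?_⟩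
  · rw [← hr₁]; exact Set.mem_range_self _
  · rw [← hr₁] at hz
    obtain ⟨m, rfl⟩ := hz
    obtain ⟨x, hx, rfl⟩ := hpsurj m
    exact ⟨x, hx, rfl⟩
  set I := 𝓡∂ n
  set e := extChartAt I (p x) with he
  set D₁ : Euc n →L[ℝ] Amb n := mfderiv I 𝓘(ℝ, Amb n) Φ₁ (p x) with hD₁
  set D₂ : Euc n →L[ℝ] Amb n := mfderiv I 𝓘(ℝ, Amb n) Φ₂ (p x) with hD₂
  have hd₁ : HasFDerivAtFilter (Φ₁ ∘ e.symm) D₁ _ := hasFDerivAtFilter_chart hΦ₁.smooth (p x)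
  have hd₂ : HasFDerivAtFilter (Φ₂ ∘ e.symm) D₂ _ := hasFDerivAtFilter_chart hΦ₂.smooth (p x)
  have hnorm : ∀ v, ‖D₁ v‖ = ‖D₂ v‖ := fun v => by
    have h1 := hΦ₁.isometric (p x) v v
    have h2 := hΦ₂.isometric (p x) v v
    have h3 : inner ℝ (D₁ v) (D₁ v) = inner ℝ (D₂ v) (D₂ v) := h1.trans h2.symm
    rw [real_inner_self_eq_norm_sq, real_inner_self_eq_norm_sq] at h3
    exact (sq_eq_sq₀ (norm_nonneg _) (norm_nonneg _)).1 h3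
  have hpos : ∀ v, v ≠ 0 → D₂ v ≠ 0 := fun v hv h0 => by
    have h2 : inner ℝ (D₂ v) (D₂ v) = g.inner (p x) v v := hΦ₂.isometric (p x) v v
    have h3 := g.pos (p x) v hv
    rw [← h2, h0, inner_zero_left] at h3
    exact lt_irrefl _ h3
  have hpcx : ContinuousWithinAt p S x := hpc x hx
  -- the last component of the second embedding is constant
  have hsnd : ∀ v, (D₂ v).snd = 0 := by
    have h1 : HasFDerivWithinAt (fun z => (Φ₂ (e.symm z)).snd)
        ((WithLp.sndL 2 ℝ (Euc n) ℝ) ∘L D₂) (Set.range I) (e (p x)) := by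
      have h2 : HasFDerivWithinAt (Φ₂ ∘ e.symm) D₂ (Set.range I) (e (p x)) :=
        hd₂.mono (prod_mono le_rfl (pure_le_nhdsWithin (Set.mem_range_self _)))
      exact (WithLp.sndL 2 ℝ (Euc n) ℝ).hasFDerivAt.comp_hasFDerivWithinAt _ h2
    have h3 : ∀ m, (Φ₂ m).snd = c := fun m => by
      obtain ⟨y, hy, rfl⟩ := hpsurj m
      rw [hΦp y hy]
      rfl
    have h4 : (fun z => (Φ₂ (e.symm z)).snd) = fun _ => c := funext fun z => h3 _
    rw [h4] at h1
    have h5 := (I.uniqueDiffOn _ (Set.mem_range_self _)).eq h1 (hasFDerivWithinAt_const c _ _)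
    exact fun v => congrArg (fun A : Euc n →L[ℝ] ℝ => A v) h5
  set T : Euc n →L[ℝ] Euc n := (WithLp.fstL 2 ℝ (Euc n) ℝ) ∘L D₂ with hT
  have hTn : ∀ v, ‖T v‖ = ‖D₂ v‖ := fun v => by
    have h1 := WithLp.prod_norm_sq_eq_of_L2 (D₂ v)
    rw [hsnd, norm_zero, zero_pow two_ne_zero, add_zero] at h1
    exact ((sq_eq_sq₀ (norm_nonneg _) (norm_nonneg _)).1 h1).symm
  have hTinj : Function.Injective T := by
    refine (injective_iff_map_eq_zero T).2 fun v hv => ?_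
    by_contra hne
    exact hpos v hne (norm_eq_zero.1 (by rw [← hTn, hv, norm_zero]))
  set E := (LinearEquiv.ofInjectiveEndo (T : Euc n →ₗ[ℝ] Euc n) hTinj).toContinuousLinearEquiv
    with hE
  have hET : ∀ v, E v = T v := fun v => rfl
  have hyc : Tendsto (fun a => e (p a)) (𝓝[S] x) (𝓝[Set.range I] (e (p x))) := by
    refine tendsto_nhdsWithin_iff.2 ⟨?_, Eventually.of_forall fun a => Set.mem_range_self _⟩
    exact (continuousAt_extChartAt (I := I) (p x)).tendsto.comp hpcx
  have hsrc : ∀ᶠ a in 𝓝[S] x, e.symm (e (p a)) = p a := by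
    filter_upwards [hpcx (extChartAt_source_mem_nhds (I := I) (p x))] with a ha
    exact e.left_inv ha
  -- the base point of the second graph determines the coordinates of the point of `Ω`
  have hdy : HasFDerivAtFilter (fun a => e (p a)) (E.symm : Euc n →L[ℝ] Euc n)
      (𝓝[S] x ×ˢ 𝓝[S] x) := by
    have h1 : HasFDerivAtFilter (fun z => (Φ₂ (e.symm z)).fst) T
        (𝓝[Set.range I] (e (p x)) ×ˢ 𝓝[Set.range I] (e (p x))) :=
      (WithLp.fstL 2 ℝ (Euc n) ℝ).hasFDerivAtFilter.comp hd₂ tendsto_top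
    have h2 := HasFDerivAtFilter.of_comp_of_leftInverse (h := id)
      (f'symm := (E.symm : Euc n →L[ℝ] Euc n)) (hyc.prodMap hyc) h1
      (hasFDerivAtFilter_id (𝕜 := ℝ) (𝓝[S] x ×ˢ 𝓝[S] x)) ?_
      (fun v => E.symm_apply_apply v)
    · exact h2
    · have : (fun z => (Φ₂ (e.symm z)).fst) ∘ (fun a => e (p a)) =ᶠ[𝓝[S] x] id := by
        filter_upwards [hsrc, self_mem_nhdsWithin] with a ha haS
        simp only [Function.comp_apply, ha, hΦp a haS, hq, id]
        rfl
      exact this.prodMap this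
  have hdψ := hd₁.comp hdy (hyc.prodMap hyc)
  have hLn : ∀ v, ‖(D₁ ∘L (E.symm : Euc n →L[ℝ] Euc n)) v‖ = ‖v‖ := fun v => by
    have : ‖D₁ (E.symm v)‖ = ‖v‖ := by
      rw [hnorm, ← hTn, ← hET, E.apply_symm_apply]
    exact this
  refine ⟨⟨(D₁ ∘L (E.symm : Euc n →L[ℝ] Euc n) : Euc n →L[ℝ] Amb n), hLn⟩, ?_⟩
  refine (HasFDerivAtFilter.congr_of_eventuallyEq hdψ ?_)
  have : (Φ₁ ∘ p) =ᶠ[𝓝[S] x] (Φ₁ ∘ e.symm) ∘ fun a => e (p a) := by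
    filter_upwards [hsrc] with a ha
    simp only [Function.comp_apply, ha]
  exact this.prodMap this

end Embeddings

/-! ### Interior points of the transition map -/

section Transition

open Filter MeasureTheory Measure

variable {n : ℕ}

lemma norm_fst_le (p : Amb n) : ‖p.fst‖ ≤ ‖p‖ := by
  have := WithLp.prod_norm_sq_eq_of_L2 p
  exact le_of_sq_le_sq (by nlinarith [sq_nonneg ‖p.snd‖]) (norm_nonneg _)

/-- A piece of a hypersurface which is a graph cannot touch a vertical hypersurface from one side:
at a point of contact it is vertical, so it contains a curve `t ↦ (z + s(t) w, c + t)`, `s ≥ 0`,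
`s(0) = 0`, which passes twice over the same point, by the intermediate value theorem. -/
lemma not_contact_vertical {ψ : Euc n → Amb n} {f ρ : Euc n → ℝ} {x : Euc n}
    {L : Euc n →ₗᵢ[ℝ] Amb n} (hd : HasStrictFDerivAt ψ L.toContinuousLinearMap x)
    (hc : ∀ᶠ a in 𝓝 x, ContinuousAt ψ a) (hf : ∀ᶠ a in 𝓝 x, (ψ a).snd = f (ψ a).fst)
    (hρ : DifferentiableAt ℝ ρ (ψ x).fst) (h0 : fderiv ℝ ρ (ψ x).fst ≠ 0)
    (hle : ∀ᶠ a in 𝓝 x, ρ (ψ x).fst ≤ ρ (ψ a).fst) : False := by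
  set z := (ψ x).fst with hz
  set D := fderiv ℝ ρ z with hD
  set P₁ := WithLp.fstL 2 ℝ (Euc n) ℝ
  set P₂ := WithLp.sndL 2 ℝ (Euc n) ℝ
  have hfst : HasStrictFDerivAt (fun a => (ψ a).fst) (P₁ ∘L L.toContinuousLinearMap) x :=
    P₁.hasStrictFDerivAt.comp x hd
  have hsnd : HasStrictFDerivAt (fun a => (ψ a).snd) (P₂ ∘L L.toContinuousLinearMap) x :=
    P₂.hasStrictFDerivAt.comp x hd
  have hvert : ∀ v, D (L v).fst = 0 := fun v => by
    have h1 : HasFDerivAt (fun a => ρ (ψ a).fst) (D ∘L (P₁ ∘L L.toContinuousLinearMap)) x :=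
      hρ.hasFDerivAt.comp x hfst.hasFDerivAt
    have h2 : IsLocalMin (fun a => ρ (ψ a).fst) x := hle
    exact congrArg (fun A : Euc n →L[ℝ] ℝ => A v) (h2.hasFDerivAt_eq_zero h1)
  obtain ⟨w₀, hw₀⟩ := exists_pos_fderiv h0
  set w := (D w₀)⁻¹ • w₀ with hw
  have hDw : D w = 1 := by rw [hw, map_smul, smul_eq_mul, inv_mul_cancel₀ hw₀.ne']
  -- project the horizontal part along `w` and put the height in its place
  set β : Euc n → Euc n := fun a => (ψ a).fst - D (ψ a).fst • w + (ψ a).snd • w with hβ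
  set B : Euc n →L[ℝ] Euc n := P₁ ∘L L.toContinuousLinearMap
    - (D ∘L (P₁ ∘L L.toContinuousLinearMap)).smulRight w
    + (P₂ ∘L L.toContinuousLinearMap).smulRight w with hB
  have hdβ : HasStrictFDerivAt β B x :=
    (hfst.sub ((D.hasStrictFDerivAt.comp x hfst).smul_const w)).add (hsnd.smul_const w)
  have hBv : ∀ v, B v = (L v).fst + (L v).snd • w := fun v => by
    have : B v = (L v).fst - D (L v).fst • w + (L v).snd • w := rfl
    rw [this, hvert, zero_smul, sub_zero]
  have hBinj : Function.Injective B := by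
    refine (injective_iff_map_eq_zero B).2 fun v hv => ?_
    rw [hBv] at hv
    have h1 := congrArg D hv
    rw [map_add, map_smul, hvert, hDw, map_zero, zero_add, smul_eq_mul, mul_one] at h1
    rw [h1, zero_smul, add_zero] at hv
    have h2 := WithLp.prod_norm_sq_eq_of_L2 (L v)
    rw [h1, hv, L.norm_map] at h2
    simpa using h2
  set E := (LinearEquiv.ofInjectiveEndo (B : Euc n →ₗ[ℝ] Euc n) hBinj).toContinuousLinearEquiv
    with hE
  have hdE : HasStrictFDerivAt β (E : Euc n →L[ℝ] Euc n) x := hdβ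
  set H := hdE.toOpenPartialHomeomorph β with hH
  have hHx : x ∈ H.source := hdE.mem_toOpenPartialHomeomorph_source
  set γ : ℝ → Euc n := fun t => β x + t • w with hγ
  set α : ℝ → Euc n := fun t => H.symm (γ t) with hα
  have hγ0 : γ 0 = H x := by simp [hγ]; rfl
  have hα0 : α 0 = x := by rw [hα]; simp only [hγ0]; exact H.left_inv hHx
  have hγc : Continuous γ := by fun_prop
  have htgt : ∀ᶠ t in 𝓝 (0 : ℝ), γ t ∈ H.target :=
    hγc.continuousAt.eventually_mem (H.open_target.mem_nhds (by rw [hγ0]; exact H.map_source hHx))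
  have hαc : ∀ t, γ t ∈ H.target → ContinuousAt α t := fun t ht =>
    (H.continuousAt_symm ht).comp hγc.continuousAt
  have hαt : Tendsto α (𝓝 0) (𝓝 x) := by
    have := (hαc 0 htgt.self_of_nhds).tendsto
    rwa [hα0] at this
  set s : ℝ → ℝ := fun t => D (ψ (α t)).fst - D z with hs
  have hcurve : ∀ t, γ t ∈ H.target → (ψ (α t)).snd = (ψ x).snd + t ∧
      (ψ (α t)).fst = z + s t • w := fun t ht => by
    have h1 : β (α t) = γ t := H.right_inv ht
    simp only [hβ, hγ, ← hz] at h1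
    have h2 := congrArg D h1
    simp only [map_add, map_sub, map_smul, hDw, smul_eq_mul, mul_one] at h2
    have h3 : (ψ (α t)).snd = (ψ x).snd + t := by linarith
    refine ⟨h3, ?_⟩
    rw [h3] at h1
    have h4 : (ψ (α t)).fst = (z - D z • w + (ψ x).snd • w + t • w)
        + D (ψ (α t)).fst • w - ((ψ x).snd + t) • w := by
      rw [← h1]; module
    rw [h4, hs]
    module
  have hs0 : s 0 = 0 := by simp only [hs, hα0, ← hz, sub_self]
  have hsign : ∀ᶠ r in 𝓝 (0 : ℝ), r < 0 → ρ (z + r • w) < ρ z := by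
    have h1 : D (-w) < 0 := by rw [map_neg, hDw]; norm_num
    have h2 := eventually_nhdsWithin_iff.1 (eventually_add_smul_lt hρ h1)
    have h3 : Tendsto (fun r : ℝ => -r) (𝓝 0) (𝓝 0) := by simpa using (continuous_neg.tendsto (0 : ℝ))
    filter_upwards [h3.eventually h2] with r hr hr0
    have := hr (Set.mem_Ioi.2 (neg_pos.2 hr0))
    rwa [smul_neg, neg_smul, neg_neg] at this
  have hsc : ∀ t, γ t ∈ H.target → ContinuousAt ψ (α t) → ContinuousAt s t := fun t ht h => by
    have h1 : ContinuousAt (fun t => D (P₁ (ψ (α t))) - D z) t :=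
      ((D.continuous.comp P₁.continuous).continuousAt.comp (h.comp (hαc t ht))).sub
        continuousAt_const
    exact h1
  have hst : Tendsto s (𝓝 0) (𝓝 0) := by
    have := (hsc 0 htgt.self_of_nhds (by rw [hα0]; exact hc.self_of_nhds)).tendsto
    rwa [hs0] at this
  obtain ⟨δ, hδ, hball⟩ := Metric.eventually_nhds_iff_ball.1 (htgt.and ((hαt.eventually hc).and
    ((hαt.eventually hf).and ((hαt.eventually hle).and (hst.eventually hsign)))))
  have hmem : ∀ t, |t| ≤ δ / 2 → t ∈ Metric.ball (0 : ℝ) δ := fun t ht => by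
    rw [mem_ball_zero_iff, Real.norm_eq_abs]; linarith
  have hnn : ∀ t, |t| ≤ δ / 2 → 0 ≤ s t := fun t ht => by
    obtain ⟨h1, -, -, h4, h5⟩ := hball t (hmem t ht)
    by_contra! hneg
    rw [(hcurve t h1).2] at h4
    exact absurd (h5 hneg) (not_lt.2 h4)
  have hinj : ∀ t t', |t| ≤ δ / 2 → |t'| ≤ δ / 2 → s t = s t' → t = t' := fun t t' ht ht' h => by
    obtain ⟨h1, -, h3, -⟩ := hball t (hmem t ht)
    obtain ⟨h1', -, h3', -⟩ := hball t' (hmem t' ht')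
    rw [(hcurve t h1).1, (hcurve t h1).2, h] at h3
    rw [(hcurve t' h1').1, (hcurve t' h1').2] at h3'
    linarith
  have hsco : ContinuousOn s (Set.Icc (-(δ / 2)) (δ / 2)) := fun t ht => by
    obtain ⟨h1, h2, -⟩ := hball t (hmem t (abs_le.2 ht))
    exact (hsc t h1 h2).continuousWithinAt
  have hpos : ∀ t, |t| ≤ δ / 2 → t ≠ 0 → 0 < s t := fun t ht hne =>
    (hnn t ht).lt_of_ne fun h => hne (hinj t 0 ht (by simp; linarith) (by rw [← h, hs0]))
  have hd1 : |δ / 2| ≤ δ / 2 := by rw [abs_of_pos (by linarith)]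
  have hd2 : |-(δ / 2)| ≤ δ / 2 := by rw [abs_neg]; exact hd1
  have hm1 := hpos (δ / 2) hd1 (by linarith)
  have hm2 := hpos (-(δ / 2)) hd2 (by linarith)
  set m := min (s (δ / 2)) (s (-(δ / 2))) with hm
  have hmpos : 0 < m := lt_min hm1 hm2
  obtain ⟨t₁, ht₁, hst₁⟩ := intermediate_value_Icc (by linarith : (0 : ℝ) ≤ δ / 2)
    (hsco.mono (Set.Icc_subset_Icc_left (by linarith)))
    (show m ∈ Set.Icc (s 0) (s (δ / 2)) from ⟨by rw [hs0]; exact hmpos.le, min_le_left _ _⟩)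
  obtain ⟨t₂, ht₂, hst₂⟩ := intermediate_value_Icc' (by linarith : -(δ / 2) ≤ (0 : ℝ))
    (hsco.mono (Set.Icc_subset_Icc_right (by linarith)))
    (show m ∈ Set.Icc (s 0) (s (-(δ / 2))) from ⟨by rw [hs0]; exact hmpos.le, min_le_right _ _⟩)
  have h12 := hinj t₁ t₂ (abs_le.2 ⟨by linarith [ht₁.1], ht₁.2⟩)
    (abs_le.2 ⟨ht₂.1, by linarith [ht₂.2]⟩) (hst₁.trans hst₂.symm)
  have h1 : t₁ = 0 := le_antisymm (h12 ▸ ht₂.2) ht₁.1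
  rw [h1, hs0] at hst₁
  exact hmpos.ne hst₁

/-- A map which is locally Lipschitz with a uniform constant distorts area as if it were Lipschitz
with this constant: the set is divided into countably many pieces on which it is. -/
lemma euclideanHausdorffMeasure_image_le_of_nhdsWithin {θ : Euc n → Euc n} {s : Set (Euc n)}
    (hs : MeasurableSet s) {C : ℝ≥0} (h : ∀ x ∈ s, ∃ u ∈ 𝓝[s] x, LipschitzOnWith C θ u) (d : ℕ) :
    (μHE[d] : Measure (Euc n)) (θ '' s) ≤ (C : ℝ≥0∞) ^ d * (μHE[d] : Measure (Euc n)) s := by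
  rcases s.eq_empty_or_nonempty with rfl | hne
  · simp
  have h' : ∀ x, ∃ O : Set (Euc n), IsOpen O ∧ (x ∈ s → x ∈ O ∧ LipschitzOnWith C θ (O ∩ s)) :=
    fun x => by
      by_cases hx : x ∈ s
      · obtain ⟨u, hu, hL⟩ := h x hx
        obtain ⟨O, hO, hxO, hOu⟩ := mem_nhdsWithin.1 hu
        exact ⟨O, hO, fun _ => ⟨hxO, hL.mono hOu⟩⟩
      · exact ⟨∅, isOpen_empty, fun hx' => absurd hx' hx⟩
  choose O hO hOx using h'
  obtain ⟨t, hts, htc, hst⟩ := TopologicalSpace.countable_cover_nhdsWithin (f := O) (s := s)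
    fun x hx => mem_nhdsWithin_of_mem_nhds ((hO x).mem_nhds (hOx x hx).1)
  have htne : t.Nonempty := by
    obtain ⟨x, hx⟩ := hne
    obtain ⟨y, hy, -⟩ := Set.mem_iUnion₂.1 (hst hx)
    exact ⟨y, hy⟩
  obtain ⟨φ, hφ⟩ := htc.exists_eq_range htne
  set A : ℕ → Set (Euc n) := fun k => O (φ k) ∩ s with hA
  have hAm : ∀ k, MeasurableSet (disjointed A k) :=
    MeasurableSet.disjointed fun k => (hO _).measurableSet.inter hs
  have hAU : ⋃ k, disjointed A k = s := by
    rw [iUnion_disjointed]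
    refine Set.Subset.antisymm (Set.iUnion_subset fun k => Set.inter_subset_right) fun x hx => ?_
    obtain ⟨y, hy, hxy⟩ := Set.mem_iUnion₂.1 (hst hx)
    rw [hφ] at hy
    obtain ⟨k, rfl⟩ := hy
    exact Set.mem_iUnion.2 ⟨k, hxy, hx⟩
  have hL : ∀ k, LipschitzOnWith C θ (disjointed A k) := fun k =>
    (hOx (φ k) (hts (hφ ▸ Set.mem_range_self k))).2.mono (disjointed_subset A k)
  calc (μHE[d] : Measure (Euc n)) (θ '' s)
      = (μHE[d] : Measure (Euc n)) (⋃ k, θ '' disjointed A k) := by rw [← Set.image_iUnion, hAU]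
    _ ≤ ∑' k, (μHE[d] : Measure (Euc n)) (θ '' disjointed A k) := measure_iUnion_le _
    _ ≤ ∑' k, (C : ℝ≥0∞) ^ d * (μHE[d] : Measure (Euc n)) (disjointed A k) :=
        ENNReal.tsum_le_tsum fun k => (hL k).euclideanHausdorffMeasure_image_le d
    _ = (C : ℝ≥0∞) ^ d * (μHE[d] : Measure (Euc n)) s := by
        rw [ENNReal.tsum_mul_left, ← measure_iUnion (disjoint_disjointed A) hAm, hAU]

/-- `ψ` maps `Ū` bijectively to the graph of `f` over `Ū \ Uₒ` and has at each point of `Ū`, up to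
the boundary, a strict derivative which is a linear isometry. -/
structure IsIsometricTransition (U Uₒ : Set (Euc n)) (f : Euc n → ℝ) (ψ : Euc n → Amb n) :
    Prop where
  bijOn : Set.BijOn ψ (closure U) (graphSet U Uₒ f)
  deriv : ∀ x ∈ closure U, ∃ L : Euc n →ₗᵢ[ℝ] Amb n,
    HasFDerivAtFilter ψ L.toContinuousLinearMap (𝓝[closure U] x ×ˢ 𝓝[closure U] x)

namespace IsIsometricTransition

variable {U Uₒ : Set (Euc n)} {f : Euc n → ℝ} {ψ : Euc n → Amb n} {x : Euc n}

lemma fst_mem (h : IsIsometricTransition U Uₒ f ψ) (hx : x ∈ closure U) :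
    (ψ x).fst ∈ closure U \ Uₒ := by
  obtain ⟨z, hz, hψ⟩ := h.bijOn.mapsTo hx
  rw [hψ]
  exact hz

lemma snd_eq (h : IsIsometricTransition U Uₒ f ψ) (hx : x ∈ closure U) :
    (ψ x).snd = f (ψ x).fst := by
  obtain ⟨z, hz, hψ⟩ := h.bijOn.mapsTo hx
  rw [hψ]
  rfl

lemma injOn (h : IsIsometricTransition U Uₒ f ψ) :
    Set.InjOn (fun a => (ψ a).fst) (closure U) := fun x hx y hy hxy => by
  obtain ⟨z, hz, hψ⟩ := h.bijOn.mapsTo hx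
  obtain ⟨z', hz', hψ'⟩ := h.bijOn.mapsTo hy
  refine h.bijOn.injOn hx hy ?_
  simp only [hψ, hψ'] at hxy
  have hzz : z = z' := hxy
  rw [hψ, hψ', hzz]

lemma exists_fst_eq (h : IsIsometricTransition U Uₒ f ψ) {z : Euc n} (hz : z ∈ closure U \ Uₒ) :
    ∃ x ∈ closure U, (ψ x).fst = z := by
  obtain ⟨x, hx, hψ⟩ := h.bijOn.surjOn (show WithLp.toLp 2 (z, f z) ∈ graphSet U Uₒ f from
    ⟨z, hz, rfl⟩)
  exact ⟨x, hx, by rw [hψ]; rfl⟩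

lemma hasStrictFDerivAt (h : IsIsometricTransition U Uₒ f ψ) (hU : IsOpen U) (hx : x ∈ U) :
    ∃ L : Euc n →ₗᵢ[ℝ] Amb n, HasStrictFDerivAt ψ L.toContinuousLinearMap x := by
  obtain ⟨L, hL⟩ := h.deriv x (subset_closure hx)
  refine ⟨L, ?_⟩
  rw [nhdsWithin_eq_nhds.2 (mem_of_superset (hU.mem_nhds hx) subset_closure), ← nhds_prod_eq] at hL
  exact hL

lemma exists_lipschitzOnWith (h : IsIsometricTransition U Uₒ f ψ) {C : ℝ≥0} (hC : 1 < C)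
    (hx : x ∈ closure U) :
    ∃ u ∈ 𝓝[closure U] x, LipschitzOnWith C (fun a => (ψ a).fst) u := by
  obtain ⟨L, hL⟩ := h.deriv x hx
  have hC' : (0 : ℝ) < C - 1 := sub_pos.2 (by exact_mod_cast hC)
  obtain ⟨u, hu, hu'⟩ := (eventually_prod_self_iff
    (r := fun a b => ‖ψ a - ψ b - L (a - b)‖ ≤ (C - 1) * ‖a - b‖)).1 (hL.isLittleO.def hC')
  refine ⟨u, hu, LipschitzOnWith.of_dist_le_mul fun a ha b hb => ?_⟩
  have h1 := hu' a ha b hb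
  have h2 := norm_sub_norm_le (ψ a - ψ b) (L (a - b))
  rw [L.norm_map] at h2
  have h3 := norm_fst_le (ψ a - ψ b)
  rw [WithLp.sub_fst] at h3
  rw [dist_eq_norm, dist_eq_norm]
  linarith

lemma not_contact (h : IsIsometricTransition U Uₒ f ψ) (hU : IsOpen U) (hx : x ∈ U)
    {ρ : Euc n → ℝ} (hρ : DifferentiableAt ℝ ρ (ψ x).fst) (h0 : fderiv ℝ ρ (ψ x).fst ≠ 0)
    (hle : ∀ᶠ z in 𝓝 (ψ x).fst, z ∈ closure U \ Uₒ → ρ (ψ x).fst ≤ ρ z) : False := by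
  obtain ⟨L, hL⟩ := h.hasStrictFDerivAt hU hx
  have hnear : ∀ᶠ a in 𝓝 x, a ∈ U := hU.mem_nhds hx
  have hfst : Tendsto (fun a => (ψ a).fst) (𝓝 x) (𝓝 (ψ x).fst) :=
    ((WithLp.fstL 2 ℝ (Euc n) ℝ).continuous.tendsto (ψ x)).comp hL.continuousAt.tendsto
  have h1 : ∀ᶠ a in 𝓝 x, ContinuousAt ψ a := hnear.mono fun a ha => by
    obtain ⟨L', hL'⟩ := h.hasStrictFDerivAt hU ha
    exact hL'.continuousAt
  have h2 : ∀ᶠ a in 𝓝 x, (ψ a).snd = f (ψ a).fst :=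
    hnear.mono fun a ha => h.snd_eq (subset_closure ha)
  have h3 : ∀ᶠ a in 𝓝 x, ρ (ψ x).fst ≤ ρ (ψ a).fst :=
    (hnear.and (hfst.eventually hle)).mono fun a ha => ha.2 (h.fst_mem (subset_closure ha.1))
  exact not_contact_vertical hL h1 h2 hρ h0 h3

/-- Every point over `∂U ∪ ∂Uₒ` comes from the boundary of `U`, since at an interior point the graph
would touch the cylinder over `∂U` or `∂Uₒ` from one side. -/
lemma frontier_union_subset_image (h : IsIsometricTransition U Uₒ f ψ)
    (hf : IsCompactGraph U Uₒ f) :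
    frontier U ∪ frontier Uₒ ⊆ (fun a => (ψ a).fst) '' frontier U := by
  intro z hz
  have hzU : z ∈ closure U \ Uₒ := by
    rcases hz with hz | hz
    · have := hf.frontier_subset hz
      exact ⟨this.1, fun hc => this.2 (subset_closure hc)⟩
    · exact hf.frontier_inner_subset hz
  obtain ⟨x, hx, rfl⟩ := h.exists_fst_eq hzU
  refine ⟨x, ?_, rfl⟩
  rw [hf.isOpen.frontier_eq]
  refine ⟨hx, fun hxU => ?_⟩
  rcases hz with hz | hz
  · obtain ⟨ρ, hρ⟩ := hf.smoothBoundary _ hz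
    refine h.not_contact hf.isOpen hxU (ρ := fun z => -ρ z) hρ.differentiableAt.neg
      (by rw [fderiv_fun_neg]; exact neg_ne_zero.2 hρ.2.1) ?_
    filter_upwards [hρ.eventually] with z hz1 hz2
    rw [hρ.mem_frontier_iff.1 hz]
    exact neg_le_neg (hz1.mem_closure_iff.1 hz2.1)
  · obtain ⟨ρ, hρ⟩ := hf.smoothBoundary_inner _ hz
    refine h.not_contact hf.isOpen hxU hρ.differentiableAt hρ.2.1 ?_
    filter_upwards [hρ.2.2] with z hz1 hz2
    rw [hρ.mem_frontier_iff.1 hz]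
    by_contra! hneg
    exact hz2.2 (hz1.2 hneg)

lemma measure_image_le (h : IsIsometricTransition U Uₒ f ψ) {C : ℝ≥0} (hC : 1 < C) (d : ℕ) :
    (μHE[d] : Measure (Euc n)) ((fun a => (ψ a).fst) '' frontier U)
      ≤ (C : ℝ≥0∞) ^ d * (μHE[d] : Measure (Euc n)) (frontier U) :=
  euclideanHausdorffMeasure_image_le_of_nhdsWithin isClosed_frontier.measurableSet (fun x hx => by
    obtain ⟨u, hu, hL⟩ := h.exists_lipschitzOnWith hC (frontier_subset_closure hx)
    exact ⟨u, nhdsWithin_mono x frontier_subset_closure hu, hL⟩) d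

/-- The areas of `∂U` and `∂Uₒ` add up to at most `C ^ (n - 1)` times the area of `∂U`, for every
`C > 1`; so there is no inner boundary. -/
lemma inner_eq_empty (hn : n ≠ 0) (h : IsIsometricTransition U Uₒ f ψ)
    (hf : IsCompactGraph U Uₒ f) : Uₒ = ∅ := by
  set a := (μHE[n - 1] : Measure (Euc n)) (frontier U)
  set b := (μHE[n - 1] : Measure (Euc n)) (frontier Uₒ)
  have ha : a ≠ ⊤ := (hf.smoothBoundary.measure_frontier_lt_top hf.isBounded).ne
  have hdisj : Disjoint (frontier U) (frontier Uₒ) := by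
    rw [Set.disjoint_left]
    intro z hz hz'
    exact (hf.frontier_subset hz).2 (frontier_subset_closure hz')
  have hle : ∀ C : ℝ≥0, 1 < C → a + b ≤ (C : ℝ≥0∞) ^ (n - 1) * a := fun C hC => by
    refine le_trans ?_ (h.measure_image_le hC (n - 1))
    rw [← measure_union hdisj isClosed_frontier.measurableSet]
    exact measure_mono (h.frontier_union_subset_image hf)
  have hlim : a + b ≤ a := by
    have h1 : Tendsto (fun C : ℝ≥0 => (C : ℝ≥0∞) ^ (n - 1) * a) (𝓝[>] 1) (𝓝 (1 * a)) := by
      refine ENNReal.Tendsto.mul_const ?_ (Or.inr ha)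
      have h2 := ((ENNReal.continuous_pow (n - 1)).comp ENNReal.continuous_coe).tendsto (1 : ℝ≥0)
      simp only [Function.comp_def, ENNReal.coe_one, one_pow] at h2
      exact h2.mono_left nhdsWithin_le_nhds
    rw [one_mul] at h1
    exact ge_of_tendsto h1 (by filter_upwards [self_mem_nhdsWithin] with C hC using hle C hC)
  have hb : b = 0 := by
    have h1 : a + b ≤ a + 0 := by rwa [add_zero]
    exact nonpos_iff_eq_zero.1 ((ENNReal.add_le_add_iff_left ha).1 h1)
  by_contra hne
  have hne' : Uₒ.Nonempty := Set.nonempty_iff_ne_empty.2 hne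
  have : Nonempty (Fin n) := ⟨⟨0, Nat.pos_of_ne_zero hn⟩⟩
  have huniv : Uₒ ≠ Set.univ := fun hu => by
    have h1 : Bornology.IsBounded (Set.univ : Set (Euc n)) :=
      hf.isBounded.subset (hu ▸ subset_closure.trans hf.closure_inner_subset)
    exact NormedSpace.unbounded_univ ℝ (Euc n) h1
  obtain ⟨z, hz⟩ := nonempty_frontier_iff.2 ⟨hne', huniv⟩
  obtain ⟨ρ, hρ⟩ := hf.smoothBoundary_inner z hz
  have h1 := hρ.measure_pos hz univ_mem
  rw [Set.inter_univ] at h1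
  exact h1.ne' hb

end IsIsometricTransition

end Transition

/-! ### Graphs isometric to a flat domain -/

section Flat

open Filter MeasureTheory Measure

variable {n : ℕ} {U Uₒ : Set (Euc n)} {f : Euc n → ℝ} {ψ : Euc n → Amb n} {x : Euc n}

/-- The horizontal part of an isometry onto the tangent space of the graph of `f` at `z` scales
volume by the inverse of `√(1 + |Df(z)|²)`. -/
lemma det_fst_sq_mul {z : Euc n} (L : Euc n →ₗᵢ[ℝ] Amb n)
    (h : ∀ v, (L v).snd = fderiv ℝ f z (L v).fst) :
    (((WithLp.fstL 2 ℝ (Euc n) ℝ) ∘L L.toContinuousLinearMap : Euc n →L[ℝ] Euc n).det) ^ 2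
      * (1 + gradSq f z) = 1 := by
  set M : Euc n →L[ℝ] Euc n := (WithLp.fstL 2 ℝ (Euc n) ℝ) ∘L L.toContinuousLinearMap with hM
  set b := (EuclideanSpace.basisFun (Fin n) ℝ).toBasis with hb
  set A := LinearMap.toMatrix b b (M : Euc n →ₗ[ℝ] Euc n) with hA
  have hAe : ∀ k i, A k i = (L (EuclideanSpace.single i 1)).fst k := fun k i => by
    rw [hA, LinearMap.toMatrix_apply]
    simp [hb, hM]
  have hq : ∀ i, (L (EuclideanSpace.single i 1)).snd = ∑ k, A k i * pderiv k f z := fun i => by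
    rw [h, fderiv_apply_eq_sum]
    simp only [hAe]
  have hmat : A.transpose * graphMetric f z * A = 1 := by
    ext i j
    have h1 := L.inner_map_map (EuclideanSpace.single i (1 : ℝ)) (EuclideanSpace.single j 1)
    rw [WithLp.prod_inner_apply, EuclideanSpace.inner_single_left] at h1
    have h2 : inner ℝ (L (EuclideanSpace.single i 1)).fst (L (EuclideanSpace.single j 1)).fst
        = ∑ k, A k i * A k j := by
      rw [PiLp.inner_apply]
      simp only [hAe]
      exact Finset.sum_congr rfl fun k _ => by simp [mul_comm]
    have h3 : inner ℝ (L (EuclideanSpace.single i 1)).snd (L (EuclideanSpace.single j 1)).snd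
        = (∑ k, A k i * pderiv k f z) * ∑ l, A l j * pderiv l f z := by
      rw [hq, hq]
      exact mul_comm _ _
    have h4 : (A.transpose * graphMetric f z * A) i j = ∑ k, A k i * A k j
        + (∑ k, A k i * pderiv k f z) * ∑ l, A l j * pderiv l f z := by
      simp only [Matrix.mul_apply, Matrix.transpose_apply, graphMetric_apply, mul_add, mul_ite,
        mul_one, mul_zero, Finset.sum_add_distrib, add_mul, Finset.sum_ite_eq', Finset.mem_univ,
        if_true]
      congr 1
      rw [Finset.mul_sum]
      refine Finset.sum_congr rfl fun l _ => ?_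
      simp only [Finset.sum_mul]
      exact Finset.sum_congr rfl fun k _ => by ring
    rw [h4, ← h2, ← h3]
    refine h1.trans ?_
    simp [Matrix.one_apply]
  have hdet := congrArg Matrix.det hmat
  rw [Matrix.det_mul, Matrix.det_mul, Matrix.det_transpose, det_graphMetric, Matrix.det_one] at hdet
  have hAd : A.det = M.det := LinearMap.det_toMatrix b _
  rw [← hAd]
  linarith

lemma HasSmoothBoundary.volume_frontier_eq_zero (hn : n ≠ 0) {V : Set (Euc n)}
    (hV : HasSmoothBoundary V) (hb : Bornology.IsBounded V) :
    (μHE[n] : Measure (Euc n)) (frontier V) = 0 :=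
  (euclideanHausdorffMeasure_zero_or_top (Nat.sub_one_lt hn) (frontier V)).resolve_right
    (hV.measure_frontier_lt_top hb).ne

namespace IsIsometricTransition

lemma continuousWithinAt (h : IsIsometricTransition U Uₒ f ψ) (hx : x ∈ closure U) :
    ContinuousWithinAt ψ (closure U) x := by
  obtain ⟨L, hL⟩ := h.deriv x hx
  have h1 : HasFDerivWithinAt ψ L.toContinuousLinearMap (closure U) x :=
    hL.mono (prod_mono le_rfl (pure_le_nhdsWithin hx))
  exact h1.continuousWithinAt

/-- The image of the interior has full measure in `Ū`. -/
lemma volume_le (hn : n ≠ 0) (h : IsIsometricTransition U ∅ f ψ) (hf : IsCompactGraph U ∅ f) :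
    volume U ≤ volume ((fun a => (ψ a).fst) '' U) := by
  have h0 : (μHE[n] : Measure (Euc n)) ((fun a => (ψ a).fst) '' frontier U) = 0 := by
    have h1 := h.measure_image_le (C := 2) (by norm_num) n
    rw [hf.smoothBoundary.volume_frontier_eq_zero hn hf.isBounded, mul_zero] at h1
    exact nonpos_iff_eq_zero.1 h1
  rw [EuclideanSpace.euclideanHausdorffMeasure_eq_volume] at h0
  have hsub : U ⊆ ((fun a => (ψ a).fst) '' U) ∪ ((fun a => (ψ a).fst) '' frontier U) := by
    intro z hz
    obtain ⟨x, hx, hxz⟩ := h.exists_fst_eq (z := z) ⟨subset_closure hz, by simp⟩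
    by_cases hxU : x ∈ U
    · exact Or.inl ⟨x, hxU, hxz⟩
    · exact Or.inr ⟨x, by rw [hf.isOpen.frontier_eq]; exact ⟨hx, hxU⟩, hxz⟩
  refine (measure_mono hsub).trans ((measure_union_le _ _).trans_eq ?_)
  rw [h0, add_zero]

/-- A compact graph which is isometric to a flat domain with the same outer boundary is
horizontal: there is no inner boundary, and comparison of volumes forces `Df = 0`. -/
theorem exists_eq_const (hn : n ≠ 0) (h : IsIsometricTransition U Uₒ f ψ)
    (hf : IsCompactGraph U Uₒ f) : ∃ c, ∀ x ∈ closure U \ Uₒ, f x = c := by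
  obtain rfl := h.inner_eq_empty hn hf
  have hmem : ∀ x ∈ U, (ψ x).fst ∈ closure U \ closure (∅ : Set (Euc n)) := fun x hx =>
    ⟨(h.fst_mem (subset_closure hx)).1, by simp⟩
  have hex : ∀ x, ∃ L : Euc n →ₗᵢ[ℝ] Amb n,
      x ∈ U → HasStrictFDerivAt ψ L.toContinuousLinearMap x := fun x => by
    by_cases hx : x ∈ U
    · obtain ⟨L, hL⟩ := h.hasStrictFDerivAt hf.isOpen hx
      exact ⟨L, fun _ => hL⟩
    · obtain ⟨y, hy⟩ := hf.isConnected.nonempty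
      obtain ⟨L, -⟩ := h.hasStrictFDerivAt hf.isOpen hy
      exact ⟨L, fun hx' => absurd hx' hx⟩
  choose L hL using hex
  set M : Euc n → Euc n →L[ℝ] Euc n := fun x =>
    (WithLp.fstL 2 ℝ (Euc n) ℝ) ∘L (L x).toContinuousLinearMap
  have hfst : ∀ x ∈ U, HasFDerivAt (fun a => (ψ a).fst) (M x) x := fun x hx =>
    (WithLp.fstL 2 ℝ (Euc n) ℝ).hasFDerivAt.comp x (hL x hx).hasFDerivAt
  have hsnd : ∀ x ∈ U, HasFDerivAt (fun a => (ψ a).snd)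
      ((WithLp.sndL 2 ℝ (Euc n) ℝ) ∘L (L x).toContinuousLinearMap) x := fun x hx =>
    (WithLp.sndL 2 ℝ (Euc n) ℝ).hasFDerivAt.comp x (hL x hx).hasFDerivAt
  have htan : ∀ x ∈ U, ∀ v, (L x v).snd = fderiv ℝ f (ψ x).fst (L x v).fst := fun x hx v => by
    have h1 : HasFDerivAt (fun a => f (ψ a).fst) ((fderiv ℝ f (ψ x).fst) ∘L M x) x :=
      (hf.differentiableAt (hmem x hx)).hasFDerivAt.comp x (hfst x hx)
    have h2 : (fun a => (ψ a).snd) =ᶠ[𝓝 x] fun a => f (ψ a).fst :=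
      Filter.Eventually.mono (hf.isOpen.mem_nhds hx) fun a ha => h.snd_eq (subset_closure ha)
    have h3 := (hsnd x hx).unique (h1.congr_of_eventuallyEq h2)
    exact congrArg (fun A : Euc n →L[ℝ] ℝ => A v) h3
  have hdet : ∀ x ∈ U, (M x).det ^ 2 * (1 + gradSq f (ψ x).fst) = 1 := fun x hx =>
    det_fst_sq_mul (L x) (htan x hx)
  have hdet1 : ∀ x ∈ U, |(M x).det| ≤ 1 := fun x hx => by
    rw [← sq_le_one_iff_abs_le_one]
    nlinarith [hdet x hx, gradSq_nonneg f (ψ x).fst, sq_nonneg (M x).det]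
  have hUm := hf.isOpen.measurableSet
  have hint : ∫⁻ x in U, ENNReal.ofReal |(M x).det| = volume ((fun a => (ψ a).fst) '' U) :=
    lintegral_abs_det_fderiv_eq_addHaar_image volume hUm
      (fun x hx => (hfst x hx).hasFDerivWithinAt) (h.injOn.mono subset_closure)
  have hle : (fun x => ENNReal.ofReal |(M x).det|) ≤ᵐ[volume.restrict U] fun _ => 1 := by
    rw [EventuallyLE, ae_restrict_iff' hUm]
    exact Eventually.of_forall fun x hx => ENNReal.ofReal_le_one.2 (hdet1 x hx)
  have hfin : volume U ≠ ⊤ := hf.isBounded.measure_lt_top.ne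
  have hone : ∫⁻ _ in U, (1 : ℝ≥0∞) = volume U := by simp
  have hae := ae_eq_of_ae_le_of_lintegral_le hle
    (((lintegral_mono_ae hle).trans_eq hone).trans_lt hfin.lt_top).ne aemeasurable_const
    (by rw [hone, hint]; exact h.volume_le hn hf)
  have hgrad : Set.EqOn (fun x => gradSq f (ψ x).fst) (fun _ => 0) U := by
    refine eqOn_open_of_ae_eq (μ := volume) ?_ hf.isOpen (fun x hx => ?_) continuousOn_const
    · rw [EventuallyEq, ae_restrict_iff' hUm] at hae ⊢
      filter_upwards [hae] with x hx hxU
      have h1 : |(M x).det| = 1 := by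
        have := hx hxU
        rwa [ENNReal.ofReal_eq_one] at this
      have h2 := hdet x hxU
      rw [← sq_abs, h1] at h2
      linarith
    · exact ((continuousAt_gradSq (hf.contDiffAt (k := 1) (hmem x hx))).comp_of_eq
        (hfst x hx).continuousAt rfl).continuousWithinAt
  obtain ⟨c, hc⟩ := hf.isOpen.exists_is_const_of_fderiv_eq_zero (𝕜 := ℝ)
    (f := fun a => (ψ a).snd) hf.isConnected.isPreconnected
    (fun x hx => (hsnd x hx).differentiableAt.differentiableWithinAt) (fun x hx => by
      rw [(hsnd x hx).fderiv]
      ext v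
      have : (L x v).snd = 0 := by
        rw [htan x hx, gradSq_eq_zero_iff.1 (hgrad hx)]
        rfl
      exact this)
  refine ⟨c, fun z hz => ?_⟩
  obtain ⟨x, hx, rfl⟩ := h.exists_fst_eq hz
  rw [← h.snd_eq hx]
  have hcont : ContinuousWithinAt (fun a => (ψ a).snd) (closure U) x :=
    (WithLp.sndL 2 ℝ (Euc n) ℝ).continuous.continuousAt.comp_continuousWithinAt
      (h.continuousWithinAt hx)
  by_contra hne
  obtain ⟨y, hy, hy'⟩ := ((mem_closure_iff_frequently.1 hx).and_eventually
    (eventually_nhdsWithin_iff.1 (hcont.eventually_ne hne))).exists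
  exact hy' (subset_closure hy) (hc y hy)

end IsIsometricTransition

lemma IsConstantGraph.brownYorkMass_eq_zero (hn : 2 ≤ n) (h : IsConstantGraph U f) :
    brownYorkMass U f = 0 := by
  obtain ⟨c, hc⟩ := h.constant
  rw [brownYorkMass_eq_zero_iff hn]
  refine (setIntegral_congr_fun isClosed_frontier.measurableSet fun x hx => ?_).trans
    (integral_zero (Euc n) ℝ)
  have hx' := h.frontier_subset hx
  have hgrad : gradSq f x = 0 := by
    have hcont := continuousAt_gradSq (h.contDiffAt (k := 1) hx')
    by_contra hne
    obtain ⟨y, hy, hy'⟩ := ((mem_closure_iff_frequently.1 hx'.1).and_eventually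
      (hcont.eventually_ne hne)).exists
    refine hy' (gradSq_eq_zero_iff.2 ?_)
    have : f =ᶠ[𝓝 y] fun _ => c :=
      Filter.Eventually.mono (h.isOpen.mem_nhds hy) fun z hz => hc z (subset_closure hz)
    rw [this.fderiv_eq, fderiv_fun_const]
    rfl
  have hfr : ∀ᶠ y in 𝓝[frontier U] x, f y = f x :=
    eventually_nhdsWithin_of_forall fun y hy => by rw [hc y hy.1, hc x hx.1]
  simp only [h.boundaryMeanCurvature_sub_eq hx hfr, hgrad]
  simp

end Flat

end BYGraph

open scoped Manifold ContDiff in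
theorem mainTheorem9 {n : ℕ} [NeZero n] (hn : 2 ≤ n)
    {Ω : Type*} [TopologicalSpace Ω] [CompactSpace Ω]
    [ChartedSpace (EuclideanHalfSpace n) Ω] [IsManifold (𝓡∂ n) ∞ Ω]
    (g : BYGraph.SmoothMetric n Ω)
    (U Uₒ : Set (BYGraph.Euc n)) (f : BYGraph.Euc n → ℝ)
    (hΩ : BYGraph.RealizedInA_U g U Uₒ f ∨ BYGraph.RealizedInA_C g U Uₒ f) :
    BYGraph.brownYorkMass U f = 0 ↔ BYGraph.MemA_C g U := by
  rcases hΩ with ⟨hA, hf⟩ | ⟨rfl, hC, hf⟩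
  · refine iff_of_false (hA.brownYorkMass_ne_zero hn) ?_
    rintro ⟨f₂, hC, hf₂⟩
    obtain ⟨c, hc⟩ := hC.constant
    obtain ⟨ψ, hψ, hψ'⟩ := BYGraph.exists_isometric_transition
      hA.isConnected.nonempty.closure hf hf₂ hc
    have hT : BYGraph.IsIsometricTransition U Uₒ f ψ := ⟨hψ, hψ'⟩
    exact hA.not_constant (hT.exists_eq_const (by omega) hA.toIsCompactGraph)
  · exact iff_of_true (hC.brownYorkMass_eq_zero hn) ⟨f, hC, hf⟩
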